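/- Let $n\ge 1$ and $\rho_n=\frac{n+1}{2}$. For a positive definite $y\in \mathrm{Sym}_n(\mathbb R)$ and $T\in \mathrm{Sym}_n(\mathbb R)$ with $\det T\neq 0$, Shimura's confluent hypergeometric function is $$\eta^{(n)}(y,T,\alpha,\beta)=\int_{\substack{u\in \mathrm{Sym}_n(\mathbb R)\\ u>-T,\ u>T}} e^{-\mathrm{tr}(uy)}\det(u+T)^{\alpha-\rho_n}\det(u-T)^{\beta-\rho_n}\,du,\qquad du=\prod_{i\le j}du_{ij}.$$ The integral converges absolutely for $\mathrm{Re}(\alpha)>\rho_n-1$ and $\mathrm{Re}(\beta)>\rho_n-1$. If $T$ has signature $(n-j,j)$, then $\eta^{(n)}(y,T,\cdot,\cdot)$ continues analytically to all $(\alpha,\beta)\in\mathbb C^2$ at which no factor of $$\prod_{i=j}^{n-1}\Gamma\big(\beta-\tfrac i2\big)\prod_{i=n-j}^{n-1}\Gamma\big(\alpha-\tfrac i2\big)$$ has a pole; call such a pair regular for $T$. The continuation is again denoted by $\eta^{(n)}$, and $\eta^{(0)}=1$. **Theorem.** Let $$T=\begin{pmatrix}T_1&T_{12}\\ {}^tT_{12}&T_2\end{pmatrix}\in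 \mathrm{Sym}_n(\mathbb R),\quad \det T\ne 0,\qquad y=\begin{pmatrix}y_1&y_{12}\\ {}^ty_{12}&y_2\end{pmatrix}\in \mathrm{Sym}_n(\mathbb R),\quad y>0,$$ with $T_1,y_1\in\mathbb R$, $T_{12},y_{12}\in\mathbb R^{1\times (n-1)}$ and $T_2,y_2\in \mathrm{Sym}_{n-1}(\mathbb R)$, and let $(\alpha,\beta)\in\mathbb C^2$ be regular for $T$. Keep $y_{12}$ and $y_2$ fixed and let $y_1\to\infty$. If $T_1\le 0$, then $$\lim_{y_1\to\infty}e^{T_1y_1}y_1^{\beta}\,\eta^{(n)}(y,T,\alpha,\beta)=0.$$ If $T_1>0$, put $\tilde T_2=T_2-{}^tT_{12}T_1^{-1}T_{12}$; then $$\lim_{y_1\to\infty}e^{T_1y_1}y_1^{\beta}\,\eta^{(n)}(y,T,\alpha,\beta)=e^{-2T_{12}{}^ty_{12}+\mathrm{tr}((\tilde T_2-T_2)y_2)}\;\Gamma(\beta+1-\rho_n)\,\pi^{\frac{n-1}{2}}\,(2T_1)^{\alpha-\rho_n}\;\eta^{(n-1)}\big(y_2,\tilde T_2,\alpha-\tfrac12,\beta\big).$$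 -/

import Mathlib

open Filter Topology MeasureTheory Matrix

noncomputable section

namespace Confluent

/-- `ρ_n = (n + 1) / 2`. -/
def rho (n : ℕ) : ℝ := ((n : ℝ) + 1) / 2

/-- The real symmetric `n × n` matrix with entries `x_{ij} = x_{ji} = c {i, j}`. The coordinates
are indexed by unordered pairs, so this identifies `Sym_n(ℝ)` with `ℝ^{n(n+1)/2}` through the
entries `x_{ij}`, `i ≤ j`. -/
def symMat {n : ℕ} (c : Sym2 (Fin n) → ℝ) : Matrix (Fin n) (Fin n) ℝ :=
  Matrix.of fun i j => c s(i, j)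

/-- The symmetric block matrix with rows `(a, b)` and `(ᵗb, d)`. -/
def blockSym {m : ℕ} (a : ℝ) (b : Fin m → ℝ) (d : Matrix (Fin m) (Fin m) ℝ) :
    Matrix (Fin (m + 1)) (Fin (m + 1)) ℝ :=
  Matrix.of (vecCons (vecCons a b) fun i => vecCons (b i) (d i))

/-- The domain `{u ∈ Sym_n(ℝ) : u > -T, u > T}`, in the coordinates of `symMat`. -/
def etaDomain (n : ℕ) (T : Matrix (Fin n) (Fin n) ℝ) : Set (Sym2 (Fin n) → ℝ) :=
  {c | (symMat c + T).PosDef ∧ (symMat c - T).PosDef}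

/-- `e^{-tr(uy)} det(u + T)^{α - ρ_n} det(u - T)^{β - ρ_n}`. -/
def etaIntegrand (n : ℕ) (y T : Matrix (Fin n) (Fin n) ℝ) (α β : ℂ)
    (c : Sym2 (Fin n) → ℝ) : ℂ :=
  (Real.exp (-(symMat c * y).trace) : ℂ) *
    ((symMat c + T).det : ℂ) ^ (α - (rho n : ℂ)) *
    ((symMat c - T).det : ℂ) ^ (β - (rho n : ℂ))

/-- The integral defining `η^{(n)}(y, T, α, β)` in its domain of convergence, with respect to the
Lebesgue measure `∏_{i ≤ j} du_{ij}`. -/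
def etaIntegral (n : ℕ) (y T : Matrix (Fin n) (Fin n) ℝ) (α β : ℂ) : ℂ :=
  ∫ c in etaDomain n T, etaIntegrand n y T α β c

/-- The domain `Re α > ρ_n - 1`, `Re β > ρ_n - 1` of convergence. -/
def convDomain (n : ℕ) : Set (ℂ × ℂ) :=
  {p | rho n - 1 < p.1.re ∧ rho n - 1 < p.2.re}

/-- The number `j` in the signature `(n - j, j)` of a regular real symmetric matrix `T`: the
maximal dimension of a subspace on which the quadratic form `x ↦ ᵗx T x` is negative definite. -/
def negIndex {n : ℕ} (T : Matrix (Fin n) (Fin n) ℝ) : ℕ :=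
  sigNeg T.toQuadraticForm'

/-- For `T` of signature `(n - j, j)`: the pairs `(α, β)` at which no factor of the gamma product
`Γ_{n-j}(β - j/2) Γ_j(α - (n-j)/2)`, that is, of
`∏_{j ≤ i < n} Γ(β - i/2) ∏_{n-j ≤ i < n} Γ(α - i/2)`, has a pole. It is the complement of the
polar lines of `η^{(n)}(y, T, ·, ·)`; it is open and connected, and it contains the domain of
convergence. -/
def regularSet (n j : ℕ) : Set (ℂ × ℂ) :=
  {p | (∀ i k : ℕ, j ≤ i → i < n → p.2 - (i : ℂ) / 2 ≠ -(k : ℂ)) ∧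
    (∀ i k : ℕ, n - j ≤ i → i < n → p.1 - (i : ℂ) / 2 ≠ -(k : ℂ))}

/-- `F` is the analytic continuation of `(α, β) ↦ η^{(n)}(y, T, α, β)` from the domain of
convergence of the integral to the complement of the polar lines. -/
def IsEtaContinuation (n : ℕ) (y T : Matrix (Fin n) (Fin n) ℝ) (F : ℂ × ℂ → ℂ) : Prop :=
  DifferentiableOn ℂ F (regularSet n (negIndex T)) ∧
    ∀ p ∈ convDomain n, F p = etaIntegral n y T p.1 p.2

/-- The integral converges (absolutely) on the domain of convergence and has an analytic
continuation to the complement of the polar lines. -/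
def EtaDefined (n : ℕ) (y T : Matrix (Fin n) (Fin n) ℝ) : Prop :=
  (∀ p ∈ convDomain n, IntegrableOn (etaIntegrand n y T p.1 p.2) (etaDomain n T)) ∧
    ∃ F : ℂ × ℂ → ℂ, IsEtaContinuation n y T F

open scoped Classical in
/-- `η^{(n)}(y, T, α, β)`, continued analytically in `(α, β)`. By the identity theorem the value at
a point of `regularSet n (negIndex T)` does not depend on the choice. -/
def eta (n : ℕ) (y T : Matrix (Fin n) (Fin n) ℝ) (α β : ℂ) : ℂ :=
  if h : ∃ F : ℂ × ℂ → ℂ, IsEtaContinuation n y T F then h.choose (α, β) else 0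

end Confluent

end

namespace Confluent

/-! Reduction. Write T = h (E/2) ᵗh with E diagonal and substitute u = h (v + E/2) ᵗh. Then u - T
and u + T become h v ᵗh and h (v + E) ᵗh, and η becomes an explicit factor times J(a, b), the
integral of e^{-tr(v y')} det(v + E)^a det(v)^b over {v > 0, v + E > 0}, where y' = ᵗh y h, a = α -
ρ_n and b = β - ρ_n (`DiagFamily.etaIntegral_eq`).

Continuation. The limit is also wanted where the integral diverges, so the continuation has to be
controlled as y and E vary. Let V be the set of negative entries of E. On the block V one has v = (v
+ E) + |E|, so the minor of v on V is bounded below by the product of the |E_i|. By Jacobi's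
complementary minor formula det(v)^b is therefore an invertible weight times det(v)^{b+1} times the
minor of the inverse of v on the complement of V. A Cayley-type identity (`sum_rowsDeriv`) and
integration by parts remove the rows of this minor one at a time, each at the price of a division by
b + 1 + i/2 (`ConeFamily.exists_JW_recursion`, `ConeFamily.rep_step`). Exchanging the roles of v and
v + E raises a in the same way. After N rounds J(a, b) is a finite sum of r_i(a, b) times integrals
with exponents a + N, b + N and weights f_i (`DiagFamily.rep_shift`). The r_i are holomorphic off
the polar lines and do not depend on y or E. The f_i are polynomials in the entries of v and y, in
the inverses of the entries of E and in the inverses of two normalized minors that are at least 1.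
This gives the continuation; absolute convergence in the full range then follows from Landau's
lemma, applied to the logarithms of the determinants.

Case T₁ ≤ 0. The variable y₁ enters the kernel only through exp(-y₁ w), where w is the first
diagonal entry of u - T, and the 2 × 2 minors of u - T and u + T bound w below by a constant divided
by the size of v. So every term of the sum decays faster than any power of y₁, while e^{T₁ y₁} is
cancelled exactly by the factor e^{-tr(Ty)}.

Case T₁ > 0. Split off T₁ by a Schur complement and scale the first coordinate by y₁^{-1/2}. The
first entry of E is then 2 T₁ y₁ and tends to infinity, the others diagonalize the Schur complement
of T₁, and ᵗh y h converges to a block diagonal matrix. As the weights involve E only through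
inverses, dominated convergence applies to each term, and the continued integrals converge to a
holomorphic function of the exponents (`Degenerates.exists_tendsto_cont`). For exponents with
positive real part the limit is computed directly: integrating out the first row of v gives a
Gaussian integral and a Gamma integral (`Degenerates.limJ_one`). The identity theorem carries this
value to all regular exponents (`Degenerates.tendsto_cont`). -/

/-- The coordinate space of symmetric matrices. -/
abbrev Coord (n : ℕ) := Sym2 (Fin n) → ℝ

/-! ### Symmetric matrices in coordinates, and exponential decay on cones -/

section Basic
variable {n : ℕ}

lemma symMat_apply (c : Coord n) (i j : Fin n) : symMat c i j = c s(i, j) := rfl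

lemma symMat_add (c d : Coord n) : symMat (c + d) = symMat c + symMat d := rfl

lemma symMat_smul (t : ℝ) (c : Coord n) : symMat (t • c) = t • symMat c := rfl

lemma symMat_isSymm (c : Coord n) : (symMat c).IsSymm := by
  ext i j
  simp [symMat_apply, Sym2.eq_swap]

lemma symMat_isHermitian (c : Coord n) : (symMat c).IsHermitian := by
  ext i j
  simp [symMat_apply, Sym2.eq_swap]

lemma symMat_injective : Function.Injective (symMat (n := n)) := by
  intro c d h
  ext e
  induction e with
  | _ i j => exact congrFun (congrFun h i) j

/-- The coordinates of a symmetric matrix (the upper triangular entries). -/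
noncomputable def symCoord (M : Matrix (Fin n) (Fin n) ℝ) : Coord n :=
  fun e => Sym2.lift ⟨fun i j => (M i j + M j i) / 2, fun i j => by beta_reduce; rw [add_comm]⟩ e

lemma symMat_symCoord {M : Matrix (Fin n) (Fin n) ℝ} (h : M.IsSymm) : symMat (symCoord M) = M := by
  ext i j
  have := h.apply i j
  simp [symMat_apply, symCoord, this]

lemma continuous_symMat : Continuous (symMat (n := n)) := by
  refine continuous_matrix fun i j => ?_
  exact continuous_apply _

/-- The direction in coordinate space with matrix `(e_i e_jᵗ + e_j e_iᵗ) / 2`. -/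
noncomputable def symDir (i j : Fin n) : Coord n := symCoord (Matrix.single i j 1)

lemma symMat_symDir (i j a b : Fin n) :
    symMat (symDir i j) a b =
      ((if i = a ∧ j = b then 1 else 0) + (if i = b ∧ j = a then 1 else 0)) / 2 := by
  simp [symMat_apply, symDir, symCoord, Matrix.single_apply]

lemma posDef_iff_sphere {M : Matrix (Fin n) (Fin n) ℝ} (hM : M.IsHermitian) :
    M.PosDef ↔ ∀ v ∈ Metric.sphere (0 : Fin n → ℝ) 1, 0 < v ⬝ᵥ M *ᵥ v := by
  rw [posDef_iff_dotProduct_mulVec]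
  constructor
  · rintro ⟨-, h⟩ v hv
    have : v ≠ 0 := by
      rintro rfl
      simp at hv
    simpa using h this
  · intro h
    refine ⟨hM, fun v hv => ?_⟩
    have h0 : 0 < ‖v‖ := norm_pos_iff.2 hv
    have := h (‖v‖⁻¹ • v) (by simp [norm_smul, h0.ne'])
    rw [mulVec_smul, smul_dotProduct, dotProduct_smul, smul_eq_mul, smul_eq_mul] at this
    have h1 : 0 < ‖v‖⁻¹ := inv_pos.2 h0
    simpa using (mul_pos_iff_of_pos_left h1).1 ((mul_pos_iff_of_pos_left h1).1 this)

/-- Positive definiteness is positivity of the quadratic form on the unit sphere; since the sphere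
is compact, positivity persists for all nearby parameters. -/
lemma isOpen_posDef {X : Type*} [TopologicalSpace X] {M : X → Matrix (Fin n) (Fin n) ℝ}
    (hc : Continuous M) (hM : ∀ x, (M x).IsHermitian) : IsOpen {x | (M x).PosDef} := by
  rw [isOpen_iff_mem_nhds]
  intro x hx
  have key : ∀ᶠ z in 𝓝 x, ∀ v ∈ Metric.sphere (0 : Fin n → ℝ) 1, 0 < v ⬝ᵥ M z *ᵥ v := by
    apply (isCompact_sphere _ _).eventually_forall_of_forall_eventually
    intro v hv
    have h1 := (posDef_iff_sphere (hM x)).1 hx v hv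
    have h2 : Continuous fun p : X × (Fin n → ℝ) => p.2 ⬝ᵥ M p.1 *ᵥ p.2 :=
      continuous_snd.dotProduct ((hc.comp continuous_fst).matrix_mulVec continuous_snd)
    exact (h2.tendsto (x, v)).eventually (lt_mem_nhds h1)
  filter_upwards [key] with z hz
  exact (posDef_iff_sphere (hM z)).2 hz

-- The trace of X Y is the trace of √Y X √Y, which is positive semidefinite.
open scoped MatrixOrder in
lemma trace_mul_nonneg {X Y : Matrix (Fin n) (Fin n) ℝ} (hX : X.PosSemidef) (hY : Y.PosSemidef) :
    0 ≤ (X * Y).trace := by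
  have hB : (CFC.sqrt Y).PosSemidef := (CFC.sqrt_nonneg Y).posSemidef
  have h := (hX.mul_mul_conjTranspose_same (CFC.sqrt Y)).trace_nonneg
  have hY' : CFC.sqrt Y * CFC.sqrt Y = Y := CFC.sqrt_mul_sqrt_self Y hY.nonneg
  rw [hB.1.eq, mul_assoc, trace_mul_comm, mul_assoc, hY'] at h
  exact h

lemma exists_posSemidef_sub {y : Matrix (Fin n) (Fin n) ℝ} (hy : y.PosDef) :
    ∃ δ : ℝ, 0 < δ ∧ (y - δ • (1 : Matrix (Fin n) (Fin n) ℝ)).PosSemidef := by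
  have ho : IsOpen {t : ℝ | (y - t • (1 : Matrix (Fin n) (Fin n) ℝ)).PosDef} := by
    apply isOpen_posDef (by fun_prop)
    intro t
    exact hy.1.sub (by simp [IsHermitian])
  have h0 : (0 : ℝ) ∈ {t : ℝ | (y - t • (1 : Matrix (Fin n) (Fin n) ℝ)).PosDef} := by simpa using hy
  obtain ⟨ε, hε, h⟩ := Metric.isOpen_iff.1 ho 0 h0
  refine ⟨ε / 2, by positivity, (h ?_).posSemidef⟩
  simp [abs_of_pos hε, hε]

/-- Testing the form on e_i + e_j and e_i - e_j bounds 2|M_ij| by M_ii + M_jj. -/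
lemma abs_apply_le_trace {M : Matrix (Fin n) (Fin n) ℝ} (hM : M.PosSemidef) (i j : Fin n) :
    |M i j| ≤ M.trace := by
  have hd : ∀ k, 0 ≤ M k k := fun k => hM.diag_nonneg
  have hle : ∀ k, M k k ≤ M.trace := fun k =>
    Finset.single_le_sum (f := fun k => M k k) (fun k _ => hd k) (Finset.mem_univ k)
  have hs : M j i = M i j := by simpa using hM.1.apply i j
  have q : ∀ t : ℝ, 0 ≤ M i i + t * (2 * M i j) + t ^ 2 * M j j := by
    intro t
    have := hM.dotProduct_mulVec_nonneg (Pi.single i 1 + t • Pi.single j 1)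
    simp [mulVec_add, mulVec_smul, add_dotProduct, dotProduct_add, hs] at this
    nlinarith [this]
  have h1 := q 1
  have h2 := q (-1)
  have := hle i
  have := hle j
  rw [abs_le]
  constructor <;> linarith

/-- `1 + ∑ |c_e|`. -/
noncomputable def csize (c : Coord n) : ℝ := 1 + ∑ e, |c e|

lemma one_le_csize (c : Coord n) : 1 ≤ csize c := by
  unfold csize
  have : 0 ≤ ∑ e, |c e| := Finset.sum_nonneg fun _ _ => abs_nonneg _
  linarith

lemma csize_pos (c : Coord n) : 0 < csize c := zero_lt_one.trans_le (one_le_csize c)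

lemma abs_le_csize (c : Coord n) (e : Sym2 (Fin n)) : |c e| ≤ csize c := by
  unfold csize
  have := Finset.single_le_sum (f := fun e => |c e|) (fun e _ => abs_nonneg _) (Finset.mem_univ e)
  linarith

lemma continuous_csize : Continuous (csize (n := n)) := by
  unfold csize
  fun_prop

/-- Uniform exponential decay of `e^{-tr(uy)}` on a translated cone. -/
lemma exists_trace_bound {y : Matrix (Fin n) (Fin n) ℝ} (hy : y.PosDef)
    {A : Matrix (Fin n) (Fin n) ℝ} :
    ∃ δ : ℝ, 0 < δ ∧ ∃ η : ℝ, 0 < η ∧ ∃ C : ℝ, ∀ y' : Matrix (Fin n) (Fin n) ℝ,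
      (∀ i j, |y' i j - y i j| ≤ η) → ∀ c : Coord n, (symMat c + A).PosSemidef →
        -(symMat c * y').trace ≤ C - δ * csize c := by
  obtain ⟨δ, hδ, hy'⟩ := exists_posSemidef_sub hy
  -- The summand 1 keeps N and K positive when n = 0.
  set N : ℝ := (n : ℝ) ^ 2 + 1
  set K : ℝ := Fintype.card (Sym2 (Fin n)) + 1
  have hN : 0 < N := by positivity
  have hK : 0 < K := by positivity
  set a : ℝ := ∑ i, ∑ j, |A i j|
  have ha : ∀ i j, |A i j| ≤ a := fun i j =>
    (Finset.single_le_sum (f := fun j => |A i j|) (fun j _ => abs_nonneg _)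
      (Finset.mem_univ j)).trans
    (Finset.single_le_sum (f := fun i => ∑ j, |A i j|)
      (fun i _ => Finset.sum_nonneg fun j _ => abs_nonneg _) (Finset.mem_univ i))
  set b : ℝ := ∑ i, ∑ j, |A i j| * (|y j i| + 1)
  -- For M = u + A one has tr(My) ≥ δ tr M and all |M_ij| ≤ tr M. So a perturbation of y by δ/(2N)
  -- in each entry costs at most half of δ tr M. The other half is converted into decay in `csize`
  -- through `csize c ≤ 1 + K a + K tr M`. The bound 1 on the perturbation controls tr(A y').
  refine ⟨δ / (2 * K), by positivity, min 1 (δ / (2 * N)), by positivity,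
    b + δ / (2 * K) * (1 + K * a), ?_⟩
  intro y' hyy c hc
  set M := symMat c + A with hM
  have htr0 : 0 ≤ M.trace := hc.trace_nonneg
  have e1 : (symMat c * y').trace = (M * y).trace + (M * (y' - y)).trace - (A * y').trace := by
    rw [hM, mul_sub, trace_sub, add_mul, add_mul, trace_add, trace_add]
    ring
  have e2 : δ * M.trace ≤ (M * y).trace := by
    have := trace_mul_nonneg hc hy'
    rw [mul_sub, trace_sub] at this
    simp at this
    linarith
  have e3 : |(M * (y' - y)).trace| ≤ δ / 2 * M.trace := by
    calc |(M * (y' - y)).trace| ≤ ∑ i : Fin n, ∑ j : Fin n, M.trace * (δ / (2 * N)) := by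
          unfold trace
          refine (Finset.abs_sum_le_sum_abs _ _).trans (Finset.sum_le_sum fun i _ => ?_)
          simp only [diag_apply, mul_apply]
          refine (Finset.abs_sum_le_sum_abs _ _).trans (Finset.sum_le_sum fun j _ => ?_)
          rw [abs_mul]
          have := (hyy j i).trans (min_le_right _ _)
          exact mul_le_mul (abs_apply_le_trace hc i j) (by simpa using this) (abs_nonneg _) htr0
      _ = (n : ℝ) ^ 2 * (M.trace * (δ / (2 * N))) := by simp; ring
      _ ≤ N * (M.trace * (δ / (2 * N))) := by
          apply mul_le_mul_of_nonneg_right _ (by positivity)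
          simp [N]
      _ = δ / 2 * M.trace := by field_simp
  have e4 : |(A * y').trace| ≤ b := by
    unfold trace
    refine (Finset.abs_sum_le_sum_abs _ _).trans (Finset.sum_le_sum fun i _ => ?_)
    simp only [diag_apply, mul_apply]
    refine (Finset.abs_sum_le_sum_abs _ _).trans (Finset.sum_le_sum fun j _ => ?_)
    rw [abs_mul]
    refine mul_le_mul_of_nonneg_left ?_ (abs_nonneg _)
    have h1 := (hyy j i).trans (min_le_left _ _)
    have h2 : y' j i = (y' j i - y j i) + y j i := by ring
    rw [h2]
    exact (abs_add_le _ _).trans (by linarith)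
  have e5 : csize c ≤ 1 + K * a + K * M.trace := by
    unfold csize
    have : ∑ e, |c e| ≤ ∑ e : Sym2 (Fin n), (M.trace + a) := by
      refine Finset.sum_le_sum fun e _ => ?_
      induction e with
      | _ i j =>
        have h1 := abs_apply_le_trace hc i j
        have h2 : c s(i, j) = M i j - A i j := by simp [hM, symMat_apply]
        rw [h2]
        exact (abs_sub _ _).trans (by linarith [ha i j])
    have ha0 : 0 ≤ a := Finset.sum_nonneg fun i _ => Finset.sum_nonneg fun j _ => abs_nonneg _
    simp at this
    have hKc : (Fintype.card (Sym2 (Fin n)) : ℝ) ≤ K := by simp [K]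
    have : (Fintype.card (Sym2 (Fin n)) : ℝ) * (M.trace + a) ≤ K * (M.trace + a) :=
      mul_le_mul_of_nonneg_right hKc (by positivity)
    simp at *
    linarith
  have e6 : δ / (2 * K) * csize c ≤ δ / (2 * K) * (1 + K * a) + δ / 2 * M.trace := by
    have := mul_le_mul_of_nonneg_left e5 (show 0 ≤ δ / (2 * K) by positivity)
    have h : δ / (2 * K) * (K * M.trace) = δ / 2 * M.trace := by field_simp
    linarith
  have := abs_le.1 e3
  have := abs_le.1 e4
  linarith

lemma integrable_exp_neg_mul_abs {δ : ℝ} (hδ : 0 < δ) :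
    Integrable fun t : ℝ => Real.exp (-δ * |t|) := by
  have h1 : IntegrableOn (fun t : ℝ => Real.exp (-δ * |t|)) (Set.Ioi 0) :=
    (integrableOn_exp_mul_Ioi (neg_lt_zero.2 hδ) 0).congr_fun
      (fun t ht => by simp only [abs_of_pos (Set.mem_Ioi.1 ht)]) measurableSet_Ioi
  have h2 : IntegrableOn (fun t : ℝ => Real.exp (-δ * |t|)) (Set.Iic 0) :=
    (integrableOn_exp_mul_Iic hδ 0).congr_fun
      (fun t ht => by simp only [abs_of_nonpos (Set.mem_Iic.1 ht), neg_mul_neg]) measurableSet_Iic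
  rw [← integrableOn_univ, ← Set.Iic_union_Ioi (a := (0 : ℝ))]
  exact h2.union h1

lemma integrable_exp_neg_csize {δ : ℝ} (hδ : 0 < δ) :
    Integrable fun c : Coord n => Real.exp (-δ * csize c) := by
  have h1 : Integrable fun t : ℝ => Real.exp (-δ * |t|) := integrable_exp_neg_mul_abs hδ
  have h2 : Integrable fun c : Coord n => ∏ e, Real.exp (-δ * |c e|) :=
    Integrable.fintype_prod (f := fun _ t => Real.exp (-δ * |t|)) fun _ => h1
  convert h2.const_mul (Real.exp (-δ)) using 2 with c
  rw [← Real.exp_sum, ← Real.exp_add]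
  congr 1
  unfold csize
  rw [mul_add, Finset.mul_sum, mul_one]

lemma pow_le_exp {δ : ℝ} (hδ : 0 < δ) (N : ℕ) :
    ∃ C > 0, ∀ s : ℝ, 0 ≤ s → s ^ N ≤ C * Real.exp (δ * s) := by
  refine ⟨(N.factorial : ℝ) / δ ^ N, by positivity, fun s hs => ?_⟩
  have := Real.pow_div_factorial_le_exp (δ * s) (by positivity) N
  rw [div_le_iff₀ (by positivity), mul_pow] at this
  rw [div_mul_eq_mul_div, le_div_iff₀ (by positivity)]
  linarith

lemma integrable_csize_pow_mul_exp {δ : ℝ} (hδ : 0 < δ) (N : ℕ) :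
    Integrable fun c : Coord n => csize c ^ N * Real.exp (-δ * csize c) := by
  obtain ⟨C, hC, h⟩ := pow_le_exp (half_pos hδ) N
  refine ((integrable_exp_neg_csize (n := n) (half_pos hδ)).const_mul C).mono' ?_ ?_
  · exact ((continuous_csize.pow N).mul
      (Real.continuous_exp.comp (continuous_const.mul continuous_csize))).aestronglyMeasurable
  · refine Eventually.of_forall fun c => ?_
    have h0 := (csize_pos c).le
    rw [Real.norm_of_nonneg (by positivity)]
    calc csize c ^ N * Real.exp (-δ * csize c)
        ≤ C * Real.exp (δ / 2 * csize c) * Real.exp (-δ * csize c) :=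
          mul_le_mul_of_nonneg_right (h _ h0) (Real.exp_pos _).le
      _ = C * Real.exp (-(δ / 2) * csize c) := by
          rw [mul_assoc, ← Real.exp_add]
          congr 2
          ring

end Basic

end Confluent

namespace Confluent

/-! ### The Cayley-type identity for minors of the inverse matrix -/

section Algebra
variable {n : ℕ}

/-- The matrix with rows `R i` for `i ∈ S` and unit rows `e_{σ i}` for the other `i`. -/
def rowsMat (R : Matrix (Fin n) (Fin n) ℝ) (S : Finset (Fin n)) (σ : Fin n → Fin n) :
    Matrix (Fin n) (Fin n) ℝ :=
  Matrix.of fun i => if i ∈ S then R i else Pi.single (σ i) 1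

/-- The determinant as a linear function of one row. -/
noncomputable def detRow (M : Matrix (Fin n) (Fin n) ℝ) (i : Fin n) : (Fin n → ℝ) →ₗ[ℝ] ℝ :=
  detRowAlternating.toMultilinearMap.toLinearMap M i

lemma detRow_apply (M : Matrix (Fin n) (Fin n) ℝ) (i : Fin n) (v : Fin n → ℝ) :
    detRow M i v = (M.updateRow i v).det := rfl

/-- The determinant as a bilinear function of two rows. -/
noncomputable def detRows (M : Matrix (Fin n) (Fin n) ℝ) (k i : Fin n) (v w : Fin n → ℝ) : ℝ :=
  ((M.updateRow k v).updateRow i w).det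

lemma detRows_right (M : Matrix (Fin n) (Fin n) ℝ) (k i : Fin n) (v w : Fin n → ℝ) :
    detRows M k i v w = detRow (M.updateRow k v) i w := rfl

lemma detRows_left {M : Matrix (Fin n) (Fin n) ℝ} {k i : Fin n} (h : i ≠ k) (v w : Fin n → ℝ) :
    detRows M k i v w = detRow (M.updateRow i w) k v := by
  rw [detRow_apply, detRows]
  congr 1
  exact Function.update_comm h.symm v w M

lemma detRows_self {M : Matrix (Fin n) (Fin n) ℝ} {k i : Fin n} (h : i ≠ k) (v : Fin n → ℝ) :
    detRows M k i v v = 0 := by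
  apply det_zero_of_row_eq h
  rw [updateRow_self, updateRow_ne h.symm, updateRow_self]

lemma detRows_swap {M : Matrix (Fin n) (Fin n) ℝ} {k i : Fin n} (h : i ≠ k) (v w : Fin n → ℝ) :
    detRows M k i v w = -detRows M k i w v := by
  have h0 := detRows_self (M := M) h (v + w)
  have e1 : detRows M k i (v + w) (v + w) =
      detRows M k i v v + detRows M k i v w + (detRows M k i w v + detRows M k i w w) := by
    rw [detRows_left h, map_add, ← detRows_left h, ← detRows_left h]
    simp only [detRows_right, map_add]
  rw [e1, detRows_self h, detRows_self h] at h0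
  linarith

lemma sum_smul_single (v : Fin n → ℝ) : ∑ j, v j • (Pi.single j 1 : Fin n → ℝ) = v := by
  ext l
  simp [Finset.sum_apply, Pi.single_apply]

lemma sum_detRows_left {M : Matrix (Fin n) (Fin n) ℝ} {k i : Fin n} (h : i ≠ k)
    (v w : Fin n → ℝ) : ∑ j, v j * detRows M k i (Pi.single j 1) w = detRows M k i v w := by
  conv_rhs => rw [← sum_smul_single v, detRows_left h, map_sum]
  refine Finset.sum_congr rfl fun j _ => ?_
  rw [detRows_left h, map_smul, smul_eq_mul]

/-- Expanding R j in the standard basis contracts the symmetric R with a determinant that is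
alternating in its two rows, so the sum equals its own negative. -/
lemma sum_detRows_symm {M R : Matrix (Fin n) (Fin n) ℝ} (hR : R.IsSymm) {k i : Fin n}
    (h : i ≠ k) : ∑ j, detRows M k i (Pi.single j 1) (R j) = 0 := by
  have e : ∀ j, detRows M k i (Pi.single j 1) (R j) =
      ∑ l, R j l * detRows M k i (Pi.single j 1) (Pi.single l 1) := by
    intro j
    conv_lhs => rw [← sum_smul_single (R j), detRows_right, map_sum]
    refine Finset.sum_congr rfl fun l _ => ?_
    rw [detRows_right, map_smul, smul_eq_mul]
  have e2 : ∑ j, detRows M k i (Pi.single j 1) (R j) =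
      -∑ j, detRows M k i (Pi.single j 1) (R j) := by
    simp only [e]
    conv_lhs => rw [Finset.sum_comm]
    rw [← Finset.sum_neg_distrib]
    refine Finset.sum_congr rfl fun j _ => ?_
    rw [← Finset.sum_neg_distrib]
    refine Finset.sum_congr rfl fun l _ => ?_
    rw [detRows_swap h, hR.apply j l]
    ring
  linarith

/-- The matrix `(g e_jᵗ + e_j gᵗ) / 2`. -/
noncomputable def symOuter (g : Fin n → ℝ) (j : Fin n) : Matrix (Fin n) (Fin n) ℝ :=
  Matrix.of fun a b => (g a * (if j = b then 1 else 0) + g b * (if j = a then 1 else 0)) / 2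

/-- Partial derivatives in the directions `symDir i j`, weighted by g_i and summed over i, thus
collapse to a single derivative in the direction `symOuter g j`. -/
lemma symOuter_eq_sum (g : Fin n → ℝ) (j : Fin n) :
    symOuter g j = ∑ i, g i • symMat (symDir i j) := by
  ext a b
  simp only [symOuter, of_apply, Matrix.sum_apply, Matrix.smul_apply, symMat_symDir, smul_eq_mul]
  simp only [mul_div_assoc', mul_add, add_div, Finset.sum_add_distrib, ite_and]
  congr 1 <;> rw [← Finset.sum_div] <;> simp

lemma symOuter_eq_vecMulVec (g : Fin n → ℝ) (j : Fin n) :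
    symOuter g j =
      (1 / 2 : ℝ) • (vecMulVec g (Pi.single j 1) + vecMulVec (Pi.single j 1) g) := by
  ext a b
  simp [symOuter, vecMulVec_apply, Pi.single_apply, eq_comm]
  ring

/-- The inverse has derivative -R V R in the direction V, so up to sign this is the row that
replaces row i when a minor of the inverse is differentiated. -/
lemma mul_symOuter_mul {R : Matrix (Fin n) (Fin n) ℝ} (hR : R.IsSymm) (g : Fin n → ℝ)
    (i j : Fin n) :
    (R * symOuter g j * R) i = (1 / 2 : ℝ) • ((R *ᵥ g) i • R j + R i j • (R *ᵥ g)) := by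
  ext l
  have h1 : (Pi.single j 1 : Fin n → ℝ) ᵥ* R = R j := by ext; simp
  have h2 : R *ᵥ (Pi.single j 1 : Fin n → ℝ) = fun a => R a j := by ext; simp
  have h3 : g ᵥ* R = R *ᵥ g := by
    rw [← vecMul_transpose, hR.eq]
  rw [symOuter_eq_vecMulVec, mul_smul_comm, smul_mul_assoc, mul_add, add_mul, mul_vecMulVec,
    mul_vecMulVec, vecMulVec_mul, vecMulVec_mul, h1, h2, h3]
  simp [vecMulVec_apply]

lemma trace_mul_symOuter {R : Matrix (Fin n) (Fin n) ℝ} (hR : R.IsSymm) (g : Fin n → ℝ)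
    (j : Fin n) : (R * symOuter g j).trace = (R *ᵥ g) j := by
  have h3 : g ᵥ* R = R *ᵥ g := by
    rw [← vecMul_transpose, hR.eq]
  rw [symOuter_eq_vecMulVec, mul_smul_comm, mul_add, mul_vecMulVec, mul_vecMulVec, trace_smul,
    trace_add, trace_vecMulVec, trace_vecMulVec]
  have h2 : R *ᵥ (Pi.single j 1 : Fin n → ℝ) = fun a => R a j := by ext; simp
  have h4 : (fun a => R a j) ⬝ᵥ g = (R *ᵥ g) j := by
    simp only [dotProduct, mulVec]
    exact Finset.sum_congr rfl fun a _ => by rw [hR.apply]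
  rw [h2, h4]
  simp
  ring

/-- The derivative of `det (rowsMat A⁻¹ S σ)` in the direction `V`, as a function of `R = A⁻¹`. -/
noncomputable def rowsDeriv (R : Matrix (Fin n) (Fin n) ℝ) (S : Finset (Fin n))
    (σ : Fin n → Fin n) (V : Matrix (Fin n) (Fin n) ℝ) : ℝ :=
  ∑ i ∈ S, detRow (rowsMat R S σ) i (-(R * V * R) i)

lemma rowsDeriv_sum (R : Matrix (Fin n) (Fin n) ℝ) (S : Finset (Fin n)) (σ : Fin n → Fin n)
    (g : Fin n → ℝ) (V : Fin n → Matrix (Fin n) (Fin n) ℝ) :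
    rowsDeriv R S σ (∑ i, g i • V i) = ∑ i, g i * rowsDeriv R S σ (V i) := by
  unfold rowsDeriv
  simp_rw [Finset.mul_sum (s := S)]
  rw [Finset.sum_comm]
  refine Finset.sum_congr rfl fun i _ => ?_
  have : -(R * (∑ i, g i • V i) * R) i = ∑ l, g l • (-(R * V l * R) i) := by
    ext b
    simp [Matrix.mul_sum, Matrix.sum_mul, Matrix.sum_apply]
  refine (congrArg (detRow (rowsMat R S σ) i) this).trans ?_
  rw [map_sum]
  exact Finset.sum_congr rfl fun l _ => by rw [map_smul, smul_eq_mul]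

lemma rowsMat_erase {R : Matrix (Fin n) (Fin n) ℝ} {S : Finset (Fin n)} {σ : Fin n → Fin n}
    {k : Fin n} (j : Fin n) :
    rowsMat R (S.erase k) (Function.update σ k j) = (rowsMat R S σ).updateRow k (Pi.single j 1) := by
  ext a b
  by_cases h : a = k
  · subst h
    simp [rowsMat]
  · simp [rowsMat, h]

/-- The Cayley-type identity behind the recursion: the divergence of the minors. -/
lemma sum_rowsDeriv {R : Matrix (Fin n) (Fin n) ℝ} (hR : R.IsSymm) {S : Finset (Fin n)}
    {σ : Fin n → Fin n} {k : Fin n} (hk : k ∈ S) {g : Fin n → ℝ} {ε : ℝ}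
    (hg : R *ᵥ g = R k + ε • Pi.single k 1) :
    ∑ j, rowsDeriv R (S.erase k) (Function.update σ k j) (symOuter g j) =
      ((S.card : ℝ) - 1) / 2 * ((rowsMat R S σ).det +
        ε * (rowsMat R (S.erase k) (Function.update σ k k)).det) := by
  set N := rowsMat R S σ with hN
  have hNk : N k = R k := by ext; simp [hN, rowsMat, hk]
  unfold rowsDeriv
  rw [Finset.sum_comm]
  -- Since i ≠ k, the entry (R g)_i is R_ik, and the differentiated row i is -(R_ik R_j + R_ij R
  -- g)/2. Summed over j with e_j in row k, the first part vanishes by symmetry of R. The second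
  -- puts R_i in row k and R g = R_k + ε e_k in row i; interchanging these two rows restores the
  -- minor and cancels the sign. There are |S| - 1 such i.
  have key : ∀ i ∈ S.erase k, ∑ j, detRow (rowsMat R (S.erase k) (Function.update σ k j)) i
      (-(R * symOuter g j * R) i) =
      1 / 2 * (N.det + ε * (rowsMat R (S.erase k) (Function.update σ k k)).det) := by
    intro i hi
    obtain ⟨hik, hiS⟩ := Finset.mem_erase.1 hi
    have hNi : N i = R i := by ext; simp [hN, rowsMat, hiS]
    have hgi : (R *ᵥ g) i = R i k := by
      rw [hg]
      simp [hik, hR.apply]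
    have e1 : ∀ j, detRow (rowsMat R (S.erase k) (Function.update σ k j)) i
        (-(R * symOuter g j * R) i) =
        -(1 / 2) * (R i k * detRows N k i (Pi.single j 1) (R j) +
          R i j * detRows N k i (Pi.single j 1) (R *ᵥ g)) := by
      intro j
      rw [rowsMat_erase, ← hN, ← detRows_right]
      have : -(R * symOuter g j * R) i =
          (-(1 / 2) : ℝ) • (R i k • R j + R i j • (R *ᵥ g)) := by
        rw [mul_symOuter_mul hR, hgi, neg_smul]
      rw [this, detRows_right, map_smul, map_add, map_smul, map_smul]
      rfl
    simp only [e1]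
    rw [← Finset.mul_sum, Finset.sum_add_distrib, ← Finset.mul_sum, sum_detRows_symm hR hik,
      sum_detRows_left hik, hg, detRows_right, map_add, map_smul, ← detRows_right,
      ← detRows_right, detRows_swap hik (R i) (R k), detRows_swap hik (R i) (Pi.single k 1)]
    have e2 : detRows N k i (R k) (R i) = N.det := by
      rw [detRows, ← hNk, updateRow_eq_self, ← hNi, updateRow_eq_self]
    have e3 : detRows N k i (Pi.single k 1) (R i) =
        (rowsMat R (S.erase k) (Function.update σ k k)).det := by
      rw [rowsMat_erase, ← hN, detRows]
      congr 1
      rw [← hNi]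
      have : N i = (N.updateRow k (Pi.single k 1)) i := by rw [updateRow_ne hik]
      rw [this, updateRow_eq_self]
    rw [e2, e3, smul_eq_mul]
    ring
  rw [Finset.sum_congr rfl key, Finset.sum_const, Finset.card_erase_of_mem hk, nsmul_eq_mul,
    Nat.cast_sub (Finset.one_le_card.2 ⟨k, hk⟩)]
  push_cast
  ring

/-- Expansion of row k in the standard basis. In the recursion it reassembles the full minor from
the minors in which row k has been replaced by a unit row. -/
lemma det_rowsMat_expand {R : Matrix (Fin n) (Fin n) ℝ} {S : Finset (Fin n)}
    {σ : Fin n → Fin n} {k : Fin n} (hk : k ∈ S) :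
    ∑ j, R k j * (rowsMat R (S.erase k) (Function.update σ k j)).det = (rowsMat R S σ).det := by
  simp only [rowsMat_erase, ← detRow_apply]
  have : ∑ j, R k j * detRow (rowsMat R S σ) k (Pi.single j 1) =
      detRow (rowsMat R S σ) k (∑ j, R k j • Pi.single j 1) := by
    rw [map_sum]
    exact Finset.sum_congr rfl fun j _ => by rw [map_smul, smul_eq_mul]
  rw [this, sum_smul_single, detRow_apply]
  congr 1
  have : R k = rowsMat R S σ k := by ext; simp [rowsMat, hk]
  rw [this, updateRow_eq_self]

end Algebra

/-! ### Directional derivatives of determinants, inverses and complex powers -/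

section Calculus
variable {n : ℕ}

lemma det_eq_sum_rows (M : Matrix (Fin n) (Fin n) ℝ) :
    M.det = ∑ τ : Equiv.Perm (Fin n), ((τ.sign : ℤ) : ℝ) * ∏ i, M i (τ i) := by
  rw [← det_transpose, det_apply']
  rfl

lemma hasDerivAt_det {M : ℝ → Matrix (Fin n) (Fin n) ℝ} {M' : Matrix (Fin n) (Fin n) ℝ} {t : ℝ}
    (h : ∀ i j, HasDerivAt (fun s => M s i j) (M' i j) t) :
    HasDerivAt (fun s => (M s).det) (∑ i, detRow (M t) i (M' i)) t := by
  simp only [detRow_apply, det_eq_sum_rows]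
  rw [Finset.sum_comm]
  refine HasDerivAt.fun_sum fun τ _ => ?_
  rw [← Finset.mul_sum]
  refine HasDerivAt.const_mul _ ?_
  have := HasDerivAt.fun_finsetProd (u := Finset.univ) (f := fun i s => M s i (τ i))
    (f' := fun i => M' i (τ i)) (x := t) fun i _ => h i (τ i)
  convert this using 1
  refine Finset.sum_congr rfl fun i _ => ?_
  rw [← Finset.prod_erase_mul _ _ (Finset.mem_univ i), smul_eq_mul, updateRow_self]
  congr 1
  refine Finset.prod_congr rfl fun j hj => ?_
  rw [updateRow_ne (Finset.ne_of_mem_erase hj)]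

lemma hasDerivAt_add_smul (A V : Matrix (Fin n) (Fin n) ℝ) (i j : Fin n) :
    HasDerivAt (fun t : ℝ => (A + t • V) i j) (V i j) 0 := by
  simp only [Matrix.add_apply, Matrix.smul_apply, smul_eq_mul]
  simpa using ((hasDerivAt_id (0 : ℝ)).mul_const (V i j)).const_add (A i j)

/-- After factoring out A this is det(1 + tN) = 1 + t tr N + O(t²), with a polynomial remainder. -/
lemma hasDerivAt_det_line {A : Matrix (Fin n) (Fin n) ℝ} (hA : A.det ≠ 0)
    (V : Matrix (Fin n) (Fin n) ℝ) :
    HasDerivAt (fun t : ℝ => (A + t • V).det) (A.det * (A⁻¹ * V).trace) 0 := by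
  have hu : IsUnit A.det := isUnit_iff_ne_zero.2 hA
  set p := (1 + (Polynomial.X : Polynomial ℝ) • (A⁻¹ * V).map Polynomial.C).det.divX.divX
  have e : ∀ t : ℝ, (A + t • V).det =
      A.det * (1 + (A⁻¹ * V).trace * t + Polynomial.eval t p * t ^ 2) := by
    intro t
    rw [← det_one_add_smul, ← det_mul, mul_add, mul_smul_comm, mul_nonsing_inv_cancel_left A V hu,
      mul_one]
  simp only [e]
  refine HasDerivAt.const_mul _ ?_
  have h1 : HasDerivAt (fun t : ℝ => 1 + (A⁻¹ * V).trace * t) ((A⁻¹ * V).trace) 0 := by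
    simpa using ((hasDerivAt_id (0 : ℝ)).const_mul ((A⁻¹ * V).trace)).const_add 1
  have h2 : HasDerivAt (fun t : ℝ => Polynomial.eval t p * t ^ 2)
      (Polynomial.eval 0 p.derivative * 0 ^ 2 + Polynomial.eval 0 p * (2 * 0)) 0 := by
    have := (p.hasDerivAt 0).fun_mul (hasDerivAt_pow 2 (0 : ℝ))
    simpa using this
  simpa using h1.fun_add h2

lemma continuousAt_inv_line {A : Matrix (Fin n) (Fin n) ℝ} (hA : A.det ≠ 0)
    (V : Matrix (Fin n) (Fin n) ℝ) :
    ContinuousAt (fun t : ℝ => (A + t • V)⁻¹) 0 := by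
  simp only [Matrix.inv_def, Ring.inverse_eq_inv']
  have hc : Continuous fun t : ℝ => A + t • V := by fun_prop
  refine ContinuousAt.fun_smul (f := fun t : ℝ => (A + t • V).det⁻¹)
    (g := fun t : ℝ => (A + t • V).adjugate) ?_ hc.matrix_adjugate.continuousAt
  exact hc.matrix_det.continuousAt.inv₀ (by simpa using hA)

lemma hasDerivAt_inv_line {A : Matrix (Fin n) (Fin n) ℝ} (hA : A.det ≠ 0)
    (V : Matrix (Fin n) (Fin n) ℝ) (i j : Fin n) :
    HasDerivAt (fun t : ℝ => (A + t • V)⁻¹ i j) (-(A⁻¹ * V * A⁻¹) i j) 0 := by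
  have hc : Continuous fun t : ℝ => A + t • V := by fun_prop
  rw [hasDerivAt_iff_tendsto_slope]
  have h0 : ∀ᶠ t in 𝓝[≠] (0 : ℝ), (A + t • V).det ≠ 0 := by
    refine nhdsWithin_le_nhds ?_
    have := hc.matrix_det.continuousAt (x := (0 : ℝ))
    exact this.eventually_ne (by simpa using hA)
  -- By the resolvent identity the difference quotient is exactly this expression, so continuity of
  -- the inverse at A suffices.
  have e : ∀ᶠ t in 𝓝[≠] (0 : ℝ), -((A + t • V)⁻¹ * V * A⁻¹) i j =
      slope (fun t : ℝ => (A + t • V)⁻¹ i j) 0 t := by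
    filter_upwards [h0, self_mem_nhdsWithin] with t ht ht0
    have hu : IsUnit (A + t • V).det := isUnit_iff_ne_zero.2 ht
    have hu' : IsUnit A.det := isUnit_iff_ne_zero.2 hA
    have h1 : (A + t • V)⁻¹ - A⁻¹ = -(t • ((A + t • V)⁻¹ * V * A⁻¹)) := by
      have : (A + t • V)⁻¹ * (A - (A + t • V)) * A⁻¹ = (A + t • V)⁻¹ - A⁻¹ := by
        rw [mul_sub, sub_mul, nonsing_inv_mul _ hu, one_mul, mul_assoc, mul_nonsing_inv _ hu',
          mul_one]
      rw [← this]
      simp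
    have h2 : (A + t • V)⁻¹ i j - A⁻¹ i j = -(t * ((A + t • V)⁻¹ * V * A⁻¹) i j) := by
      have := congrFun (congrFun h1 i) j
      simpa using this
    rw [slope_def_field]
    simp only [zero_smul, add_zero, sub_zero]
    rw [h2, eq_div_iff (by simpa using ht0)]
    ring
  refine Tendsto.congr' e ?_
  have hR := continuousAt_inv_line hA V
  have h3 : ContinuousAt (fun t : ℝ => -((A + t • V)⁻¹ * V * A⁻¹) i j) 0 := by
    have : ContinuousAt (fun t : ℝ => (A + t • V)⁻¹ * V * A⁻¹) 0 :=
      (hR.mul continuousAt_const).mul continuousAt_const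
    have h4 : ContinuousAt (fun t : ℝ => ((A + t • V)⁻¹ * V * A⁻¹) i j) 0 :=
      (continuous_id.matrix_elem i j).continuousAt.comp this
    exact h4.neg
  have := h3.tendsto.mono_left (nhdsWithin_le_nhds (s := {0}ᶜ))
  simpa using this

lemma hasDerivAt_det_rowsMat {A : Matrix (Fin n) (Fin n) ℝ} (hA : A.det ≠ 0)
    (V : Matrix (Fin n) (Fin n) ℝ) (S : Finset (Fin n)) (σ : Fin n → Fin n) :
    HasDerivAt (fun t : ℝ => (rowsMat (A + t • V)⁻¹ S σ).det) (rowsDeriv A⁻¹ S σ V) 0 := by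
  have h := hasDerivAt_det (M := fun t : ℝ => rowsMat (A + t • V)⁻¹ S σ)
    (M' := Matrix.of fun i => if i ∈ S then -(A⁻¹ * V * A⁻¹) i else 0) (t := 0) ?_
  · convert h using 1
    unfold rowsDeriv
    rw [← Finset.sum_filter_add_sum_filter_not Finset.univ (· ∈ S)]
    have h1 : ∑ i with i ∉ S, detRow (rowsMat (A + (0 : ℝ) • V)⁻¹ S σ) i
        ((Matrix.of fun i => if i ∈ S then -(A⁻¹ * V * A⁻¹) i else 0 :
          Matrix (Fin n) (Fin n) ℝ) i) = 0 := by
      refine Finset.sum_eq_zero fun i hi => ?_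
      have : ((Matrix.of fun i => if i ∈ S then -(A⁻¹ * V * A⁻¹) i else 0 :
          Matrix (Fin n) (Fin n) ℝ) i) = 0 := by
        ext
        simp [(Finset.mem_filter.1 hi).2]
      rw [this, map_zero]
    rw [h1, add_zero, Finset.filter_mem_eq_inter, Finset.univ_inter]
    refine Finset.sum_congr rfl fun i hi => ?_
    congr 1
    · simp
    · ext; simp [hi]
  · intro i j
    by_cases hi : i ∈ S
    · simpa [rowsMat, hi] using hasDerivAt_inv_line hA V i j
    · simpa [rowsMat, hi] using hasDerivAt_const (0 : ℝ) _

lemma hasDerivAt_ofReal_cpow {p : ℝ → ℝ} {p' : ℝ} {t : ℝ} (hp : HasDerivAt p p' t) (h0 : 0 < p t)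
    (s : ℂ) : HasDerivAt (fun x => ((p x : ℝ) : ℂ) ^ s) (s * ((p' / p t : ℝ) : ℂ) * (p t : ℂ) ^ s) t := by
  have hne : (p t : ℂ) ≠ 0 := by exact_mod_cast h0.ne'
  have h1 : HasDerivAt (fun z : ℂ => z ^ s) (s * (p t : ℂ) ^ (s - 1) * 1) (p t : ℂ) :=
    (hasDerivAt_id _).cpow_const (Or.inl (by simpa using h0))
  have h : HasDerivAt (fun x => ((p x : ℝ) : ℂ) ^ s) ((p' : ℂ) • (s * (p t : ℂ) ^ (s - 1) * 1)) t :=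
    HasDerivAt.scomp (g₁ := fun z : ℂ => z ^ s) (h := fun y => ((p y : ℝ) : ℂ)) t h1 hp.ofReal_comp
  have e : s * ((p' / p t : ℝ) : ℂ) * (p t : ℂ) ^ s = (p' : ℂ) • (s * (p t : ℂ) ^ (s - 1) * 1) := by
    rw [Complex.cpow_sub _ _ hne, smul_eq_mul, Complex.cpow_one]
    push_cast
    field_simp
  rw [e]
  exact h

end Calculus

end Confluent

namespace Confluent

/-! ### Kernels and weights of polynomial growth on an intersection of two cones -/

section Cone
variable {n : ℕ}

/-- The intersection of two translates of the cone of positive definite matrices. -/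
def cone (A B : Matrix (Fin n) (Fin n) ℝ) : Set (Coord n) :=
  {c | (symMat c + A).PosDef ∧ (symMat c + B).PosDef}

lemma isOpen_cone {A B : Matrix (Fin n) (Fin n) ℝ} (hA : A.IsHermitian) (hB : B.IsHermitian) :
    IsOpen (cone A B) := by
  refine IsOpen.inter ?_ ?_
  · exact isOpen_posDef (continuous_symMat.add continuous_const) fun c =>
      (symMat_isHermitian c).add hA
  · exact isOpen_posDef (continuous_symMat.add continuous_const) fun c =>
      (symMat_isHermitian c).add hB

lemma posSemidef_of_mem_closure {A B : Matrix (Fin n) (Fin n) ℝ} {c : Coord n}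
    (hA : A.IsHermitian) (hc : c ∈ closure (cone A B)) : (symMat c + A).PosSemidef := by
  refine PosSemidef.of_dotProduct_mulVec_nonneg ((symMat_isHermitian c).add hA) fun x => ?_
  have hcl : IsClosed {c : Coord n | 0 ≤ star x ⬝ᵥ (symMat c + A) *ᵥ x} := by
    refine isClosed_le continuous_const ?_
    exact continuous_const.dotProduct
      ((continuous_symMat.add continuous_const).matrix_mulVec continuous_const)
  exact (closure_minimal (fun d hd => hd.1.posSemidef.dotProduct_mulVec_nonneg x) hcl) hc

lemma cone_comm (A B : Matrix (Fin n) (Fin n) ℝ) : cone A B = cone B A :=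
  Set.ext fun _ => and_comm

/-- Continuous functions on `D` of at most polynomial growth. -/
def PolyBdd (D : Set (Coord n)) (h : Coord n → ℂ) : Prop :=
  ContinuousOn h D ∧ ∃ C : ℝ, ∃ N : ℕ, ∀ c ∈ D, ‖h c‖ ≤ C * csize c ^ N

namespace PolyBdd
variable {D : Set (Coord n)} {g h : Coord n → ℂ}

lemma exists_bound (hh : PolyBdd D h) :
    ∃ C : ℝ, ∃ N : ℕ, 0 ≤ C ∧ ∀ c ∈ D, ‖h c‖ ≤ C * csize c ^ N := by
  obtain ⟨-, C, N, hC⟩ := hh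
  refine ⟨|C|, N, abs_nonneg _, fun c hc => (hC c hc).trans ?_⟩
  exact mul_le_mul_of_nonneg_right (le_abs_self C) (pow_nonneg (csize_pos c).le N)

lemma mul (hg : PolyBdd D g) (hh : PolyBdd D h) : PolyBdd D fun c => g c * h c := by
  obtain ⟨C, N, hC0, hC⟩ := hg.exists_bound
  obtain ⟨C', N', hC0', hC'⟩ := hh.exists_bound
  refine ⟨hg.1.mul hh.1, C * C', N + N', fun c hc => ?_⟩
  rw [norm_mul]
  have hs := (csize_pos c).le
  calc ‖g c‖ * ‖h c‖ ≤ (C * csize c ^ N) * (C' * csize c ^ N') :=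
        mul_le_mul (hC c hc) (hC' c hc) (norm_nonneg _) (by positivity)
    _ = C * C' * csize c ^ (N + N') := by rw [pow_add]; ring

lemma add (hg : PolyBdd D g) (hh : PolyBdd D h) : PolyBdd D fun c => g c + h c := by
  obtain ⟨C, N, hC0, hC⟩ := hg.exists_bound
  obtain ⟨C', N', hC0', hC'⟩ := hh.exists_bound
  refine ⟨hg.1.add hh.1, C + C', max N N', fun c hc => (norm_add_le _ _).trans ?_⟩
  rw [add_mul]
  have h1 := one_le_csize c
  refine add_le_add ((hC c hc).trans ?_) ((hC' c hc).trans ?_)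
  · exact mul_le_mul_of_nonneg_left (pow_le_pow_right₀ h1 (le_max_left _ _)) hC0
  · exact mul_le_mul_of_nonneg_left (pow_le_pow_right₀ h1 (le_max_right _ _)) hC0'

lemma const (z : ℂ) : PolyBdd D fun _ => z :=
  ⟨continuousOn_const, ‖z‖, 0, fun c _ => by simp⟩

lemma coord (e : Sym2 (Fin n)) : PolyBdd D fun c => (c e : ℂ) :=
  ⟨by fun_prop, 1, 1, fun c _ => by simpa using abs_le_csize c e⟩

lemma sum {ι : Type*} {s : Finset ι} {f : ι → Coord n → ℂ} (hf : ∀ i ∈ s, PolyBdd D (f i)) :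
    PolyBdd D fun c => ∑ i ∈ s, f i c := by
  classical
  induction s using Finset.induction_on with
  | empty => simpa using const 0
  | insert a s ha ih =>
    simp only [Finset.sum_insert ha]
    exact (hf a (Finset.mem_insert_self a s)).add (ih fun i hi => hf i (Finset.mem_insert_of_mem hi))

lemma prod {ι : Type*} {s : Finset ι} {f : ι → Coord n → ℂ} (hf : ∀ i ∈ s, PolyBdd D (f i)) :
    PolyBdd D fun c => ∏ i ∈ s, f i c := by
  classical
  induction s using Finset.induction_on with
  | empty => simpa using const 1
  | insert a s ha ih =>
    simp only [Finset.prod_insert ha]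
    exact (hf a (Finset.mem_insert_self a s)).mul (ih fun i hi => hf i (Finset.mem_insert_of_mem hi))

lemma det {M : Coord n → Matrix (Fin n) (Fin n) ℝ}
    (hM : ∀ i j, PolyBdd D fun c => (M c i j : ℂ)) : PolyBdd D fun c => ((M c).det : ℂ) := by
  simp only [det_eq_sum_rows]
  push_cast
  exact sum fun τ _ => (const _).mul (prod fun i _ => hM i (τ i))

lemma congr (hh : PolyBdd D h) (e : ∀ c ∈ D, g c = h c) : PolyBdd D g := by
  obtain ⟨h1, C, N, h2⟩ := hh
  exact ⟨h1.congr e, C, N, fun c hc => by rw [e c hc]; exact h2 c hc⟩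

lemma symMat_add (A : Matrix (Fin n) (Fin n) ℝ) (i j : Fin n) :
    PolyBdd D fun c => ((symMat c + A) i j : ℂ) := by
  simpa [symMat_apply] using (coord s(i, j)).add (const (A i j : ℂ))

lemma adjugate (A : Matrix (Fin n) (Fin n) ℝ) (i j : Fin n) :
    PolyBdd D fun c => ((symMat c + A).adjugate i j : ℂ) := by
  simp only [adjugate_apply]
  refine det fun a b => ?_
  by_cases h : a = j
  · subst h
    simpa using const _
  · simpa [updateRow_ne h] using symMat_add A a b

end PolyBdd

/-- The kernel `e^{-tr(uy)} (p det(u + A))^b (q det(u + B))^a`. -/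
noncomputable def kern (A B : Matrix (Fin n) (Fin n) ℝ) (p q : ℝ) (y : Matrix (Fin n) (Fin n) ℝ)
    (a b : ℂ) (c : Coord n) : ℂ :=
  (Real.exp (-(symMat c * y).trace) : ℂ) * ((q * (symMat c + B).det : ℝ) : ℂ) ^ a *
    ((p * (symMat c + A).det : ℝ) : ℂ) ^ b

variable {A B y : Matrix (Fin n) (Fin n) ℝ} {p q : ℝ}

lemma continuous_trace_symMat : Continuous fun c : Coord n => (symMat c * y).trace :=
  (continuous_symMat.matrix_mul continuous_const).matrix_trace

lemma continuous_det_symMat (A : Matrix (Fin n) (Fin n) ℝ) :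
    Continuous fun c : Coord n => (symMat c + A).det :=
  (continuous_symMat.add continuous_const).matrix_det

lemma continuousOn_kern (hp : 0 < p) (hq : 0 < q) (a b : ℂ) :
    ContinuousOn (kern A B p q y a b) (cone A B) := by
  unfold kern
  refine ContinuousOn.mul (ContinuousOn.mul ?_ ?_) ?_
  · exact (Complex.continuous_ofReal.comp
      (Real.continuous_exp.comp continuous_trace_symMat.neg)).continuousOn
  · intro c hc
    have h : 0 < q * (symMat c + B).det := mul_pos hq hc.2.det_pos
    refine ContinuousWithinAt.cpow ?_ continuousWithinAt_const (Or.inl (by simpa using h))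
    exact (Complex.continuous_ofReal.comp
      (continuous_const.mul (continuous_det_symMat B))).continuousWithinAt
  · intro c hc
    have h : 0 < p * (symMat c + A).det := mul_pos hp hc.1.det_pos
    refine ContinuousWithinAt.cpow ?_ continuousWithinAt_const (Or.inl (by simpa using h))
    exact (Complex.continuous_ofReal.comp
      (continuous_const.mul (continuous_det_symMat A))).continuousWithinAt

lemma norm_kern (hp : 0 < p) (hq : 0 < q) {c : Coord n} (hc : c ∈ cone A B) (a b : ℂ) :
    ‖kern A B p q y a b c‖ = Real.exp (-(symMat c * y).trace) *
      (q * (symMat c + B).det) ^ a.re * (p * (symMat c + A).det) ^ b.re := by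
  unfold kern
  rw [norm_mul, norm_mul, Complex.norm_cpow_eq_rpow_re_of_pos (mul_pos hq hc.2.det_pos),
    Complex.norm_cpow_eq_rpow_re_of_pos (mul_pos hp hc.1.det_pos), Complex.norm_real,
    Real.norm_of_nonneg (Real.exp_pos _).le]

lemma exists_det_rpow_bound (A : Matrix (Fin n) (Fin n) ℝ) (p : ℝ) {r : ℝ} (hr : 0 ≤ r) :
    ∃ C : ℝ, ∃ N : ℕ, 0 ≤ C ∧ ∀ c : Coord n, 0 < p * (symMat c + A).det →
      (p * (symMat c + A).det) ^ r ≤ C * csize c ^ N := by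
  have h : PolyBdd Set.univ fun c : Coord n => ((p : ℂ) * ((symMat c + A).det : ℂ)) :=
    (PolyBdd.const _).mul (PolyBdd.det fun i j => PolyBdd.symMat_add A i j)
  obtain ⟨C, N, hC0, hC⟩ := h.exists_bound
  -- With C + 1 in place of C the bound on the base is at least 1, so the real exponent may be
  -- rounded up to a natural number.
  obtain ⟨k, hk⟩ := exists_nat_ge r
  refine ⟨(C + 1) ^ k, N * k, by positivity, fun c hc => ?_⟩
  have h1 := hC c (Set.mem_univ c)
  rw [← Complex.ofReal_mul, Complex.norm_real, Real.norm_of_nonneg hc.le] at h1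
  have hs : 1 ≤ csize c ^ N := one_le_pow₀ (one_le_csize c)
  have h2 : p * (symMat c + A).det ≤ (C + 1) * csize c ^ N := by
    rw [add_mul]
    linarith
  have h3 : 1 ≤ (C + 1) * csize c ^ N := by nlinarith
  calc (p * (symMat c + A).det) ^ r ≤ ((C + 1) * csize c ^ N) ^ r :=
        Real.rpow_le_rpow hc.le h2 hr
    _ ≤ ((C + 1) * csize c ^ N) ^ (k : ℝ) := Real.rpow_le_rpow_of_exponent_le h3 hk
    _ = (C + 1) ^ k * csize c ^ (N * k) := by rw [Real.rpow_natCast, mul_pow, pow_mul]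

/-- When the exponents have nonnegative real part, no power is singular at the boundary, and
polynomial growth is beaten by the exponential decay of the kernel. -/
lemma integrableOn_mul_kern (hA : A.IsHermitian) (hB : B.IsHermitian) (hp : 0 < p) (hq : 0 < q)
    (hy : y.PosDef) {h : Coord n → ℂ} (hh : PolyBdd (cone A B) h) {a b : ℂ} (ha : 0 ≤ a.re)
    (hb : 0 ≤ b.re) : IntegrableOn (fun c => h c * kern A B p q y a b c) (cone A B) := by
  obtain ⟨δ, hδ, η, hη, C, hC⟩ := exists_trace_bound hy (A := A)
  obtain ⟨C1, N1, hC1, h1⟩ := hh.exists_bound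
  obtain ⟨C2, N2, hC2, h2⟩ := exists_det_rpow_bound B q ha
  obtain ⟨C3, N3, hC3, h3⟩ := exists_det_rpow_bound A p hb
  have hm := (isOpen_cone hA hB).measurableSet
  refine Integrable.mono'
    (((integrable_csize_pow_mul_exp hδ (N1 + N2 + N3)).const_mul
      (C1 * C2 * C3 * Real.exp C)).integrableOn (s := cone A B)) ?_ ?_
  · exact (hh.1.mul (continuousOn_kern hp hq a b)).aestronglyMeasurable hm
  · refine (ae_restrict_iff' hm).2 (Eventually.of_forall fun c hc => ?_)
    rw [norm_mul, norm_kern hp hq hc]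
    have e1 : Real.exp (-(symMat c * y).trace) ≤ Real.exp C * Real.exp (-δ * csize c) := by
      rw [← Real.exp_add]
      apply Real.exp_le_exp.2
      have := hC y (by simp [hη.le]) c hc.1.posSemidef
      linarith
    have e2 := h2 c (mul_pos hq hc.2.det_pos)
    have e3 := h3 c (mul_pos hp hc.1.det_pos)
    have hs := (csize_pos c).le
    have p2 : 0 ≤ (q * (symMat c + B).det) ^ a.re :=
      Real.rpow_nonneg (mul_pos hq hc.2.det_pos).le _
    have p3 : 0 ≤ (p * (symMat c + A).det) ^ b.re :=
      Real.rpow_nonneg (mul_pos hp hc.1.det_pos).le _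
    calc ‖h c‖ * (Real.exp (-(symMat c * y).trace) * (q * (symMat c + B).det) ^ a.re *
          (p * (symMat c + A).det) ^ b.re)
        ≤ (C1 * csize c ^ N1) * ((Real.exp C * Real.exp (-δ * csize c)) * (C2 * csize c ^ N2) *
          (C3 * csize c ^ N3)) := by
          have := h1 c hc
          gcongr
      _ = C1 * C2 * C3 * Real.exp C * (csize c ^ (N1 + N2 + N3) * Real.exp (-δ * csize c)) := by
          rw [pow_add, pow_add]
          ring

/-- The logarithmic derivative of the kernel in the direction `v`. -/
noncomputable def kernLog (A B y : Matrix (Fin n) (Fin n) ℝ) (a b : ℂ)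
    (V : Matrix (Fin n) (Fin n) ℝ) (c : Coord n) : ℂ :=
  -((V * y).trace : ℂ) + a * (((symMat c + B)⁻¹ * V).trace : ℂ) +
    b * (((symMat c + A)⁻¹ * V).trace : ℂ)

lemma hasLineDerivAt_kern (hp : 0 < p) (hq : 0 < q) {c : Coord n} (hc : c ∈ cone A B) (a b : ℂ)
    (v : Coord n) : HasLineDerivAt ℝ (kern A B p q y a b)
      (kernLog A B y a b (symMat v) c * kern A B p q y a b c) c v := by
  unfold HasLineDerivAt kern
  have hs : ∀ (M : Matrix (Fin n) (Fin n) ℝ) (t : ℝ),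
      symMat (c + t • v) + M = (symMat c + M) + t • symMat v := by
    intro M t
    rw [Confluent.symMat_add, symMat_smul]
    abel
  have hdet : ∀ (M : Matrix (Fin n) (Fin n) ℝ) (r : ℝ), 0 < r → (symMat c + M).PosDef → ∀ s : ℂ,
      HasDerivAt (fun t : ℝ => ((r * (symMat (c + t • v) + M).det : ℝ) : ℂ) ^ s)
        (s * (((symMat c + M)⁻¹ * symMat v).trace : ℂ) * ((r * (symMat c + M).det : ℝ) : ℂ) ^ s)
        0 := by
    intro M r hr hM s
    have h1 : HasDerivAt (fun t : ℝ => r * (symMat (c + t • v) + M).det)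
        (r * ((symMat c + M).det * ((symMat c + M)⁻¹ * symMat v).trace)) 0 := by
      simp only [hs]
      exact (hasDerivAt_det_line hM.det_pos.ne' (symMat v)).const_mul r
    have h2 := hasDerivAt_ofReal_cpow h1 (by simpa using mul_pos hr hM.det_pos) s
    have e : r * ((symMat c + M).det * ((symMat c + M)⁻¹ * symMat v).trace) /
        (r * (symMat (c + (0 : ℝ) • v) + M).det) = ((symMat c + M)⁻¹ * symMat v).trace := by
      have := hM.det_pos.ne'
      have := hr.ne'
      simp only [zero_smul, add_zero]
      field_simp
    rw [e] at h2
    simpa using h2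
  have hexp : HasDerivAt (fun t : ℝ => ((Real.exp (-(symMat (c + t • v) * y).trace) : ℝ) : ℂ))
      (-((symMat v * y).trace : ℂ) * (Real.exp (-(symMat c * y).trace) : ℂ)) 0 := by
    have h1 : HasDerivAt (fun t : ℝ => -(symMat (c + t • v) * y).trace) (-(symMat v * y).trace)
        0 := by
      have e : ∀ t : ℝ, -(symMat (c + t • v) * y).trace =
          -(symMat c * y).trace + t * (-(symMat v * y).trace) := by
        intro t
        rw [Confluent.symMat_add, symMat_smul, add_mul, trace_add, smul_mul_assoc, trace_smul,
          smul_eq_mul]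
        ring
      simp only [e]
      simpa using ((hasDerivAt_id (0 : ℝ)).mul_const (-(symMat v * y).trace)).const_add (-(symMat c * y).trace)
    have h2 := h1.exp.ofReal_comp
    convert h2 using 1
    simp
    ring
  have h := (hexp.fun_mul (hdet B q hq hc.2 a)).fun_mul (hdet A p hp hc.1 b)
  simp only [zero_smul, add_zero] at h
  refine h.congr_deriv ?_
  unfold kernLog
  ring

end Cone

end Confluent

namespace Confluent

/-! ### Integration by parts on the cone -/

section IBP
variable {n : ℕ} {A B y : Matrix (Fin n) (Fin n) ℝ} {p q : ℝ}

lemma continuous_line (c v : Coord n) : Continuous fun t : ℝ => c + t • v := by fun_prop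

lemma differentiableAt_det_line (A : Matrix (Fin n) (Fin n) ℝ) (c v : Coord n) :
    DifferentiableAt ℝ (fun t : ℝ => (symMat (c + t • v) + A).det) 0 := by
  refine (hasDerivAt_det (M := fun t : ℝ => symMat (c + t • v) + A) (M' := symMat v)
    fun i j => ?_).differentiableAt
  have h := hasDerivAt_add_smul (symMat c + A) (symMat v) i j
  refine h.congr_of_eventuallyEq (Eventually.of_forall fun t => ?_)
  simp [Confluent.symMat_add, symMat_smul]
  ring

/-- The product of the two determinants vanishes to first order at the boundary of the cone. -/
lemma isBigO_det_mul_det (hA : A.IsHermitian) (hB : B.IsHermitian) {c : Coord n}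
    (hc : c ∈ closure (cone A B)) (hc' : c ∉ cone A B) (v : Coord n) :
    (fun t : ℝ => (symMat (c + t • v) + A).det * (symMat (c + t • v) + B).det) =O[𝓝 0]
      fun t : ℝ => t := by
  have h := (differentiableAt_det_line A c v).fun_mul (differentiableAt_det_line B c v)
  have h0 : (symMat c + A).det * (symMat c + B).det = 0 := by
    have hA' := posSemidef_of_mem_closure hA hc
    have hB' := posSemidef_of_mem_closure hB (cone_comm A B ▸ hc)
    by_contra hne
    exact hc' ⟨hA'.posDef_iff_det_ne_zero.2 (left_ne_zero_of_mul hne),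
      hB'.posDef_iff_det_ne_zero.2 (right_ne_zero_of_mul hne)⟩
  have := h.isBigO_sub
  simpa [h0] using this

lemma rpow_two_mul {P r : ℝ} (hP : 0 < P) : P ^ r = P ^ 2 * P ^ (r - 2) := by
  rw [← Real.rpow_natCast P 2, ← Real.rpow_add hP]
  congr 1
  push_cast
  ring

/-- At a boundary point at least one of the two determinants vanishes, so their product is O(t)
along the line. With both exponents of real part at least 2 the kernel is bounded by the square of
this product, hence O(t²). So the extension by zero is differentiable there as well, and no boundary
terms arise. -/
lemma hasDerivAt_indicator_line (hA : A.IsHermitian) (hB : B.IsHermitian) (hp : 0 < p)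
    (hq : 0 < q) {h : Coord n → ℂ} (hh : PolyBdd (cone A B) h) {a b : ℂ} (ha : 2 ≤ a.re)
    (hb : 2 ≤ b.re) {c : Coord n} (hc : c ∉ cone A B) (v : Coord n) :
    HasDerivAt (fun t : ℝ => (cone A B).indicator (fun c => h c * kern A B p q y a b c)
      (c + t • v)) 0 0 := by
  by_cases hcl : c ∈ closure (cone A B)
  swap
  · have h1 : ∀ᶠ t : ℝ in 𝓝 0, c + t • v ∈ (closure (cone A B))ᶜ :=
      (continuous_line c v).continuousAt.eventually
        (isClosed_closure.isOpen_compl.mem_nhds (by simpa using hcl))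
    refine (hasDerivAt_const (0 : ℝ) (0 : ℂ)).congr_of_eventuallyEq ?_
    filter_upwards [h1] with t ht
    exact Set.indicator_of_notMem (fun h' => ht (subset_closure h')) _
  obtain ⟨C, N, hC0, hC⟩ := hh.exists_bound
  set PA : ℝ → ℝ := fun t => p * (symMat (c + t • v) + A).det with hPA
  set PB : ℝ → ℝ := fun t => q * (symMat (c + t • v) + B).det with hPB
  have cPA : Continuous PA := continuous_const.mul
    ((continuous_det_symMat A).comp (continuous_line c v))
  have cPB : Continuous PB := continuous_const.mul
    ((continuous_det_symMat B).comp (continuous_line c v))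
  set K : ℝ → ℝ := fun t => C * csize (c + t • v) ^ N *
    Real.exp (-(symMat (c + t • v) * y).trace) * PB t ^ (a.re - 2) * PA t ^ (b.re - 2)
  have cK : Continuous K := by
    have h1 : Continuous fun t : ℝ => csize (c + t • v) :=
      continuous_csize.comp (continuous_line c v)
    have h2 : Continuous fun t : ℝ => (symMat (c + t • v) * y).trace :=
      continuous_trace_symMat.comp (continuous_line c v)
    have h3 : Continuous fun t => PB t ^ (a.re - 2) :=
      cPB.rpow_const fun t => Or.inr (by linarith)
    have h4 : Continuous fun t => PA t ^ (b.re - 2) :=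
      cPA.rpow_const fun t => Or.inr (by linarith)
    fun_prop
  -- Two powers of each determinant are split off; the remaining factor K has nonnegative exponents
  -- and is continuous in t.
  have bound : ∀ t : ℝ, ‖(cone A B).indicator (fun c => h c * kern A B p q y a b c) (c + t • v)‖ ≤
      ‖K t‖ * ‖((PB t * PA t) ^ 2 : ℝ)‖ := by
    intro t
    by_cases ht : c + t • v ∈ cone A B
    · have hPAt : 0 < PA t := mul_pos hp ht.1.det_pos
      have hPBt : 0 < PB t := mul_pos hq ht.2.det_pos
      have hs := (csize_pos (c + t • v)).le
      rw [Set.indicator_of_mem ht, norm_mul, norm_kern hp hq ht]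
      change ‖h (c + t • v)‖ * (_ * PB t ^ a.re * PA t ^ b.re) ≤ _
      rw [rpow_two_mul hPBt, rpow_two_mul hPAt, Real.norm_of_nonneg (by positivity),
        Real.norm_of_nonneg (by positivity)]
      calc ‖h (c + t • v)‖ * (Real.exp (-(symMat (c + t • v) * y).trace) *
            (PB t ^ 2 * PB t ^ (a.re - 2)) * (PA t ^ 2 * PA t ^ (b.re - 2)))
          ≤ (C * csize (c + t • v) ^ N) * (Real.exp (-(symMat (c + t • v) * y).trace) *
            (PB t ^ 2 * PB t ^ (a.re - 2)) * (PA t ^ 2 * PA t ^ (b.re - 2))) :=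
            mul_le_mul_of_nonneg_right (hC _ ht) (by positivity)
        _ = K t * (PB t * PA t) ^ 2 := by simp only [K]; ring
    · rw [Set.indicator_of_notMem ht, norm_zero]
      positivity
  have hO : (fun t : ℝ => PB t * PA t) =O[𝓝 0] fun t : ℝ => t := by
    have := (isBigO_det_mul_det hA hB hcl hc v).const_mul_left (p * q)
    refine this.congr_left fun t => ?_
    simp only [hPA, hPB]
    ring
  have hK : K =O[𝓝 0] fun _ => (1 : ℝ) := cK.continuousAt.isBigO_one ℝ
  have hF : (fun t : ℝ => (cone A B).indicator (fun c => h c * kern A B p q y a b c) (c + t • v))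
      =O[𝓝 0] fun t : ℝ => t ^ 2 := by
    have h1 : (fun t => K t * (PB t * PA t) ^ 2) =O[𝓝 0] fun t : ℝ => 1 * t ^ 2 := hK.mul (hO.pow 2)
    simp only [one_mul] at h1
    refine (Asymptotics.IsBigO.of_bound 1 (Eventually.of_forall fun t => ?_)).trans h1
    simpa [norm_mul] using bound t
  have ho : (fun t : ℝ => t ^ 2) =o[𝓝 0] fun t : ℝ => t :=
    Asymptotics.isLittleO_pow_id one_lt_two
  rw [hasDerivAt_iff_isLittleO]
  have := hF.trans_isLittleO ho
  simpa [Set.indicator_of_notMem hc] using this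

/-- Integration by parts on the cone. -/
lemma integral_lineDeriv_eq_zero (hA : A.IsHermitian) (hB : B.IsHermitian) (hp : 0 < p)
    (hq : 0 < q) (hy : y.PosDef) {h h' : Coord n → ℂ} (hh : PolyBdd (cone A B) h)
    (hh' : PolyBdd (cone A B) h') {v : Coord n}
    (hd : ∀ c ∈ cone A B, HasLineDerivAt ℝ h (h' c) c v) {a b : ℂ} (ha : 2 ≤ a.re)
    (hb : 2 ≤ b.re) :
    IntegrableOn (fun c => (h' c + h c * kernLog A B y a b (symMat v) c) * kern A B p q y a b c)
        (cone A B) ∧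
      ∫ c in cone A B, (h' c + h c * kernLog A B y a b (symMat v) c) * kern A B p q y a b c = 0 := by
  have hm := (isOpen_cone hA hB).measurableSet
  -- The extension by zero is line-differentiable at every point of the coordinate space, so
  -- integration by parts takes place on the whole space.
  set F : Coord n → ℂ := (cone A B).indicator fun c => h c * kern A B p q y a b c with hF
  set F' : Coord n → ℂ := (cone A B).indicator fun c =>
    (h' c + h c * kernLog A B y a b (symMat v) c) * kern A B p q y a b c with hF'
  have hder : ∀ c, HasLineDerivAt ℝ F (F' c) c v := by
    intro c
    by_cases hc : c ∈ cone A B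
    · have h1 : ∀ᶠ t : ℝ in 𝓝 0, c + t • v ∈ cone A B :=
        (continuous_line c v).continuousAt.eventually
          ((isOpen_cone hA hB).mem_nhds (by simpa using hc))
      have h2 : HasDerivAt (fun t : ℝ => h (c + t • v) * kern A B p q y a b (c + t • v))
          _ 0 := HasDerivAt.fun_mul (hd c hc) (hasLineDerivAt_kern hp hq hc a b v)
      have h3 : HasDerivAt (fun t : ℝ => F (c + t • v)) _ 0 := h2.congr_of_eventuallyEq (by
        filter_upwards [h1] with t ht
        exact Set.indicator_of_mem ht _)
      refine HasDerivAt.congr_deriv h3 ?_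
      rw [hF', Set.indicator_of_mem hc]
      simp only [zero_smul, add_zero]
      ring
    · have : F' c = 0 := Set.indicator_of_notMem hc _
      rw [this]
      exact hasDerivAt_indicator_line hA hB hp hq hh ha hb hc v
  have hI : Integrable F := (integrable_indicator_iff hm).2
    (integrableOn_mul_kern hA hB hp hq hy hh (by linarith) (by linarith))
  have hadj : ∀ (M : Matrix (Fin n) (Fin n) ℝ), PolyBdd (cone A B)
      fun c => (((symMat c + M).adjugate * symMat v).trace : ℂ) := by
    intro M
    simp only [trace, diag_apply, Matrix.mul_apply, Complex.ofReal_sum, Complex.ofReal_mul]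
    exact PolyBdd.sum fun i _ => PolyBdd.sum fun j _ =>
      (PolyBdd.adjugate M i j).mul (PolyBdd.const _)
  -- Replacing the inverse by the adjugate lowers the exponent by one. The weight becomes
  -- polynomial, and the derivative is integrable because the lowered exponent still has nonnegative
  -- real part.
  have hinv : ∀ (M : Matrix (Fin n) (Fin n) ℝ) (r : ℝ) (s : ℂ), 0 < r → M.PosDef →
      ((M⁻¹ * symMat v).trace : ℂ) * ((r * M.det : ℝ) : ℂ) ^ s =
      r * ((M.adjugate * symMat v).trace : ℂ) * ((r * M.det : ℝ) : ℂ) ^ (s - 1) := by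
    intro M r s hr hM
    have hne : ((r * M.det : ℝ) : ℂ) ≠ 0 := by exact_mod_cast (mul_pos hr hM.det_pos).ne'
    have hdne : (M.det : ℂ) ≠ 0 := by exact_mod_cast hM.det_pos.ne'
    have hrne : (r : ℂ) ≠ 0 := by exact_mod_cast hr.ne'
    rw [Complex.cpow_sub _ _ hne, Complex.cpow_one, Matrix.inv_def, Ring.inverse_eq_inv',
      smul_mul_assoc, trace_smul, smul_eq_mul]
    push_cast
    field_simp
  have hI' : IntegrableOn (fun c => (h' c + h c * kernLog A B y a b (symMat v) c) *
      kern A B p q y a b c) (cone A B) := by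
    have i1 := integrableOn_mul_kern hA hB hp hq hy
      (hh'.add (hh.mul (PolyBdd.const (-((symMat v * y).trace : ℂ)))))
      (show 0 ≤ a.re by linarith) (show 0 ≤ b.re by linarith)
    have i2 := integrableOn_mul_kern hA hB hp hq hy
      (hh.mul ((PolyBdd.const (a * q)).mul (hadj B))) (a := a - 1) (b := b)
      (show 0 ≤ (a - 1).re by simp; linarith) (show 0 ≤ b.re by linarith)
    have i3 := integrableOn_mul_kern hA hB hp hq hy
      (hh.mul ((PolyBdd.const (b * p)).mul (hadj A))) (a := a) (b := b - 1)
      (show 0 ≤ a.re by linarith) (show 0 ≤ (b - 1).re by simp; linarith)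
    refine ((i1.add i2).add i3).congr_fun (fun c hc => ?_) hm
    simp only [Pi.add_apply, kern, kernLog]
    have e2 := hinv _ q a hq hc.2
    have e3 := hinv _ p b hp hc.1
    linear_combination (-(h c * a * (Real.exp (-(symMat c * y).trace) : ℂ) *
        ((p * (symMat c + A).det : ℝ) : ℂ) ^ b)) * e2 -
      (h c * b * (Real.exp (-(symMat c * y).trace) : ℂ) *
        ((q * (symMat c + B).det : ℝ) : ℂ) ^ a) * e3
  refine ⟨hI', ?_⟩
  have hIF' : Integrable F' := (integrable_indicator_iff hm).2 hI'
  -- Integration by parts against the constant function 1: the integral of a derivative vanishes.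
  have key := integral_bilinear_hasLineDerivAt_right_eq_neg_left_of_integrable
    (μ := (volume : Measure (Coord n))) (f := F) (f' := F') (g := fun _ => (1 : ℂ))
    (g' := fun _ => (0 : ℂ)) (v := v) (B := ContinuousLinearMap.mul ℝ ℂ)
    (by simpa using hIF') (by simp) (by simpa using hI) (fun c _ => hder c)
    (fun c _ => hasDerivAt_const (0 : ℝ) (1 : ℂ))
  simp only [ContinuousLinearMap.mul_apply', mul_zero, integral_zero, mul_one] at key
  rw [← integral_indicator hm]
  exact neg_eq_zero.1 key.symm

end IBP

end Confluent

namespace Confluent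

/-! ### Weights with poles along det(u + A) = 0 -/

section Pole
variable {n : ℕ} {A B y : Matrix (Fin n) (Fin n) ℝ} {p q : ℝ}

/-- Functions that become of polynomial growth after multiplication by `(p det(u + A))^m`. -/
def PoleBdd (A B : Matrix (Fin n) (Fin n) ℝ) (p : ℝ) (m : ℕ) (w : Coord n → ℂ) : Prop :=
  PolyBdd (cone A B) fun c => w c * ((p * (symMat c + A).det : ℝ) : ℂ) ^ m

namespace PoleBdd
variable {m m' : ℕ} {w w' : Coord n → ℂ}

lemma det_polyBdd (D : Set (Coord n)) (A : Matrix (Fin n) (Fin n) ℝ) (p : ℝ) (k : ℕ) :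
    PolyBdd D fun c => ((p * (symMat c + A).det : ℝ) : ℂ) ^ k := by
  have h : PolyBdd D fun c => ((p * (symMat c + A).det : ℝ) : ℂ) := by
    simp only [Complex.ofReal_mul]
    exact (PolyBdd.const _).mul (PolyBdd.det fun i j => PolyBdd.symMat_add A i j)
  simpa using PolyBdd.prod (s := Finset.range k) fun _ _ => h

lemma mul (h : PoleBdd A B p m w) (h' : PoleBdd A B p m' w') :
    PoleBdd A B p (m + m') fun c => w c * w' c :=
  (PolyBdd.mul h h').congr fun c _ => by rw [pow_add]; ring

lemma mono (h : PoleBdd A B p m w) (hm : m ≤ m') : PoleBdd A B p m' w := by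
  refine (PolyBdd.mul h (det_polyBdd _ A p (m' - m))).congr fun c _ => ?_
  rw [mul_assoc, ← pow_add, Nat.add_sub_cancel' hm]

lemma of_polyBdd (h : PolyBdd (cone A B) w) : PoleBdd A B p 0 w := by
  simpa [PoleBdd] using h

lemma sum {ι : Type*} {s : Finset ι} {f : ι → Coord n → ℂ} (hf : ∀ i ∈ s, PoleBdd A B p m (f i)) :
    PoleBdd A B p m fun c => ∑ i ∈ s, f i c := by
  simp only [PoleBdd, Finset.sum_mul]
  exact PolyBdd.sum hf

lemma prod {ι : Type*} {s : Finset ι} {f : ι → Coord n → ℂ} (hf : ∀ i ∈ s, PoleBdd A B p m (f i)) :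
    PoleBdd A B p (s.card * m) fun c => ∏ i ∈ s, f i c := by
  have := PolyBdd.prod hf
  refine this.congr fun c _ => ?_
  rw [Finset.prod_mul_distrib, Finset.prod_const, ← pow_mul, mul_comm m]

lemma det {M : Coord n → Matrix (Fin n) (Fin n) ℝ}
    (hM : ∀ i j, PoleBdd A B p m fun c => (M c i j : ℂ)) :
    PoleBdd A B p (n * m) fun c => ((M c).det : ℂ) := by
  simp only [det_eq_sum_rows, Complex.ofReal_sum, Complex.ofReal_mul, Complex.ofReal_prod]
  refine sum fun τ _ => ?_
  have h1 := prod (s := Finset.univ) fun i _ => hM i (τ i)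
  rw [Finset.card_univ, Fintype.card_fin] at h1
  simpa using (of_polyBdd (PolyBdd.const _)).mul h1

lemma inv (i j : Fin n) : PoleBdd A B p 1 fun c => ((symMat c + A)⁻¹ i j : ℂ) := by
  refine ((PolyBdd.const (p : ℂ)).mul (PolyBdd.adjugate A i j)).congr fun c hc => ?_
  have h : (symMat c + A).det ≠ 0 := hc.1.det_pos.ne'
  beta_reduce
  rw [Matrix.inv_def, Ring.inverse_eq_inv', pow_one, ← Complex.ofReal_mul, ← Complex.ofReal_mul]
  congr 1
  rw [Matrix.smul_apply, smul_eq_mul]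
  field_simp

end PoleBdd

/-- Integration by parts with weights that are singular along `det(u + A) = 0`. -/
lemma integral_lineDeriv_eq_zero_of_poleBdd (hA : A.IsHermitian) (hB : B.IsHermitian) (hp : 0 < p)
    (hq : 0 < q) (hy : y.PosDef) {m : ℕ} {h h' : Coord n → ℂ} (hh : PoleBdd A B p m h)
    (hh' : PoleBdd A B p m h') {v : Coord n}
    (hd : ∀ c ∈ cone A B, HasLineDerivAt ℝ h (h' c) c v) {a b : ℂ} (ha : 2 ≤ a.re)
    (hb : m + 3 ≤ b.re) :
    IntegrableOn (fun c => (h' c + h c * kernLog A B y a b (symMat v) c) * kern A B p q y a b c)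
        (cone A B) ∧
      ∫ c in cone A B, (h' c + h c * kernLog A B y a b (symMat v) c) * kern A B p q y a b c = 0 := by
  have hm := (isOpen_cone hA hB).measurableSet
  set P : Coord n → ℝ := fun c => p * (symMat c + A).det with hP
  have htr : PoleBdd A B p 1 fun c => (((symMat c + A)⁻¹ * symMat v).trace : ℂ) := by
    simp only [trace, diag_apply, Matrix.mul_apply, Complex.ofReal_sum, Complex.ofReal_mul]
    exact PoleBdd.sum fun i _ => PoleBdd.sum fun j _ =>
      (PoleBdd.inv i j).mul (PoleBdd.of_polyBdd (PolyBdd.const _))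
  -- The weight absorbs m + 1 powers of P = p det(u + A) and the exponent is lowered by m + 1, which
  -- leaves real part at least 2. One power more than m is needed because differentiating that power
  -- of P brings in the inverse of u + A, which adds a simple pole.
  have key := integral_lineDeriv_eq_zero hA hB hp hq hy (a := a) (b := b - ((m + 1 : ℕ) : ℂ))
    (h := fun c => h c * (P c : ℂ) ^ (m + 1))
    (h' := fun c => (h' c + h c * (((m + 1 : ℕ) : ℂ) * (((symMat c + A)⁻¹ * symMat v).trace : ℂ))) *
      (P c : ℂ) ^ (m + 1)) (v := v) (hh.mono (Nat.le_succ m)) ?_ ?_ ha ?_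
  · have e : ∀ c ∈ cone A B,
        ((h' c + h c * (((m + 1 : ℕ) : ℂ) * (((symMat c + A)⁻¹ * symMat v).trace : ℂ))) *
          (P c : ℂ) ^ (m + 1) + h c * (P c : ℂ) ^ (m + 1) *
            kernLog A B y a (b - ((m + 1 : ℕ) : ℂ)) (symMat v) c) *
            kern A B p q y a (b - ((m + 1 : ℕ) : ℂ)) c =
        (h' c + h c * kernLog A B y a b (symMat v) c) * kern A B p q y a b c := by
      intro c hc
      have hne : (P c : ℂ) ≠ 0 := by exact_mod_cast (mul_pos hp hc.1.det_pos).ne'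
      have hk : kern A B p q y a b c =
          kern A B p q y a (b - ((m + 1 : ℕ) : ℂ)) c * (P c : ℂ) ^ (m + 1) := by
        unfold kern
        rw [Complex.cpow_sub _ _ hne, Complex.cpow_natCast, mul_assoc _ (_ / _), div_mul_cancel₀ _
          (pow_ne_zero _ hne)]
      rw [hk]
      unfold kernLog
      ring
    refine ⟨key.1.congr_fun e hm, ?_⟩
    rw [← key.2]
    exact (setIntegral_congr_fun hm e).symm
  · have h1 := (hh'.mono (Nat.le_succ m))
    have h2 := hh.mul ((PoleBdd.of_polyBdd (PolyBdd.const ((m + 1 : ℕ) : ℂ))).mul htr)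
    rw [zero_add] at h2
    refine (PolyBdd.add h1 h2).congr fun c _ => ?_
    simp only [Nat.succ_eq_add_one, hP]
    ring
  · intro c hc
    have h1 : HasDerivAt (fun t : ℝ => P (c + t • v)) (P c * ((symMat c + A)⁻¹ * symMat v).trace)
        0 := by
      have := (hasDerivAt_det_line hc.1.det_pos.ne' (symMat v)).const_mul p
      refine (this.congr_deriv (by simp only [hP]; ring)).congr_of_eventuallyEq
        (Eventually.of_forall fun t => ?_)
      simp only [hP, Confluent.symMat_add, symMat_smul]
      rw [add_right_comm]
    have h2 := h1.ofReal_comp.fun_pow (m + 1)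
    have h3 := HasDerivAt.fun_mul (hd c hc) h2
    refine HasDerivAt.congr_deriv h3 ?_
    simp only [zero_smul, add_zero, Nat.add_sub_cancel]
    push_cast
    ring
  · simp
    linarith

end Pole

/-! ### Families of cones, and representations by integrals with raised exponents -/

/-- A family of cones with kernels. -/
structure ConeFamily (Λ : Type) (n : ℕ) where
  /-- first translation -/
  A : Λ → Matrix (Fin n) (Fin n) ℝ
  /-- second translation -/
  B : Λ → Matrix (Fin n) (Fin n) ℝ
  /-- normalization of `det(u + A)` -/
  p : Λ → ℝ
  /-- normalization of `det(u + B)` -/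
  q : Λ → ℝ
  /-- the matrix in the exponential -/
  y : Λ → Matrix (Fin n) (Fin n) ℝ
  hA : ∀ l, (A l).IsHermitian
  hB : ∀ l, (B l).IsHermitian
  hp : ∀ l, 0 < p l
  hq : ∀ l, 0 < q l
  hy : ∀ l, (y l).PosDef

namespace ConeFamily
variable {Λ : Type} {n : ℕ} (F : ConeFamily Λ n)

/-- The domain of integration. -/
def D (l : Λ) : Set (Coord n) := cone (F.A l) (F.B l)

/-- The kernel. -/
noncomputable def k (l : Λ) (a b : ℂ) (c : Coord n) : ℂ :=
  kern (F.A l) (F.B l) (F.p l) (F.q l) (F.y l) a b c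

/-- The integral of a weight against the kernel. -/
noncomputable def J (f : Λ → Coord n → ℂ) (l : Λ) (a b : ℂ) : ℂ :=
  ∫ c in F.D l, f l c * F.k l a b c

/-- Exchange the roles of the two translations. -/
def swap : ConeFamily Λ n where
  A := F.B
  B := F.A
  p := F.q
  q := F.p
  y := F.y
  hA := F.hB
  hB := F.hA
  hp := F.hq
  hq := F.hp
  hy := F.hy

lemma swap_D (l : Λ) : F.swap.D l = F.D l := cone_comm _ _

lemma swap_J (f : Λ → Coord n → ℂ) (l : Λ) (a b : ℂ) : F.swap.J f l a b = F.J f l b a := by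
  unfold J
  rw [swap_D]
  congr 1
  ext c
  simp only [k, kern, swap]
  ring

lemma measurableSet_D (l : Λ) : MeasurableSet (F.D l) := (isOpen_cone (F.hA l) (F.hB l)).measurableSet

/-- Algebras of weights of polynomial growth that are closed under differentiation. -/
structure Admissible (𝓐 : Subalgebra ℂ (Λ → Coord n → ℂ)) : Prop where
  polyBdd : ∀ f ∈ 𝓐, ∀ l, PolyBdd (F.D l) (f l)
  deriv : ∀ f ∈ 𝓐, ∀ i j, ∃ f' ∈ 𝓐, ∀ l, ∀ c ∈ F.D l,
    HasLineDerivAt ℝ (f l) (f' l c) c (symDir i j)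
  y_mem : ∀ i j, (fun l _ => (F.y l i j : ℂ)) ∈ 𝓐

/-- `Φ` is a combination of integrals with shifted exponents, with coefficients holomorphic on
`U`. -/
def Rep (𝓐 : Subalgebra ℂ (Λ → Coord n → ℂ)) (U : Set (ℂ × ℂ)) (L : ℝ) (da db : ℕ)
    (Φ : Λ → ℂ → ℂ → ℂ) : Prop :=
  ∃ (ι : Type) (_ : Fintype ι) (r : ι → ℂ × ℂ → ℂ) (f : ι → Λ → Coord n → ℂ),
    (∀ i, DifferentiableOn ℂ (r i) U) ∧ (∀ i, f i ∈ 𝓐) ∧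
    ∀ l a b, L ≤ a.re → L ≤ b.re → Φ l a b = ∑ i, r i (a, b) * F.J (f i) l (a + da) (b + db)

namespace Rep
variable {F} {𝓐 : Subalgebra ℂ (Λ → Coord n → ℂ)} {U : Set (ℂ × ℂ)} {L : ℝ} {da db : ℕ}
  {Φ Ψ : Λ → ℂ → ℂ → ℂ}

lemma of_mem {f : Λ → Coord n → ℂ} (hf : f ∈ 𝓐) :
    F.Rep 𝓐 U L da db fun l a b => F.J f l (a + da) (b + db) :=
  ⟨Unit, inferInstance, fun _ _ => 1, fun _ => f, fun _ => differentiableOn_const _, fun _ => hf,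
    fun l a b _ _ => by simp⟩

lemma add (hΦ : F.Rep 𝓐 U L da db Φ) (hΨ : F.Rep 𝓐 U L da db Ψ) :
    F.Rep 𝓐 U L da db fun l a b => Φ l a b + Ψ l a b := by
  obtain ⟨ι, _, r, f, hr, hf, h⟩ := hΦ
  obtain ⟨ι', _, r', f', hr', hf', h'⟩ := hΨ
  refine ⟨ι ⊕ ι', inferInstance, Sum.elim r r', Sum.elim f f', ?_, ?_, ?_⟩
  · rintro (i | i)
    · exact hr i
    · exact hr' i
  · rintro (i | i)
    · exact hf i
    · exact hf' i
  · intro l a b ha hb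
    simp [h l a b ha hb, h' l a b ha hb]

lemma zero : F.Rep 𝓐 U L da db fun _ _ _ => 0 :=
  ⟨Empty, inferInstance, fun _ _ => 0, fun i => i.elim, fun i => i.elim, fun i => i.elim,
    fun l a b _ _ => by simp⟩

lemma mul {r : ℂ × ℂ → ℂ} (hr : DifferentiableOn ℂ r U) (hΦ : F.Rep 𝓐 U L da db Φ) :
    F.Rep 𝓐 U L da db fun l a b => r (a, b) * Φ l a b := by
  obtain ⟨ι, _, s, f, hs, hf, h⟩ := hΦ
  refine ⟨ι, inferInstance, fun i z => r z * s i z, f, fun i => hr.mul (hs i), hf, ?_⟩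
  intro l a b ha hb
  beta_reduce
  rw [h l a b ha hb, Finset.mul_sum]
  exact Finset.sum_congr rfl fun i _ => by ring

lemma sum {κ : Type*} {s : Finset κ} {Φ : κ → Λ → ℂ → ℂ → ℂ}
    (h : ∀ i ∈ s, F.Rep 𝓐 U L da db (Φ i)) :
    F.Rep 𝓐 U L da db fun l a b => ∑ i ∈ s, Φ i l a b := by
  classical
  induction s using Finset.induction_on with
  | empty => simpa using zero
  | insert a s ha ih =>
    simp only [Finset.sum_insert ha]
    exact (h a (Finset.mem_insert_self a s)).add (ih fun i hi => h i (Finset.mem_insert_of_mem hi))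

lemma congr (hΦ : F.Rep 𝓐 U L da db Φ)
    (e : ∀ l a b, L ≤ a.re → L ≤ b.re → Ψ l a b = Φ l a b) : F.Rep 𝓐 U L da db Ψ := by
  obtain ⟨ι, i, r, f, hr, hf, h⟩ := hΦ
  exact ⟨ι, i, r, f, hr, hf, fun l a b ha hb => (e l a b ha hb).trans (h l a b ha hb)⟩

/-- Two shifts compose: the coefficients of the second are evaluated at the shifted exponents, which
`hV'` keeps inside their domain. -/
lemma trans {da' db' : ℕ} {U' V : Set (ℂ × ℂ)} (hΦ : F.Rep 𝓐 U L da db Φ)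
    (h' : ∀ f ∈ 𝓐, F.Rep 𝓐 U' L da' db' (F.J f)) (hV : V ⊆ U)
    (hV' : ∀ z ∈ V, ((z.1 + da, z.2 + db) : ℂ × ℂ) ∈ U') :
    F.Rep 𝓐 V L (da + da') (db + db') Φ := by
  obtain ⟨ι, _, r, f, hr, hf, h⟩ := hΦ
  refine congr (Φ := fun l a b => ∑ i, r i (a, b) * F.J (f i) l (a + da) (b + db)) ?_ h
  refine sum fun i _ => mul ((hr i).mono hV) ?_
  obtain ⟨ι', _, r', f', hr', hf', h''⟩ := h' (f i) (hf i)
  refine ⟨ι', inferInstance, fun i z => r' i (z.1 + da, z.2 + db), f', ?_, hf', ?_⟩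
  · intro i'
    refine (hr' i').comp ?_ hV'
    exact (Differentiable.prodMk (by fun_prop) (by fun_prop)).differentiableOn
  · intro l a b ha hb
    beta_reduce
    rw [h'' l _ _ (by simp; linarith [(Nat.cast_nonneg da : (0 : ℝ) ≤ da)])
      (by simp; linarith [(Nat.cast_nonneg db : (0 : ℝ) ≤ db)])]
    refine Finset.sum_congr rfl fun i' _ => ?_
    push_cast
    rw [add_assoc, add_assoc]

end Rep

end ConeFamily

end Confluent

/-! ### The recursion for minors, raising one exponent by one -/

namespace Confluent

namespace PoleBdd
variable {n : ℕ} {A B : Matrix (Fin n) (Fin n) ℝ} {p : ℝ}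

/-- Each entry of the inverse has a simple pole. The order is rounded up to 2 so that one bound
serves both the minors and their derivatives, where a row of R V R has double poles. -/
lemma det_rowsMat (S : Finset (Fin n)) (σ : Fin n → Fin n) :
    PoleBdd A B p (n * 2) fun c => ((rowsMat (symMat c + A)⁻¹ S σ).det : ℂ) := by
  refine det fun i j => ?_
  by_cases hi : i ∈ S
  · simpa [rowsMat, hi] using (inv (A := A) (B := B) (p := p) i j).mono one_le_two
  · simpa [rowsMat, hi] using (of_polyBdd (PolyBdd.const _)).mono (Nat.zero_le 2)

lemma rowsDeriv (S : Finset (Fin n)) (σ : Fin n → Fin n) (V : Matrix (Fin n) (Fin n) ℝ) :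
    PoleBdd A B p (n * 2) fun c => (rowsDeriv (symMat c + A)⁻¹ S σ V : ℂ) := by
  simp only [Confluent.rowsDeriv, Complex.ofReal_sum, detRow_apply]
  refine sum fun k _ => det fun i j => ?_
  by_cases hk : i = k
  · subst hk
    simp only [updateRow_self, Matrix.mul_apply, Pi.neg_apply, Complex.ofReal_neg,
      Complex.ofReal_sum, Complex.ofReal_mul, Finset.sum_mul]
    have : PoleBdd A B p 2 fun c => (-1 : ℂ) * ∑ x, ∑ x_1,
        ((symMat c + A)⁻¹ i x_1 : ℂ) * (V x_1 x : ℂ) * ((symMat c + A)⁻¹ x j : ℂ) := by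
      refine (of_polyBdd (PolyBdd.const _)).mul (m' := 2) (sum fun x _ => sum fun x' _ => ?_)
      exact ((inv i x').mul (of_polyBdd (PolyBdd.const _))).mul (m' := 1) (inv x j)
    simpa using this
  · simp only [updateRow_ne hk]
    by_cases hi : i ∈ S
    · simpa [rowsMat, hi] using (inv (A := A) (B := B) (p := p) i j).mono one_le_two
    · simpa [rowsMat, hi] using (of_polyBdd (PolyBdd.const _)).mono (Nat.zero_le 2)

end PoleBdd

lemma integrableOn_poleBdd_mul_kern {n : ℕ} {A B y : Matrix (Fin n) (Fin n) ℝ} {p q : ℝ}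
    (hA : A.IsHermitian) (hB : B.IsHermitian) (hp : 0 < p) (hq : 0 < q)
    (hy : y.PosDef) {m : ℕ} {h : Coord n → ℂ} (hh : PoleBdd A B p m h) {a b : ℂ} (ha : 0 ≤ a.re)
    (hb : m ≤ b.re) : IntegrableOn (fun c => h c * kern A B p q y a b c) (cone A B) := by
  have := integrableOn_mul_kern hA hB hp hq hy hh (b := b - m) ha (by simpa using hb)
  refine this.congr_fun (fun c hc => ?_) (isOpen_cone hA hB).measurableSet
  have hne : ((p * (symMat c + A).det : ℝ) : ℂ) ≠ 0 := by
    exact_mod_cast (mul_pos hp hc.1.det_pos).ne'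
  unfold kern
  beta_reduce
  rw [Complex.cpow_sub _ _ hne, Complex.cpow_natCast]
  have := pow_ne_zero m hne
  field_simp

namespace ConeFamily
variable {Λ : Type} {n : ℕ} (F : ConeFamily Λ n)

/-- The integral of a weight times a minor of the inverse matrix. -/
noncomputable def JW (S : Finset (Fin n)) (σ : Fin n → Fin n) (f : Λ → Coord n → ℂ) (l : Λ)
    (a b : ℂ) : ℂ :=
  ∫ c in F.D l, f l c * ((rowsMat (symMat c + F.A l)⁻¹ S σ).det : ℂ) * F.k l a b c

variable {F} {𝓐 : Subalgebra ℂ (Λ → Coord n → ℂ)}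

lemma Admissible.trace_mem (h𝓐 : F.Admissible 𝓐) (V : Matrix (Fin n) (Fin n) ℝ) :
    (fun l _ => ((V * F.y l).trace : ℂ)) ∈ 𝓐 := by
  have : (fun l _ => ((V * F.y l).trace : ℂ)) =
      ∑ i, ∑ j, (V i j : ℂ) • fun (l : Λ) (_ : Coord n) => (F.y l j i : ℂ) := by
    ext l c
    simp [trace, Matrix.mul_apply]
  rw [this]
  exact sum_mem fun i _ => sum_mem fun j _ => 𝓐.smul_mem (h𝓐.y_mem j i) _

lemma integrableOn_JW (h𝓐 : F.Admissible 𝓐) {f : Λ → Coord n → ℂ} (hf : f ∈ 𝓐)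
    (S : Finset (Fin n)) (σ : Fin n → Fin n) (l : Λ) {a b : ℂ} (ha : 0 ≤ a.re)
    (hb : 2 * n ≤ b.re) :
    IntegrableOn (fun c => f l c * ((rowsMat (symMat c + F.A l)⁻¹ S σ).det : ℂ) * F.k l a b c)
      (F.D l) := by
  have h := (PoleBdd.of_polyBdd (p := F.p l) (h𝓐.polyBdd f hf l)).mul
    (PoleBdd.det_rowsMat (A := F.A l) (B := F.B l) (p := F.p l) S σ)
  refine integrableOn_poleBdd_mul_kern (F.hA l) (F.hB l) (F.hp l) (F.hq l) (F.hy l) h ha ?_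
  push_cast
  linarith

/-- The recursion for the minors. -/
lemma exists_JW_recursion (h𝓐 : F.Admissible 𝓐) {K : Finset (Fin n)} {ε E : Λ → Fin n → ℝ}
    (hE : ∀ l, F.B l - F.A l = diagonal (E l)) (hεE : ∀ l, ∀ k ∈ K, ε l k * E l k = 1)
    (hε : ∀ k ∈ K, (fun l _ => (ε l k : ℂ)) ∈ 𝓐)
    (hg : ∀ k ∈ K, ∀ i, (fun l c => ((ε l k * (symMat c + F.B l) i k : ℝ) : ℂ)) ∈ 𝓐)
    {S : Finset (Fin n)} {k : Fin n} (hkS : k ∈ S) (hkK : k ∈ K) (σ : Fin n → Fin n)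
    {f : Λ → Coord n → ℂ} (hf : f ∈ 𝓐) :
    ∃ G : Fin n → Fin n → Λ → Coord n → ℂ, (∀ i j, G i j ∈ 𝓐) ∧ ∃ f₁ ∈ 𝓐,
      ∀ l (a s : ℂ), 2 ≤ a.re → 2 * n + 3 ≤ s.re →
        (s + ((S.card : ℂ) - 1) / 2) * F.JW S σ f l a s =
          ∑ i, ∑ j, F.JW (S.erase k) (Function.update σ k j) (G i j) l a s -
          (s + ((S.card : ℂ) - 1) / 2 + a) *
            F.JW (S.erase k) (Function.update σ k k) f₁ l a s := by
  -- This is ε_k times column k of u + B. Multiplied by the inverse of u + B it gives ε_k e_k. Since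
  -- u + B = (u + A) + E and ε_k E_k = 1, multiplied by R, the inverse of u + A, it gives row k of R
  -- plus ε_k e_k, as `sum_rowsDeriv` requires.
  set g : Fin n → Λ → Coord n → ℂ := fun i l c => ((ε l k * (symMat c + F.B l) i k : ℝ) : ℂ)
  have hgm : ∀ i, f * g i ∈ 𝓐 := fun i => 𝓐.mul_mem hf (hg k hkK i)
  choose d hd𝓐 hd using fun i j => h𝓐.deriv _ (hgm i) i j
  set y' : Fin n → Fin n → Λ → Coord n → ℂ := fun i j l _ => ((symMat (symDir i j) * F.y l).trace : ℂ)
  have hy' : ∀ i j, y' i j ∈ 𝓐 := fun i j => h𝓐.trace_mem _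
  set G : Fin n → Fin n → Λ → Coord n → ℂ := fun i j => f * g i * y' i j - d i j with hG
  have hG𝓐 : ∀ i j, G i j ∈ 𝓐 := fun i j =>
    𝓐.sub_mem (𝓐.mul_mem (hgm i) (hy' i j)) (hd𝓐 i j)
  set f₁ : Λ → Coord n → ℂ := f * fun l _ => (ε l k : ℂ) with hf₁
  have hf₁𝓐 : f₁ ∈ 𝓐 := 𝓐.mul_mem hf (hε k hkK)
  refine ⟨G, hG𝓐, f₁, hf₁𝓐, fun l a s ha hs => ?_⟩
  set W : Fin n → Coord n → ℝ := fun j c =>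
    (rowsMat (symMat c + F.A l)⁻¹ (S.erase k) (Function.update σ k j)).det with hW
  set W' : Fin n → Matrix (Fin n) (Fin n) ℝ → Coord n → ℝ := fun j V c =>
    rowsDeriv (symMat c + F.A l)⁻¹ (S.erase k) (Function.update σ k j) V with hW'
  have hm := F.measurableSet_D l
  -- Integration by parts in the direction `symDir i j` with the weight f g_i W_j, where W_j is the
  -- minor whose row k has been replaced by e_j.
  have ibp : ∀ i j, IntegrableOn (fun c => (d i j l c * (W j c : ℂ) +
        (f * g i) l c * (W' j (symMat (symDir i j)) c : ℂ) + (f * g i) l c * (W j c : ℂ) *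
          kernLog (F.A l) (F.B l) (F.y l) a s (symMat (symDir i j)) c) * F.k l a s c) (F.D l) ∧
      ∫ c in F.D l, (d i j l c * (W j c : ℂ) +
        (f * g i) l c * (W' j (symMat (symDir i j)) c : ℂ) + (f * g i) l c * (W j c : ℂ) *
          kernLog (F.A l) (F.B l) (F.y l) a s (symMat (symDir i j)) c) * F.k l a s c = 0 := by
    intro i j
    have b1 := (PoleBdd.of_polyBdd (p := F.p l) (h𝓐.polyBdd _ (hgm i) l)).mul
      (PoleBdd.det_rowsMat (A := F.A l) (B := F.B l) (p := F.p l) (S.erase k)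
        (Function.update σ k j))
    have b2 := (PoleBdd.of_polyBdd (p := F.p l) (h𝓐.polyBdd _ (hd𝓐 i j) l)).mul
      (PoleBdd.det_rowsMat (A := F.A l) (B := F.B l) (p := F.p l) (S.erase k)
        (Function.update σ k j))
    have b3 := (PoleBdd.of_polyBdd (p := F.p l) (h𝓐.polyBdd _ (hgm i) l)).mul
      (PoleBdd.rowsDeriv (A := F.A l) (B := F.B l) (p := F.p l) (S.erase k)
        (Function.update σ k j) (symMat (symDir i j)))
    refine integral_lineDeriv_eq_zero_of_poleBdd (F.hA l) (F.hB l) (F.hp l) (F.hq l) (F.hy l)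
      (h := fun c => (f * g i) l c * (W j c : ℂ)) b1 (m := 0 + n * 2) ?_ ?_ ha ?_
    · exact (PolyBdd.add b2 b3).congr fun c _ => by simp only [hW, hW']; ring
    · intro c hc
      have h1 : HasDerivAt (fun t : ℝ => W j (c + t • symDir i j)) (W' j (symMat (symDir i j)) c)
          0 := by
        have := hasDerivAt_det_rowsMat hc.1.det_pos.ne' (symMat (symDir i j)) (S.erase k)
          (Function.update σ k j)
        refine this.congr_of_eventuallyEq (Eventually.of_forall fun t => ?_)
        simp only [hW, Confluent.symMat_add, symMat_smul]
        rw [add_right_comm]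
      have h2 := HasDerivAt.fun_mul (hd i j l c hc) h1.ofReal_comp
      refine HasDerivAt.congr_deriv h2 ?_
      simp only [zero_smul, add_zero]
    · push_cast
      linarith
  have hsum : ∑ i, ∑ j, ∫ c in F.D l, (d i j l c * (W j c : ℂ) +
        (f * g i) l c * (W' j (symMat (symDir i j)) c : ℂ) + (f * g i) l c * (W j c : ℂ) *
          kernLog (F.A l) (F.B l) (F.y l) a s (symMat (symDir i j)) c) * F.k l a s c = 0 :=
    Finset.sum_eq_zero fun i _ => Finset.sum_eq_zero fun j _ => (ibp i j).2
  -- Three contributions are summed over i and j. Differentiating the minors gives (|S| - 1)/2 times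
  -- (minor + ε W_k), the power of det(u + A) gives s times (minor + ε W_k), and the power of det(u
  -- + B) gives a ε W_k. Derivatives of f g_i and of the exponential are collected in G.
  have pt : ∀ c ∈ F.D l, ∑ i, ∑ j, (d i j l c * (W j c : ℂ) +
        (f * g i) l c * (W' j (symMat (symDir i j)) c : ℂ) + (f * g i) l c * (W j c : ℂ) *
          kernLog (F.A l) (F.B l) (F.y l) a s (symMat (symDir i j)) c) * F.k l a s c =
      (s + ((S.card : ℂ) - 1) / 2) * (f l c * ((rowsMat (symMat c + F.A l)⁻¹ S σ).det : ℂ) *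
        F.k l a s c) - ∑ i, ∑ j, G i j l c * (W j c : ℂ) * F.k l a s c +
      (s + ((S.card : ℂ) - 1) / 2 + a) * (f₁ l c * (W k c : ℂ) * F.k l a s c) := by
    intro c hc
    set R := (symMat c + F.A l)⁻¹ with hR
    set T := (symMat c + F.B l)⁻¹ with hT
    have hRs : R.IsSymm := by
      rw [hR]
      have := hc.1.inv.1
      simpa [IsHermitian, IsSymm] using this
    have hTs : T.IsSymm := by
      rw [hT]
      have := hc.2.inv.1
      simpa [IsHermitian, IsSymm] using this
    set gv : Fin n → ℝ := fun i => ε l k * (symMat c + F.B l) i k with hgv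
    have hTg : T *ᵥ gv = ε l k • Pi.single k 1 := by
      have : gv = ε l k • ((symMat c + F.B l) *ᵥ Pi.single k 1) := by
        ext i; simp [hgv]
      rw [this, mulVec_smul, mulVec_mulVec, hT, nonsing_inv_mul _ hc.2.det_pos.ne'.isUnit,
        one_mulVec]
    have hRg : R *ᵥ gv = R k + ε l k • Pi.single k 1 := by
      have e1 : gv = ε l k • ((symMat c + F.A l) *ᵥ Pi.single k 1) + Pi.single k 1 := by
        have hB' : F.B l = F.A l + diagonal (E l) := by rw [← hE l]; abel
        ext i
        simp only [hgv, hB', ← add_assoc]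
        by_cases hik : i = k
        · subst hik
          have := hεE l i hkK
          simp [mul_add, this]
        · simp [hik]
      have e2 : R *ᵥ Pi.single k 1 = R k := by
        ext i; simp [hRs.apply]
      rw [e1, mulVec_add, mulVec_smul, mulVec_mulVec, hR, nonsing_inv_mul _ hc.1.det_pos.ne'.isUnit,
        one_mulVec, ← hR, e2, add_comm]
    have c1 : ∑ i, ∑ j, gv i * W' j (symMat (symDir i j)) c =
        ((S.card : ℝ) - 1) / 2 * ((rowsMat R S σ).det + ε l k * W k c) := by
      rw [← sum_rowsDeriv hRs hkS hRg, Finset.sum_comm]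
      refine Finset.sum_congr rfl fun j _ => ?_
      rw [symOuter_eq_sum, rowsDeriv_sum]
    have c2 : ∑ i, ∑ j, gv i * W j c * (R * symMat (symDir i j)).trace =
        (rowsMat R S σ).det + ε l k * W k c := by
      have : ∀ j, ∑ i, gv i * W j c * (R * symMat (symDir i j)).trace = W j c * (R *ᵥ gv) j := by
        intro j
        rw [← trace_mul_symOuter hRs, symOuter_eq_sum, Matrix.mul_sum, trace_sum, Finset.mul_sum]
        refine Finset.sum_congr rfl fun i _ => ?_
        rw [mul_smul_comm, trace_smul, smul_eq_mul]
        ring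
      rw [Finset.sum_comm, Finset.sum_congr rfl fun j _ => this j, hRg, ← det_rowsMat_expand hkS]
      simp only [Pi.add_apply, Pi.smul_apply, smul_eq_mul, mul_add, Finset.sum_add_distrib]
      congr 1
      · exact Finset.sum_congr rfl fun j _ => mul_comm _ _
      · simp [Pi.single_apply, mul_comm]
    have c3 : ∑ i, ∑ j, gv i * W j c * (T * symMat (symDir i j)).trace = ε l k * W k c := by
      have : ∀ j, ∑ i, gv i * W j c * (T * symMat (symDir i j)).trace = W j c * (T *ᵥ gv) j := by
        intro j
        rw [← trace_mul_symOuter hTs, symOuter_eq_sum, Matrix.mul_sum, trace_sum, Finset.mul_sum]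
        refine Finset.sum_congr rfl fun i _ => ?_
        rw [mul_smul_comm, trace_smul, smul_eq_mul]
        ring
      rw [Finset.sum_comm, Finset.sum_congr rfl fun j _ => this j, hTg]
      simp [Pi.single_apply, mul_comm]
    have expand : ∀ i j, (d i j l c * (W j c : ℂ) +
        (f * g i) l c * (W' j (symMat (symDir i j)) c : ℂ) + (f * g i) l c * (W j c : ℂ) *
          kernLog (F.A l) (F.B l) (F.y l) a s (symMat (symDir i j)) c) * F.k l a s c =
        f l c * F.k l a s c * ((gv i * W' j (symMat (symDir i j)) c : ℝ) : ℂ) +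
        f l c * F.k l a s c * s * ((gv i * W j c * (R * symMat (symDir i j)).trace : ℝ) : ℂ) +
        f l c * F.k l a s c * a * ((gv i * W j c * (T * symMat (symDir i j)).trace : ℝ) : ℂ) -
        G i j l c * (W j c : ℂ) * F.k l a s c := by
      intro i j
      simp only [hG, kernLog, Pi.sub_apply, Pi.mul_apply, g, y', hgv]
      push_cast
      ring
    simp only [← Finset.mul_sum] at c1
    simp only [expand, Finset.sum_sub_distrib, Finset.sum_add_distrib, ← Finset.mul_sum,
      ← Complex.ofReal_sum, c1, c2, c3]
    simp only [hf₁, Pi.mul_apply]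
    push_cast
    ring
  have hI1 := integrableOn_JW h𝓐 hf S σ l (a := a) (b := s) (by linarith) (by linarith)
  have hI2 := fun i j => integrableOn_JW h𝓐 (hG𝓐 i j) (S.erase k) (Function.update σ k j) l
    (a := a) (b := s) (by linarith) (by linarith)
  have hI3 := integrableOn_JW h𝓐 hf₁𝓐 (S.erase k) (Function.update σ k k) l
    (a := a) (b := s) (by linarith) (by linarith)
  have e1 : ∑ i, ∑ j, ∫ c in F.D l, (d i j l c * (W j c : ℂ) +
        (f * g i) l c * (W' j (symMat (symDir i j)) c : ℂ) + (f * g i) l c * (W j c : ℂ) *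
          kernLog (F.A l) (F.B l) (F.y l) a s (symMat (symDir i j)) c) * F.k l a s c =
      (s + ((S.card : ℂ) - 1) / 2) * F.JW S σ f l a s -
        ∑ i, ∑ j, F.JW (S.erase k) (Function.update σ k j) (G i j) l a s +
      (s + ((S.card : ℂ) - 1) / 2 + a) * F.JW (S.erase k) (Function.update σ k k) f₁ l a s := by
    have s1 : ∑ i, ∑ j, ∫ c in F.D l, (d i j l c * (W j c : ℂ) +
        (f * g i) l c * (W' j (symMat (symDir i j)) c : ℂ) + (f * g i) l c * (W j c : ℂ) *
          kernLog (F.A l) (F.B l) (F.y l) a s (symMat (symDir i j)) c) * F.k l a s c =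
        ∫ c in F.D l, ∑ i, ∑ j, (d i j l c * (W j c : ℂ) +
        (f * g i) l c * (W' j (symMat (symDir i j)) c : ℂ) + (f * g i) l c * (W j c : ℂ) *
          kernLog (F.A l) (F.B l) (F.y l) a s (symMat (symDir i j)) c) * F.k l a s c := by
      rw [integral_finsetSum _ fun i _ => integrable_finsetSum _ fun j _ => (ibp i j).1]
      exact Finset.sum_congr rfl fun i _ => (integral_finsetSum _ fun j _ => (ibp i j).1).symm
    have s2 : ∑ i, ∑ j, F.JW (S.erase k) (Function.update σ k j) (G i j) l a s =
        ∫ c in F.D l, ∑ i, ∑ j, G i j l c * (W j c : ℂ) * F.k l a s c := by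
      rw [integral_finsetSum _ fun i _ => integrable_finsetSum _ fun j _ => hI2 i j]
      exact Finset.sum_congr rfl fun i _ => (integral_finsetSum _ fun j _ => hI2 i j).symm
    have hI2' : IntegrableOn (fun c => ∑ i, ∑ j, G i j l c * (W j c : ℂ) * F.k l a s c) (F.D l) :=
      integrable_finsetSum _ fun i _ => integrable_finsetSum _ fun j _ => hI2 i j
    rw [s1, s2, setIntegral_congr_fun hm pt, integral_add, integral_sub, integral_const_mul,
      integral_const_mul]
    · rfl
    · exact hI1.const_mul _
    · exact hI2'
    · exact (hI1.const_mul _).sub hI2'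
    · exact hI3.const_mul _
  rw [hsum] at e1
  linear_combination -e1

end ConeFamily

end Confluent

namespace Confluent
namespace ConeFamily
variable {Λ : Type} {n : ℕ} {F : ConeFamily Λ n} {𝓐 : Subalgebra ℂ (Λ → Coord n → ℂ)}

/-- The exponents for which one step of the recursion has no denominators that vanish. -/
def stepSet (r : ℕ) : Set (ℂ × ℂ) := {z | ∀ i < r, z.2 + 1 + (i : ℂ) / 2 ≠ 0}

/-- Induction on the number of rows. With s = b + 1 and |S| = m + 1 the recursion divides by b + 1 +
m/2, and a minor without rows is a constant, which leaves an integral with exponent b + 1. -/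
lemma rep_JW (h𝓐 : F.Admissible 𝓐) {K : Finset (Fin n)} {ε E : Λ → Fin n → ℝ}
    (hE : ∀ l, F.B l - F.A l = diagonal (E l)) (hεE : ∀ l, ∀ k ∈ K, ε l k * E l k = 1)
    (hε : ∀ k ∈ K, (fun l _ => (ε l k : ℂ)) ∈ 𝓐)
    (hg : ∀ k ∈ K, ∀ i, (fun l c => ((ε l k * (symMat c + F.B l) i k : ℝ) : ℂ)) ∈ 𝓐)
    (m : ℕ) : ∀ S : Finset (Fin n), S ⊆ K → S.card = m → ∀ σ : Fin n → Fin n,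
      ∀ f ∈ 𝓐, F.Rep 𝓐 (stepSet K.card) (2 * n + 2) 0 1
        fun l a b => F.JW S σ f l a (b + 1) := by
  induction m with
  | zero =>
    intro S _ hS σ f hf
    rw [Finset.card_eq_zero.1 hS]
    set M : Matrix (Fin n) (Fin n) ℝ := Matrix.of fun i => Pi.single (σ i) 1
    have hM : ∀ R, rowsMat R ∅ σ = M := fun R => by ext; simp [rowsMat, M]
    refine (Rep.of_mem (𝓐.smul_mem hf (M.det : ℂ))).congr fun l a b _ _ => ?_
    unfold JW J
    simp only [hM, Nat.cast_zero, add_zero, Nat.cast_one, Pi.smul_apply, smul_eq_mul]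
    congr 1
    ext c
    ring
  | succ m ih =>
    intro S hSK hS σ f hf
    obtain ⟨k, hkS⟩ : S.Nonempty := Finset.card_pos.1 (by omega)
    obtain ⟨G, hG, f₁, hf₁, h⟩ := exists_JW_recursion h𝓐 hE hεE hε hg hkS (hSK hkS) σ hf
    have hsub : S.erase k ⊆ K := (Finset.erase_subset _ _).trans hSK
    have hcard : (S.erase k).card = m := by rw [Finset.card_erase_of_mem hkS, hS]; rfl
    have hm : m < K.card := by
      have := Finset.card_le_card hSK
      omega
    have hd : DifferentiableOn ℂ (fun z : ℂ × ℂ => (z.2 + 1 + (m : ℂ) / 2)⁻¹)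
        (stepSet K.card) := by
      refine DifferentiableOn.inv (by fun_prop) fun z hz => hz m hm
    have r1 : F.Rep 𝓐 (stepSet K.card) (2 * n + 2) 0 1 fun l a b =>
        ∑ i, ∑ j, F.JW (S.erase k) (Function.update σ k j) (G i j) l a (b + 1) :=
      Rep.sum fun i _ => Rep.sum fun j _ => ih _ hsub hcard _ _ (hG i j)
    have r2 := (ih _ hsub hcard (Function.update σ k k) _ hf₁).mul
      (r := fun z => -(z.2 + 1 + (m : ℂ) / 2 + z.1)) (by fun_prop)
    refine ((r1.add r2).mul hd).congr fun l a b ha hb => ?_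
    have h2 := h l a (b + 1) (by linarith [(Nat.cast_nonneg n : (0 : ℝ) ≤ n)])
      (by simp; linarith)
    have hne : b + 1 + (m : ℂ) / 2 ≠ 0 := by
      intro h0
      have := congrArg Complex.re h0
      have e : ((m : ℂ) / 2).re = (m : ℝ) / 2 := by
        rw [← Complex.ofReal_natCast, ← Complex.ofReal_ofNat, ← Complex.ofReal_div,
          Complex.ofReal_re]
      simp [e] at this
      linarith [(Nat.cast_nonneg n : (0 : ℝ) ≤ n), (Nat.cast_nonneg m : (0 : ℝ) ≤ m)]
    rw [hS] at h2
    push_cast at h2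
    rw [eq_inv_mul_iff_mul_eq₀ hne]
    linear_combination h2

/-- One step of the continuation in the exponent of `det(u + A)`. -/
lemma rep_step (h𝓐 : F.Admissible 𝓐) {K : Finset (Fin n)} {ε E : Λ → Fin n → ℝ}
    (hE : ∀ l, F.B l - F.A l = diagonal (E l)) (hεE : ∀ l, ∀ k ∈ K, ε l k * E l k = 1)
    (hε : ∀ k ∈ K, (fun l _ => (ε l k : ℂ)) ∈ 𝓐)
    (hg : ∀ k ∈ K, ∀ i, (fun l c => ((ε l k * (symMat c + F.B l) i k : ℝ) : ℂ)) ∈ 𝓐)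
    (hM : ∃ μ ∈ 𝓐, ∀ l, ∀ c ∈ F.D l,
      μ l c * ((F.p l * (rowsMat (symMat c + F.A l) Kᶜ id).det : ℝ) : ℂ) = 1)
    {f : Λ → Coord n → ℂ} (hf : f ∈ 𝓐) :
    F.Rep 𝓐 (stepSet K.card) (2 * n + 2) 0 1 (F.J f) := by
  obtain ⟨μ, hμ, h⟩ := hM
  refine (rep_JW h𝓐 hE hεE hε hg K.card K subset_rfl rfl id _ (𝓐.mul_mem hf hμ)).congr
    fun l a b _ _ => ?_
  unfold J JW
  refine setIntegral_congr_fun (F.measurableSet_D l) fun c hc => ?_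
  -- Jacobi's complementary minor formula: the minor of the inverse on K times the determinant is
  -- the minor of the matrix on the complement of K. As that minor is invertible in the algebra of
  -- weights, the kernel at b is a weight times the minor of the inverse times the kernel at b + 1.
  have hdet : (rowsMat (symMat c + F.A l)⁻¹ K id).det * (symMat c + F.A l).det =
      (rowsMat (symMat c + F.A l) Kᶜ id).det := by
    rw [← det_mul]
    congr 1
    have h1 := nonsing_inv_mul (symMat c + F.A l) hc.1.det_pos.ne'.isUnit
    ext i j
    by_cases hi : i ∈ K
    · have := congrFun (congrFun h1 i) j
      simp only [Matrix.mul_apply, rowsMat, of_apply, hi, if_true, Finset.mem_compl, not_true,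
        if_false, id] at this ⊢
      rw [this, Matrix.one_apply, Pi.single_apply]
      simp [eq_comm]
    · simp [Matrix.mul_apply, rowsMat, hi, Pi.single_apply]
  have hne : ((F.p l * (symMat c + F.A l).det : ℝ) : ℂ) ≠ 0 := by
    exact_mod_cast (mul_pos (F.hp l) hc.1.det_pos).ne'
  have hk : F.k l a (b + 1) c = ((F.p l * (symMat c + F.A l).det : ℝ) : ℂ) * F.k l a b c := by
    unfold k kern
    rw [Complex.cpow_add _ _ hne, Complex.cpow_one]
    ring
  have h2 := h l c hc
  simp only [Pi.mul_apply, hk]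
  rw [← hdet] at h2
  push_cast at h2 ⊢
  linear_combination (-(f l c * F.k l a b c)) * h2

end ConeFamily
end Confluent

namespace Confluent

/-! ### Holomorphy of two-sided Laplace transforms -/

section Holomorphy
variable {Ω : Type*} [MeasurableSpace Ω] {μ : Measure Ω}

lemma exp_mul_le_add {a a' δ x : ℝ} (h : |a - a'| ≤ δ) :
    Real.exp (a * x) ≤ Real.exp ((a' + δ) * x) + Real.exp ((a' - δ) * x) := by
  obtain ⟨h1, h2⟩ := abs_le.1 h
  rcases le_total 0 x with hx | hx
  · have : Real.exp (a * x) ≤ Real.exp ((a' + δ) * x) :=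
      Real.exp_le_exp.2 (mul_le_mul_of_nonneg_right (by linarith) hx)
    linarith [Real.exp_pos ((a' - δ) * x)]
  · have : Real.exp (a * x) ≤ Real.exp ((a' - δ) * x) :=
      Real.exp_le_exp.2 (mul_le_mul_of_nonpos_right (by linarith) hx)
    linarith [Real.exp_pos ((a' + δ) * x)]

lemma abs_mul_exp_mul_le {a a' δ x : ℝ} (hδ : 0 < δ) (h : |a - a'| ≤ δ) :
    |x| * Real.exp (a * x) ≤
      δ⁻¹ * (Real.exp ((a' + 2 * δ) * x) + Real.exp ((a' - 2 * δ) * x)) := by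
  obtain ⟨h1, h2⟩ := abs_le.1 h
  have h3 : δ * |x| ≤ Real.exp (δ * |x|) := by linarith [Real.add_one_le_exp (δ * |x|)]
  have h4 : Real.exp (δ * |x|) * Real.exp (a * x) ≤
      Real.exp ((a' + 2 * δ) * x) + Real.exp ((a' - 2 * δ) * x) := by
    rw [← Real.exp_add]
    rcases abs_cases x with ⟨e, _⟩ | ⟨e, _⟩
    · rw [e, ← add_mul]
      exact exp_mul_le_add (abs_le.2 ⟨by linarith, by linarith⟩)
    · rw [e, show δ * -x + a * x = (a - δ) * x by ring]
      exact exp_mul_le_add (abs_le.2 ⟨by linarith, by linarith⟩)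
  rw [← div_eq_inv_mul, le_div_iff₀ hδ]
  nlinarith [mul_le_mul_of_nonneg_right h3 (Real.exp_pos (a * x)).le]

/-- A two-sided Laplace transform in two variables is holomorphic where it converges absolutely. -/
lemma differentiableOn_integral_exp {w : Ω → ℂ} {X Y : Ω → ℝ} (hw : AEStronglyMeasurable w μ)
    (hX : AEMeasurable X μ) (hY : AEMeasurable Y μ) {a₀ b₀ : ℝ}
    (h : ∀ a b : ℝ, a₀ < a → b₀ < b →
      Integrable (fun ω => ‖w ω‖ * (Real.exp (a * X ω) * Real.exp (b * Y ω))) μ) :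
    DifferentiableOn ℂ
      (fun z : ℂ × ℂ => ∫ ω, w ω * (Complex.exp (z.1 * X ω) * Complex.exp (z.2 * Y ω)) ∂μ)
      {z | a₀ < z.1.re ∧ b₀ < z.2.re} := by
  rintro z₀ ⟨hz1, hz2⟩
  obtain ⟨δ, hδ, hδ1, hδ2⟩ : ∃ δ : ℝ, 0 < δ ∧ a₀ + 2 * δ < z₀.1.re ∧ b₀ + 2 * δ < z₀.2.re := by
    refine ⟨min (z₀.1.re - a₀) (z₀.2.re - b₀) / 4, by
      have := lt_min (sub_pos.2 hz1) (sub_pos.2 hz2); positivity, ?_, ?_⟩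
    · linarith [min_le_left (z₀.1.re - a₀) (z₀.2.re - b₀)]
    · linarith [min_le_right (z₀.1.re - a₀) (z₀.2.re - b₀)]
  -- For exponents within δ of the centre, the sum of the two extreme exponentials dominates both
  -- exp(aX) and, up to 1/δ, its derivative. The product with the analogous `cY` is a sum of four
  -- integrands covered by the hypothesis.
  set cX : Ω → ℝ := fun ω =>
    Real.exp ((z₀.1.re + 2 * δ) * X ω) + Real.exp ((z₀.1.re - 2 * δ) * X ω) with hcX
  set cY : Ω → ℝ := fun ω =>
    Real.exp ((z₀.2.re + 2 * δ) * Y ω) + Real.exp ((z₀.2.re - 2 * δ) * Y ω) with hcY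
  have hmeas : ∀ z : ℂ × ℂ, AEStronglyMeasurable
      (fun ω => w ω * (Complex.exp (z.1 * X ω) * Complex.exp (z.2 * Y ω))) μ := fun z => by
    refine hw.mul (AEMeasurable.aestronglyMeasurable ?_)
    exact (Complex.measurable_exp.comp_aemeasurable
      ((Complex.measurable_ofReal.comp_aemeasurable hX).const_mul _)).mul
      (Complex.measurable_exp.comp_aemeasurable
      ((Complex.measurable_ofReal.comp_aemeasurable hY).const_mul _))
  have hnorm : ∀ (z : ℂ) (x : ℝ), ‖Complex.exp (z * x)‖ = Real.exp (z.re * x) := fun z x => by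
    rw [Complex.norm_exp]; simp
  set F' : ℂ × ℂ → Ω → ℂ × ℂ →L[ℂ] ℂ := fun z ω =>
    (w ω * (Complex.exp (z.1 * X ω) * Complex.exp (z.2 * Y ω))) •
      ((X ω : ℂ) • ContinuousLinearMap.fst ℂ ℂ ℂ + (Y ω : ℂ) • ContinuousLinearMap.snd ℂ ℂ ℂ)
    with hF'
  have key := hasFDerivAt_integral_of_dominated_of_fderiv_le (𝕜 := ℂ) (μ := μ)
    (F := fun (z : ℂ × ℂ) ω => w ω * (Complex.exp (z.1 * X ω) * Complex.exp (z.2 * Y ω)))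
    (F' := F') (x₀ := z₀) (s := Metric.ball z₀ δ)
    (bound := fun ω => (2 / δ) * (‖w ω‖ * (cX ω * cY ω)))
    (Metric.ball_mem_nhds z₀ hδ) (Eventually.of_forall hmeas) ?_ ?_ ?_ ?_ ?_
  · exact key.differentiableAt.differentiableWithinAt
  · rw [← integrable_norm_iff (hmeas z₀)]
    refine (h z₀.1.re z₀.2.re (by linarith) (by linarith)).congr
      (Eventually.of_forall fun ω => ?_)
    simp [hnorm]
  · refine (hmeas z₀).smul (AEStronglyMeasurable.add ?_ ?_)
    · exact (Complex.measurable_ofReal.comp_aemeasurable hX).aestronglyMeasurable.smul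
        aestronglyMeasurable_const
    · exact (Complex.measurable_ofReal.comp_aemeasurable hY).aestronglyMeasurable.smul
        aestronglyMeasurable_const
  · refine Eventually.of_forall fun ω z hz => ?_
    have hd1 : |z.1.re - z₀.1.re| ≤ δ := by
      rw [← Complex.sub_re]
      refine (Complex.abs_re_le_norm _).trans ?_
      rw [← dist_eq_norm]
      exact (le_max_left _ _).trans (Metric.mem_ball.1 hz).le
    have hd2 : |z.2.re - z₀.2.re| ≤ δ := by
      rw [← Complex.sub_re]
      refine (Complex.abs_re_le_norm _).trans ?_
      rw [← dist_eq_norm]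
      exact (le_max_right _ _).trans (Metric.mem_ball.1 hz).le
    have e1 : Real.exp (z.1.re * X ω) ≤ cX ω := exp_mul_le_add (by linarith)
    have e2 : Real.exp (z.2.re * Y ω) ≤ cY ω := exp_mul_le_add (by linarith)
    have e3 : |X ω| * Real.exp (z.1.re * X ω) ≤ δ⁻¹ * cX ω := abs_mul_exp_mul_le hδ hd1
    have e4 : |Y ω| * Real.exp (z.2.re * Y ω) ≤ δ⁻¹ * cY ω := abs_mul_exp_mul_le hδ hd2
    have hcX0 : 0 ≤ cX ω := by positivity
    have hcY0 : 0 ≤ cY ω := by positivity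
    have hlin : ‖(X ω : ℂ) • ContinuousLinearMap.fst ℂ ℂ ℂ +
        (Y ω : ℂ) • ContinuousLinearMap.snd ℂ ℂ ℂ‖ ≤ |X ω| + |Y ω| := by
      refine (norm_add_le _ _).trans (add_le_add ?_ ?_)
      · rw [norm_smul]
        simp
      · rw [norm_smul]
        simp
    rw [hF']
    beta_reduce
    rw [norm_smul, norm_mul, norm_mul, hnorm, hnorm]
    refine (mul_le_mul_of_nonneg_left hlin (by positivity)).trans ?_
    have h5 : (|X ω| * Real.exp (z.1.re * X ω)) * Real.exp (z.2.re * Y ω) ≤ (δ⁻¹ * cX ω) * cY ω :=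
      mul_le_mul e3 e2 (Real.exp_pos _).le (by positivity)
    have h6 : (|Y ω| * Real.exp (z.2.re * Y ω)) * Real.exp (z.1.re * X ω) ≤ (δ⁻¹ * cY ω) * cX ω :=
      mul_le_mul e4 e1 (Real.exp_pos _).le (by positivity)
    calc _ = ‖w ω‖ * ((|X ω| * Real.exp (z.1.re * X ω)) * Real.exp (z.2.re * Y ω) +
          (|Y ω| * Real.exp (z.2.re * Y ω)) * Real.exp (z.1.re * X ω)) := by ring
      _ ≤ ‖w ω‖ * ((δ⁻¹ * cX ω) * cY ω + (δ⁻¹ * cY ω) * cX ω) :=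
          mul_le_mul_of_nonneg_left (add_le_add h5 h6) (norm_nonneg _)
      _ = _ := by rw [div_eq_mul_inv]; ring
  · refine Integrable.const_mul ?_ _
    have g1 := h (z₀.1.re + 2 * δ) (z₀.2.re + 2 * δ) (by linarith) (by linarith)
    have g2 := h (z₀.1.re + 2 * δ) (z₀.2.re - 2 * δ) (by linarith) (by linarith)
    have g3 := h (z₀.1.re - 2 * δ) (z₀.2.re + 2 * δ) (by linarith) (by linarith)
    have g4 := h (z₀.1.re - 2 * δ) (z₀.2.re - 2 * δ) (by linarith) (by linarith)
    refine ((g1.add g2).add (g3.add g4)).congr (Eventually.of_forall fun ω => ?_)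
    simp only [hcX, hcY, Pi.add_apply]
    ring
  · refine Eventually.of_forall fun ω z _ => ?_
    have f1 : HasFDerivAt (fun z : ℂ × ℂ => z.1 * (X ω : ℂ))
        ((X ω : ℂ) • ContinuousLinearMap.fst ℂ ℂ ℂ) z :=
      (hasFDerivAt_fst (p := z)).mul_const _
    have f2 : HasFDerivAt (fun z : ℂ × ℂ => z.2 * (Y ω : ℂ))
        ((Y ω : ℂ) • ContinuousLinearMap.snd ℂ ℂ ℂ) z :=
      (hasFDerivAt_snd (p := z)).mul_const _
    refine ((f1.cexp.fun_mul f2.cexp).const_mul (w ω)).congr_fderiv ?_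
    rw [hF']
    ext <;> simp <;> ring

end Holomorphy

/-! ### Landau's lemma for positive measures -/

section Landau
open ProbabilityTheory
variable {Ω : Type*} [MeasurableSpace Ω] {ν : Measure Ω} {X : Ω → ℝ}

/-- Landau's lemma: the abscissa of convergence of the Laplace transform of a positive measure is a
singularity. -/
lemma integrable_exp_of_continuation (hX : Measurable X) {b₀ b₁ : ℝ}
    (h : ∀ t, b₀ < t → Integrable (fun ω => Real.exp (t * X ω)) ν) {g : ℂ → ℂ}
    (hg : DifferentiableOn ℂ g {z | b₁ < z.re})
    (hgJ : ∀ z : ℂ, b₀ < z.re → g z = ∫ ω, Complex.exp (z * X ω) ∂ν) {t : ℝ} (ht : b₁ < t) :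
    Integrable (fun ω => Real.exp (t * X ω)) ν := by
  rcases lt_or_ge b₀ t with h0 | h0
  · exact h t h0
  have hS : MeasurableSet {ω | X ω < 0} := hX measurableSet_Iio
  -- Lowering t can destroy convergence only where X < 0. On the complement every smaller exponent
  -- is dominated by one that converges.
  set ν₁ := ν.restrict {ω | X ω < 0} with hν₁
  set ν₂ := ν.restrict {ω | X ω < 0}ᶜ with hν₂
  have hX2 : ∀ᵐ ω ∂ν₂, 0 ≤ X ω := by
    filter_upwards [ae_restrict_mem hS.compl] with ω hω
    simpa using hω
  have hX1 : ∀ᵐ ω ∂ν₁, X ω < 0 := ae_restrict_mem hS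
  have h2 : ∀ s, Integrable (fun ω => Real.exp (s * X ω)) ν₂ := by
    intro s
    refine ((h (max s (b₀ + 1)) (by linarith [le_max_right s (b₀ + 1)])).restrict
      (s := {ω | X ω < 0}ᶜ)).mono' (by fun_prop) ?_
    filter_upwards [hX2] with ω hω
    rw [Real.norm_eq_abs, Real.abs_exp]
    exact Real.exp_le_exp.2 (mul_le_mul_of_nonneg_right (le_max_left _ _) hω)
  suffices h1 : Integrable (fun ω => Real.exp (t * X ω)) ν₁ by
    have := IntegrableOn.union (s := {ω | X ω < 0}) (t := {ω | X ω < 0}ᶜ) h1 (h2 t)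
    rwa [Set.union_compl_self, integrableOn_univ] at this
  have hset2 : integrableExpSet X ν₂ = Set.univ := Set.eq_univ_of_forall h2
  have hset1 : Set.Ioi b₀ ⊆ interior (integrableExpSet X ν₁) :=
    interior_maximal (fun s hs => (h s hs).restrict) isOpen_Ioi
  have hd2 : Differentiable ℂ (complexMGF X ν₂) := by
    intro z
    exact (hasDerivAt_complexMGF (by simp [hset2])).differentiableAt
  -- The part with X ≥ 0 has an entire transform, so subtracting it leaves a continuation of the
  -- transform of the part with X < 0.
  set g₁ : ℂ → ℂ := fun z => g z - complexMGF X ν₂ z with hg₁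
  have hg₁d : DifferentiableOn ℂ g₁ {z | b₁ < z.re} := hg.sub hd2.differentiableOn
  have hg₁J : ∀ z : ℂ, b₀ < z.re → g₁ z = complexMGF X ν₁ z := by
    intro z hz
    have hint : Integrable (fun ω => Complex.exp (z * X ω)) ν := by
      have hm : AEStronglyMeasurable (fun ω => Complex.exp (z * X ω)) ν := by fun_prop
      rw [← integrable_norm_iff hm]
      refine (h z.re hz).congr (Eventually.of_forall fun ω => ?_)
      simp [Complex.norm_exp]
    rw [hg₁]
    beta_reduce
    rw [hgJ z hz, ← integral_add_compl hS hint]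
    unfold complexMGF
    ring
  set σ : ℝ := b₀ + 1 with hσ
  have hball : Metric.ball (σ : ℂ) (σ - b₁) ⊆ {z : ℂ | b₁ < z.re} := by
    intro z hz
    have := (Complex.abs_re_le_norm (z - σ)).trans_lt (by simpa [dist_eq_norm] using hz)
    simp only [Complex.sub_re, Complex.ofReal_re] at this
    have := (abs_lt.1 this).1
    show b₁ < z.re
    linarith
  have htball : (t : ℂ) ∈ Metric.ball (σ : ℂ) (σ - b₁) := by
    rw [Metric.mem_ball, dist_eq_norm, ← Complex.ofReal_sub, Complex.norm_real, Real.norm_eq_abs,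
      abs_lt]
    constructor <;> linarith
  -- The disc around σ = b₀ + 1 reaching to b₁ lies in the domain of g₁ and contains t, so the
  -- Taylor series at σ converges at t.
  have hsum := Complex.hasSum_taylorSeries_on_ball (hg₁d.mono hball) htball
  set φ : ℕ → Ω → ℝ := fun n ω => ((t - σ) * X ω) ^ n / n.factorial * Real.exp (σ * X ω) with hφ
  have hφi : ∀ n, Integrable (φ n) ν₁ := by
    intro n
    refine ((integrable_pow_mul_exp_of_mem_interior_integrableExpSet
      (hset1 (show σ ∈ Set.Ioi b₀ by simp [hσ])) n).const_mul
        ((t - σ) ^ n / n.factorial)).congr (Eventually.of_forall fun ω => ?_)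
    simp only [hφ, mul_pow]
    ring
  have hφ0 : ∀ n, ∀ᵐ ω ∂ν₁, 0 ≤ φ n ω := by
    intro n
    filter_upwards [hX1] with ω hω
    have : 0 ≤ (t - σ) * X ω := mul_nonneg_of_nonpos_of_nonpos (by linarith) hω.le
    positivity
  have hterm : ∀ n : ℕ, ((n.factorial : ℂ)⁻¹ • ((t : ℂ) - σ) ^ n • iteratedDeriv n g₁ σ) =
      ((∫ ω, φ n ω ∂ν₁ : ℝ) : ℂ) := by
    intro n
    have hev : g₁ =ᶠ[𝓝 (σ : ℂ)] complexMGF X ν₁ := by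
      have : {z : ℂ | b₀ < z.re} ∈ 𝓝 (σ : ℂ) :=
        (isOpen_lt continuous_const Complex.continuous_re).mem_nhds (by simp [hσ])
      filter_upwards [this] with z hz using hg₁J z hz
    rw [hev.iteratedDeriv_eq, iteratedDeriv_complexMGF (hset1 (by simp [hσ])), ← integral_smul,
      ← integral_smul, ← integral_complex_ofReal]
    refine integral_congr_ae (Eventually.of_forall fun ω => ?_)
    simp only [hφ, smul_eq_mul, mul_pow]
    push_cast
    ring
  simp only [hterm] at hsum
  have hsumm : Summable fun n => ∫ ω, φ n ω ∂ν₁ := by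
    have := hsum.summable
    exact_mod_cast this
  refine ⟨by fun_prop, ?_⟩
  rw [hasFiniteIntegral_iff_ofReal (Eventually.of_forall fun ω => (Real.exp_pos _).le)]
  -- As t < σ and X < 0, all terms of the exponential series are nonnegative. Sum and integral may
  -- be interchanged in the extended sense, and the convergent Taylor series shows that the integral
  -- is finite.
  have hae : ∀ᵐ ω ∂ν₁, ENNReal.ofReal (Real.exp (t * X ω)) = ∑' n, ENNReal.ofReal (φ n ω) := by
    filter_upwards [ae_all_iff.2 hφ0] with ω hω
    have hs : HasSum (fun n => φ n ω) (Real.exp (t * X ω)) := by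
      have := (NormedSpace.expSeries_div_hasSum_exp (𝔸 := ℝ) ((t - σ) * X ω)).mul_right
        (Real.exp (σ * X ω))
      rw [← Real.exp_eq_exp_ℝ, ← Real.exp_add] at this
      rwa [← add_mul, sub_add_cancel] at this
    rw [← hs.tsum_eq, ENNReal.ofReal_tsum_of_nonneg hω hs.summable]
  rw [lintegral_congr_ae hae, lintegral_tsum fun n => (hφi n).1.aemeasurable.ennreal_ofReal]
  have : ∀ n, ∫⁻ ω, ENNReal.ofReal (φ n ω) ∂ν₁ = ENNReal.ofReal (∫ ω, φ n ω ∂ν₁) := fun n =>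
    (ofReal_integral_eq_lintegral_ofReal (hφi n) (hφ0 n)).symm
  simp only [this]
  rw [← ENNReal.ofReal_tsum_of_nonneg (fun n => integral_nonneg_of_ae (hφ0 n)) hsumm]
  exact ENNReal.ofReal_lt_top

end Landau

/-! ### Identity theorems -/

section Identity

/-- A half plane without a countable set is connected. -/
lemma isConnected_halfPlane_diff_countable (x : ℝ) {s : Set ℂ} (hs : s.Countable) :
    IsConnected {z : ℂ | x < z.re ∧ z ∉ s} := by
  -- This map carries the plane injectively onto the half plane, so the claim reduces to
  -- connectedness of the complement of a countable set in the plane.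
  set f : ℂ → ℂ := fun z => ⟨x + Real.exp z.re, z.im⟩ with hf
  have hfc : Continuous f := by
    have : f = fun z => ((x + Real.exp z.re : ℝ) : ℂ) + ((z.im : ℝ) : ℂ) * Complex.I := by
      ext z
      simp [hf, Complex.mk_eq_add_mul_I]
    rw [this]
    fun_prop
  have hfi : Function.Injective f := by
    intro z w h
    have h1 := congrArg Complex.re h
    have h2 := congrArg Complex.im h
    simp only [hf, add_right_inj, Real.exp_eq_exp] at h1 h2
    exact Complex.ext h1 h2
  have hc := ((hs.preimage_of_injOn (f := f) hfi.injOn).isConnected_compl_of_one_lt_rank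
    (E := ℂ) (by simp [Complex.rank_real_complex])).image f hfc.continuousOn
  convert hc using 1
  ext z
  constructor
  · rintro ⟨h1, h2⟩
    have : f ⟨Real.log (z.re - x), z.im⟩ = z := by
      apply Complex.ext
      · simp [hf, Real.exp_log (sub_pos.2 h1)]
      · simp [hf]
    refine ⟨_, ?_, this⟩
    simpa [this] using h2
  · rintro ⟨w, hw, rfl⟩
    refine ⟨?_, hw⟩
    simp [hf, Real.exp_pos]

lemma eqOn_of_eventuallyEq {U : Set ℂ} (hU : IsOpen U) (hc : IsPreconnected U) {f g : ℂ → ℂ}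
    (hf : DifferentiableOn ℂ f U) (hg : DifferentiableOn ℂ g U) {V : Set ℂ} (hV : IsOpen V)
    {z : ℂ} (hzV : z ∈ V) (hzU : z ∈ U) (h : ∀ w ∈ V, f w = g w) {w : ℂ} (hw : w ∈ U) :
    f w = g w :=
  (hf.analyticOnNhd hU).eqOn_of_preconnected_of_eventuallyEq (hg.analyticOnNhd hU) hc hzU
    (by filter_upwards [hV.mem_nhds hzV] with w hw using h w hw) hw

/-- The identity theorem on a product of two domains. -/
lemma eqOn_prod_of_eqOn {U₁ U₂ V₁ V₂ : Set ℂ} (hU₁ : IsOpen U₁) (hU₂ : IsOpen U₂)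
    (hc₁ : IsPreconnected U₁) (hc₂ : IsPreconnected U₂) (hV₁ : IsOpen V₁) (hV₂ : IsOpen V₂)
    (h₁ : (U₁ ∩ V₁).Nonempty) (h₂ : (U₂ ∩ V₂).Nonempty) {f g : ℂ × ℂ → ℂ}
    (hf : DifferentiableOn ℂ f (U₁ ×ˢ U₂)) (hg : DifferentiableOn ℂ g (U₁ ×ˢ U₂))
    (h : ∀ z ∈ U₁ ×ˢ U₂, z.1 ∈ V₁ → z.2 ∈ V₂ → f z = g z) : ∀ z ∈ U₁ ×ˢ U₂, f z = g z := by
  obtain ⟨x, hxU, hxV⟩ := h₁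
  obtain ⟨y, hyU, hyV⟩ := h₂
  -- The one-variable identity theorem is applied in the second variable with the first one in V₁,
  -- and then in the first variable.
  have step1 : ∀ z ∈ U₁ ×ˢ U₂, z.1 ∈ V₁ → f z = g z := by
    rintro ⟨z1, z2⟩ ⟨hz1, hz2⟩ hzV
    have hcomp : ∀ {k : ℂ × ℂ → ℂ}, DifferentiableOn ℂ k (U₁ ×ˢ U₂) →
        DifferentiableOn ℂ (fun w => k (z1, w)) U₂ := fun hk =>
      hk.comp (by fun_prop : Differentiable ℂ fun w : ℂ => (z1, w)).differentiableOn
        fun w hw => ⟨hz1, hw⟩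
    exact eqOn_of_eventuallyEq hU₂ hc₂ (hcomp hf) (hcomp hg) (hU₂.inter hV₂) ⟨hyU, hyV⟩ hyU
      (fun w hw => h (z1, w) ⟨hz1, hw.1⟩ hzV hw.2) hz2
  rintro ⟨z1, z2⟩ ⟨hz1, hz2⟩
  have hcomp : ∀ {k : ℂ × ℂ → ℂ}, DifferentiableOn ℂ k (U₁ ×ˢ U₂) →
      DifferentiableOn ℂ (fun w => k (w, z2)) U₁ := fun hk =>
    hk.comp (by fun_prop : Differentiable ℂ fun w : ℂ => (w, z2)).differentiableOn
      fun w hw => ⟨hw, hz2⟩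
  exact eqOn_of_eventuallyEq hU₁ hc₁ (hcomp hf) (hcomp hg) (hU₁.inter hV₁) ⟨hxU, hxV⟩ hxU
    (fun w hw => step1 (w, z2) ⟨hw.1, hz2⟩ hw.2) hz1

end Identity

end Confluent

namespace Confluent

/-! ### Lower bounds for minors -/

section Minors
variable {n : ℕ}

lemma one_le_det_one_add {N : Matrix (Fin n) (Fin n) ℝ} (hN : N.PosSemidef) : 1 ≤ (1 + N).det := by
  have hH : (1 + N).IsHermitian := isHermitian_one.add hN.1
  rw [hH.det_eq_prod_eigenvalues]
  refine Finset.one_le_prod fun i _ => ?_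
  have h1 := hN.dotProduct_mulVec_nonneg (hH.eigenvectorBasis i)
  have h2 : (hH.eigenvectorBasis i : Fin n → ℝ) ⬝ᵥ (hH.eigenvectorBasis i : Fin n → ℝ) = 1 := by
    have := hH.eigenvectorBasis.orthonormal.1 i
    rw [EuclideanSpace.norm_eq, Real.sqrt_eq_one] at this
    rw [← this, dotProduct]
    exact Finset.sum_congr rfl fun j _ => by rw [Real.norm_eq_abs, sq_abs, sq]
  have h3 := hH.eigenvalues_eq i
  rw [star_trivial, add_mulVec, one_mulVec, dotProduct_add, h2] at h3
  rw [star_trivial] at h1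
  change 1 ≤ hH.eigenvalues i
  rw [h3, RCLike.re_to_real]
  linarith

/-- The product of `d i` over `S` is at most the minor of `X` on `S` if `X - d` is positive
semidefinite on `S`. -/
lemma prod_le_det_rowsMat {X Y : Matrix (Fin n) (Fin n) ℝ} {S : Finset (Fin n)} {d : Fin n → ℝ}
    (hY : Y.PosSemidef) (hd : ∀ i ∈ S, 0 < d i)
    (h : ∀ i ∈ S, ∀ j ∈ S, X i j = Y i j + diagonal d i j) :
    ∏ i ∈ S, d i ≤ (rowsMat X S id).det := by
  set P : Matrix (Fin n) (Fin n) ℝ := diagonal fun i => if i ∈ S then 1 else 0 with hP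
  set dh : Fin n → ℝ := fun i => if i ∈ S then d i else 1 with hdh
  set r : Fin n → ℝ := fun i => √(dh i) with hr
  have hdp : ∀ i, 0 < dh i := fun i => by
    by_cases hi : i ∈ S
    · simpa [hdh, hi] using hd i hi
    · simp [hdh, hi]
  have hrr : ∀ i, r i * r i = dh i := fun i => Real.mul_self_sqrt (hdp i).le
  have hr0 : ∀ i, r i ≠ 0 := fun i => (Real.sqrt_pos.2 (hdp i)).ne'
  set N : Matrix (Fin n) (Fin n) ℝ := diagonal (fun i => (r i)⁻¹) * (P * Y * P) *
    diagonal (fun i => (r i)⁻¹) with hN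
  have hPs : P.conjTranspose = P := by simp [hP]
  have hNp : N.PosSemidef := by
    have h1 := hY.mul_mul_conjTranspose_same P
    rw [hPs] at h1
    have h2 := h1.mul_mul_conjTranspose_same (diagonal (fun i => (r i)⁻¹))
    rwa [diagonal_conjTranspose, star_trivial] at h2
  have hNij : ∀ i j, N i j = (r i)⁻¹ * ((if i ∈ S then 1 else 0) * Y i j *
      (if j ∈ S then 1 else 0)) * (r j)⁻¹ := fun i j => by
    simp only [hN, hP, mul_diagonal, diagonal_mul]
  have hPP : P * P = P := by
    simp [hP, diagonal_mul_diagonal]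
  -- With P the projection to S, the matrix P X + (1 - P) is a unipotent factor times P X P + (1 -
  -- P). The latter is a congruence of 1 + N by the square roots of d, with N positive semidefinite,
  -- so its determinant is the product of d times a number at least 1.
  have e1 : rowsMat X S id = (1 + P * (X * (1 - P))) *
      (diagonal r * (1 + N) * diagonal r) := by
    have e3 : diagonal r * (1 + N) * diagonal r = P * X * P + (1 - P) := by
      ext i j
      simp only [hP, Matrix.add_apply, Matrix.sub_apply, diagonal_mul, mul_diagonal, hNij,
        Matrix.one_apply, diagonal_apply]
      by_cases hij : i = j
      · subst hij
        by_cases hi : i ∈ S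
        · have := h i hi i hi
          have h3 := hrr i
          simp only [hdh, hi, if_true] at h3
          simp only [diagonal_apply_eq] at this
          simp only [hi, if_true, this]
          have h4 := hr0 i
          field_simp
          linear_combination h3
        · have h3 := hrr i
          simp only [hdh, hi, if_false] at h3
          simp [hi, h3]
      · by_cases hi : i ∈ S <;> by_cases hj : j ∈ S
        · have := h i hi j hj
          simp only [diagonal_apply_ne _ hij, add_zero] at this
          simp only [hij, hi, hj, if_true, if_false, this]
          have h4 := hr0 i
          have h5 := hr0 j
          field_simp
          ring
        · simp [hij, hi, hj]
        · simp [hij, hi, hj]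
        · simp [hij, hi, hj]
    have e4 : P * (X * (1 - P)) * (P * X * P + (1 - P)) = P * X * (1 - P) := by
      have a1 : (1 - P) * (P * X * P) = 0 := by
        rw [← mul_assoc, ← mul_assoc, sub_mul, one_mul, hPP, sub_self, zero_mul, zero_mul]
      have a2 : (1 - P) * (1 - P) = 1 - P := by
        rw [mul_sub, sub_mul, sub_mul, hPP]
        simp
      rw [mul_add, mul_assoc, mul_assoc, a1, mul_assoc P, mul_assoc X, a2, mul_zero, mul_zero,
        zero_add, mul_assoc]
    rw [e3, add_mul, one_mul, e4]
    have : rowsMat X S id = P * X + (1 - P) := by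
      ext i j
      by_cases hi : i ∈ S
      · simp [rowsMat, hi, hP, diagonal_mul, Matrix.one_apply, diagonal_apply]
      · simp [rowsMat, hi, hP, diagonal_mul, Matrix.one_apply, diagonal_apply, Pi.single_apply,
          eq_comm]
    rw [this]
    noncomm_ring
  have e2 : (1 + P * (X * (1 - P))).det = 1 := by
    rw [det_one_add_mul_comm, mul_assoc, sub_mul, one_mul, hPP, sub_self, mul_zero, add_zero,
      det_one]
  rw [e1, det_mul, e2, one_mul, det_mul, det_mul, det_diagonal]
  have e5 : ∏ i ∈ S, d i = ∏ i, dh i := by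
    simp [hdh, Finset.prod_ite_mem]
  have e6 : ∏ i, dh i = (∏ i, r i) * ∏ i, r i := by
    rw [← Finset.prod_mul_distrib]
    exact Finset.prod_congr rfl fun i _ => (hrr i).symm
  rw [e5, e6]
  have h0 : 0 < ∏ i, r i := Finset.prod_pos fun i _ => Real.sqrt_pos.2 (hdp i)
  nlinarith [one_le_det_one_add hNp, mul_pos h0 h0]

/-- The normalizing product is distributed over the rows, so that a normalized minor is seen to be a
polynomial in the scaled entries. -/
lemma prod_mul_det_rowsMat (X : Matrix (Fin n) (Fin n) ℝ) (S : Finset (Fin n)) (d : Fin n → ℝ) :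
    (∏ i ∈ S, d i) * (rowsMat X S id).det =
      (rowsMat (Matrix.of fun i j => d i * X i j) S id).det := by
  have : (∏ i ∈ S, d i) = ∏ i, if i ∈ S then d i else 1 := by simp [Finset.prod_ite_mem]
  rw [this, ← det_mul_column]
  congr 1
  ext i j
  by_cases hi : i ∈ S <;> simp [rowsMat, hi]

end Minors

/-! ### Algebras of weights, and the diagonal families -/

section Weights
variable {Λ : Type} {n : ℕ} {D : Λ → Set (Coord n)}

lemma det_mem (𝓐 : Subalgebra ℂ (Λ → Coord n → ℂ)) {M : Λ → Coord n → Matrix (Fin n) (Fin n) ℝ}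
    (hM : ∀ i j, (fun l c => (M l c i j : ℂ)) ∈ 𝓐) : (fun l c => ((M l c).det : ℂ)) ∈ 𝓐 := by
  have : (fun l c => ((M l c).det : ℂ)) = ∑ τ : Equiv.Perm (Fin n), (((τ.sign : ℤ) : ℝ) : ℂ) •
      ∏ i, fun l c => (M l c i (τ i) : ℂ) := by
    ext l c
    simp [det_eq_sum_rows]
  rw [this]
  exact sum_mem fun τ _ => 𝓐.smul_mem (prod_mem fun i _ => hM i _) _

/-- A subalgebra is closed under differentiation if the derivatives of its generators lie in it. -/
lemma exists_deriv_of_adjoin {s : Set (Λ → Coord n → ℂ)} {v : Coord n}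
    (hs : ∀ f ∈ s, ∃ f' ∈ Algebra.adjoin ℂ s, ∀ l, ∀ c ∈ D l, HasLineDerivAt ℝ (f l) (f' l c) c v)
    {f : Λ → Coord n → ℂ} (hf : f ∈ Algebra.adjoin ℂ s) :
    ∃ f' ∈ Algebra.adjoin ℂ s, ∀ l, ∀ c ∈ D l, HasLineDerivAt ℝ (f l) (f' l c) c v := by
  induction hf using Algebra.adjoin_induction with
  | mem f hf => exact hs f hf
  | algebraMap r => exact ⟨0, zero_mem _, fun l c _ => hasDerivAt_const (0 : ℝ) r⟩
  | add f g _ _ hf hg =>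
    obtain ⟨f', hf', h1⟩ := hf
    obtain ⟨g', hg', h2⟩ := hg
    exact ⟨f' + g', add_mem hf' hg', fun l c hc => HasDerivAt.fun_add (h1 l c hc) (h2 l c hc)⟩
  | mul f g hfm hgm hf hg =>
    obtain ⟨f', hf', h1⟩ := hf
    obtain ⟨g', hg', h2⟩ := hg
    refine ⟨f' * g + f * g', add_mem (mul_mem hf' hgm) (mul_mem hfm hg'), fun l c hc => ?_⟩
    refine (HasDerivAt.fun_mul (h1 l c hc) (h2 l c hc)).congr_deriv ?_
    simp

lemma polyBdd_of_adjoin {s : Set (Λ → Coord n → ℂ)} {D : Set (Coord n)} {l : Λ}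
    (hs : ∀ f ∈ s, PolyBdd D (f l)) {f : Λ → Coord n → ℂ} (hf : f ∈ Algebra.adjoin ℂ s) :
    PolyBdd D (f l) := by
  induction hf using Algebra.adjoin_induction with
  | mem f hf => exact hs f hf
  | algebraMap r => exact PolyBdd.const r
  | add f g _ _ hf hg => exact hf.add hg
  | mul f g _ _ hf hg => exact hf.mul hg

end Weights

/-- Families of cones `{u > 0, u + E > 0}` with diagonal `E` of fixed signature. -/
structure DiagFamily (Λ : Type) (n : ℕ) where
  /-- the diagonal matrix -/
  E : Λ → Fin n → ℝ
  /-- the set of negative entries -/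
  V : Finset (Fin n)
  /-- the matrix in the exponential -/
  y : Λ → Matrix (Fin n) (Fin n) ℝ
  hneg : ∀ l, ∀ k ∈ V, E l k < 0
  hpos : ∀ l, ∀ k ∉ V, 0 < E l k
  hy : ∀ l, (y l).PosDef

namespace DiagFamily
variable {Λ : Type} {n : ℕ} (G : DiagFamily Λ n)

lemma E_ne_zero (l : Λ) (k : Fin n) : G.E l k ≠ 0 := by
  by_cases h : k ∈ G.V
  · exact (G.hneg l k h).ne
  · exact (G.hpos l k h).ne'

/-- The family of cones. -/
noncomputable def F : ConeFamily Λ n where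
  A _ := 0
  B l := diagonal (G.E l)
  -- With this normalization the minor of u on V and, with q, the minor of u + E on the complement
  -- are at least 1 on the cone. Both are polynomials in the entries of u and the inverses of E, so
  -- entries of E may tend to infinity.
  p l := ∏ k ∈ G.V, |(G.E l k)⁻¹|
  q l := ∏ k ∈ G.Vᶜ, |(G.E l k)⁻¹|
  y := G.y
  hA _ := isHermitian_zero
  hB _ := isHermitian_diagonal _
  hp l := Finset.prod_pos fun k _ => abs_pos.2 (inv_ne_zero (G.E_ne_zero l k))
  hq l := Finset.prod_pos fun k _ => abs_pos.2 (inv_ne_zero (G.E_ne_zero l k))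
  hy := G.hy

/-- The normalized minor of `u` on the negative entries. -/
noncomputable def minorA (l : Λ) (c : Coord n) : ℝ :=
  G.F.p l * (rowsMat (symMat c + G.F.A l) G.V id).det

/-- The normalized minor of `u + E` on the positive entries. -/
noncomputable def minorB (l : Λ) (c : Coord n) : ℝ :=
  G.F.q l * (rowsMat (symMat c + G.F.B l) G.Vᶜ id).det

/-- On the block V one has u = (u + E) + |E|, with u + E positive definite. -/
lemma one_le_minorA {l : Λ} {c : Coord n} (hc : c ∈ G.F.D l) : 1 ≤ G.minorA l c := by
  have h := prod_le_det_rowsMat (X := symMat c + G.F.A l) (S := G.V) (d := fun i => |G.E l i|)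
    hc.2.posSemidef (fun i _ => abs_pos.2 (G.E_ne_zero l i)) (fun i hi j _ => by
      by_cases hij : i = j
      · subst hij
        simp [F, abs_of_neg (G.hneg l i hi)]
      · simp [F, hij])
  have e : G.F.p l = (∏ k ∈ G.V, |G.E l k|)⁻¹ := by simp [F, abs_inv]
  rw [minorA, e, ← div_eq_inv_mul, one_le_div (Finset.prod_pos fun k _ => abs_pos.2 (G.E_ne_zero l k))]
  exact h

/-- On the complement of V one has u + E = u + |E|, with u positive definite. -/
lemma one_le_minorB {l : Λ} {c : Coord n} (hc : c ∈ G.F.D l) : 1 ≤ G.minorB l c := by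
  have h := prod_le_det_rowsMat (X := symMat c + G.F.B l) (S := G.Vᶜ) (d := fun i => |G.E l i|)
    hc.1.posSemidef (fun i _ => abs_pos.2 (G.E_ne_zero l i)) (fun i hi j _ => by
      by_cases hij : i = j
      · subst hij
        simp [F, abs_of_pos (G.hpos l i (by simpa using hi))]
      · simp [F, hij])
  have e : G.F.q l = (∏ k ∈ G.Vᶜ, |G.E l k|)⁻¹ := by simp [F, abs_inv]
  rw [minorB, e, ← div_eq_inv_mul, one_le_div (Finset.prod_pos fun k _ => abs_pos.2 (G.E_ne_zero l k))]
  exact h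

/-- The polynomial weights. -/
def polyGen : Set (Λ → Coord n → ℂ) :=
  Set.range (fun (e : Sym2 (Fin n)) (_ : Λ) (c : Coord n) => (c e : ℂ)) ∪
    Set.range (fun (ij : Fin n × Fin n) (l : Λ) (_ : Coord n) => (G.y l ij.1 ij.2 : ℂ)) ∪
    Set.range (fun (k : Fin n) (l : Λ) (_ : Coord n) => (((G.E l k)⁻¹ : ℝ) : ℂ))

/-- Generators of the algebra of weights. -/
def gen : Set (Λ → Coord n → ℂ) :=
  G.polyGen ∪ {fun l c => (((G.minorA l c)⁻¹ : ℝ) : ℂ), fun l c => (((G.minorB l c)⁻¹ : ℝ) : ℂ)}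

/-- The algebra of weights. -/
def alg : Subalgebra ℂ (Λ → Coord n → ℂ) := Algebra.adjoin ℂ G.gen

lemma coord_mem (e : Sym2 (Fin n)) :
    (fun (_ : Λ) (c : Coord n) => (c e : ℂ)) ∈ Algebra.adjoin ℂ G.polyGen :=
  Algebra.subset_adjoin (Or.inl (Or.inl ⟨e, rfl⟩))

lemma inv_mem (k : Fin n) :
    (fun (l : Λ) (_ : Coord n) => (((G.E l k)⁻¹ : ℝ) : ℂ)) ∈ Algebra.adjoin ℂ G.polyGen :=
  Algebra.subset_adjoin (Or.inr ⟨k, rfl⟩)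

lemma adjoin_polyGen_le : Algebra.adjoin ℂ G.polyGen ≤ G.alg :=
  Algebra.adjoin_mono Set.subset_union_left

lemma symMat_mem (i j : Fin n) :
    (fun (_ : Λ) (c : Coord n) => (symMat c i j : ℂ)) ∈ Algebra.adjoin ℂ G.polyGen :=
  G.coord_mem s(i, j)

lemma minorA_mem : (fun l c => (G.minorA l c : ℂ)) ∈ Algebra.adjoin ℂ G.polyGen := by
  have e : ∀ l c, G.minorA l c =
      (rowsMat (Matrix.of fun i j => |(G.E l i)⁻¹| * (symMat c + G.F.A l) i j) G.V id).det :=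
    fun l c => prod_mul_det_rowsMat _ _ _
  simp only [e]
  refine det_mem _ fun i j => ?_
  by_cases hi : i ∈ G.V
  · have : (fun (l : Λ) (c : Coord n) => ((rowsMat (Matrix.of fun i j => |(G.E l i)⁻¹| *
        (symMat c + G.F.A l) i j) G.V id i j : ℝ) : ℂ)) =
        -((fun (l : Λ) (_ : Coord n) => (((G.E l i)⁻¹ : ℝ) : ℂ)) *
          fun (_ : Λ) (c : Coord n) => (symMat c i j : ℂ)) := by
      ext l c
      simp [rowsMat, hi, F, abs_of_neg (G.hneg l i hi)]
    rw [this]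
    exact neg_mem (mul_mem (G.inv_mem i) (G.symMat_mem i j))
  · simp only [rowsMat, of_apply, hi, if_false]
    exact Subalgebra.algebraMap_mem _ _

/-- Dividing row i of u + E by E_i leaves an identity term, so only the inverse of E occurs. -/
lemma inv_mul_B_mem {i : Fin n} (j : Fin n) :
    (fun (l : Λ) (c : Coord n) => (((G.E l i)⁻¹ * (symMat c + G.F.B l) i j : ℝ) : ℂ)) ∈
      Algebra.adjoin ℂ G.polyGen := by
  have : (fun (l : Λ) (c : Coord n) => (((G.E l i)⁻¹ * (symMat c + G.F.B l) i j : ℝ) : ℂ)) =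
      ((fun (l : Λ) (_ : Coord n) => (((G.E l i)⁻¹ : ℝ) : ℂ)) *
        fun (_ : Λ) (c : Coord n) => (symMat c i j : ℂ)) + algebraMap ℂ _ (if i = j then 1 else 0) := by
    ext l c
    by_cases hij : i = j
    · subst hij
      simp [F, mul_add, inv_mul_cancel₀ (Complex.ofReal_ne_zero.2 (G.E_ne_zero l i))]
    · simp [F, hij]
  rw [this]
  exact add_mem (mul_mem (G.inv_mem i) (G.symMat_mem i j)) (Subalgebra.algebraMap_mem _ _)

lemma minorB_mem : (fun l c => (G.minorB l c : ℂ)) ∈ Algebra.adjoin ℂ G.polyGen := by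
  have e : ∀ l c, G.minorB l c =
      (rowsMat (Matrix.of fun i j => |(G.E l i)⁻¹| * (symMat c + G.F.B l) i j) G.Vᶜ id).det :=
    fun l c => prod_mul_det_rowsMat _ _ _
  simp only [e]
  refine det_mem _ fun i j => ?_
  by_cases hi : i ∈ G.V
  · simp only [rowsMat, of_apply, Finset.mem_compl, hi, not_true, if_false]
    exact Subalgebra.algebraMap_mem _ _
  · have : (fun (l : Λ) (c : Coord n) => ((rowsMat (Matrix.of fun i j => |(G.E l i)⁻¹| *
        (symMat c + G.F.B l) i j) G.Vᶜ id i j : ℝ) : ℂ)) =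
        fun (l : Λ) (c : Coord n) => (((G.E l i)⁻¹ * (symMat c + G.F.B l) i j : ℝ) : ℂ) := by
      ext l c
      simp [rowsMat, hi, abs_of_pos (G.hpos l i hi)]
    rw [this]
    exact G.inv_mul_B_mem j

lemma polyGen_deriv {f : Λ → Coord n → ℂ} (hf : f ∈ Algebra.adjoin ℂ G.polyGen) (v : Coord n) :
    ∃ f' ∈ Algebra.adjoin ℂ G.polyGen, ∀ l, ∀ c ∈ G.F.D l,
      HasLineDerivAt ℝ (f l) (f' l c) c v := by
  refine exists_deriv_of_adjoin ?_ hf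
  rintro f ((⟨e, rfl⟩ | ⟨ij, rfl⟩) | ⟨k, rfl⟩)
  · refine ⟨algebraMap ℂ _ (v e : ℂ), Subalgebra.algebraMap_mem _ _, fun l c _ => ?_⟩
    have h : HasDerivAt (fun t : ℝ => c e + t * v e) (v e) 0 := by
      simpa using ((hasDerivAt_id (0 : ℝ)).mul_const (v e)).const_add (c e)
    exact h.ofReal_comp
  · exact ⟨0, zero_mem _, fun l c _ => hasDerivAt_const _ _⟩
  · exact ⟨0, zero_mem _, fun l c _ => hasDerivAt_const _ _⟩

lemma invA_mem : (fun l c => (((G.minorA l c)⁻¹ : ℝ) : ℂ)) ∈ G.alg :=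
  Algebra.subset_adjoin (Or.inr (Or.inl rfl))

lemma invB_mem : (fun l c => (((G.minorB l c)⁻¹ : ℝ) : ℂ)) ∈ G.alg :=
  Algebra.subset_adjoin (Or.inr (Or.inr rfl))

/-- The derivative of the inverse of a minor M is -M'/M², and M' is a polynomial weight. -/
lemma alg_deriv {f : Λ → Coord n → ℂ} (hf : f ∈ G.alg) (v : Coord n) :
    ∃ f' ∈ G.alg, ∀ l, ∀ c ∈ G.F.D l, HasLineDerivAt ℝ (f l) (f' l c) c v := by
  have inv : ∀ M : Λ → Coord n → ℝ, (fun l c => (M l c : ℂ)) ∈ Algebra.adjoin ℂ G.polyGen →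
      (∀ l, ∀ c ∈ G.F.D l, 1 ≤ M l c) → (fun l c => (((M l c)⁻¹ : ℝ) : ℂ)) ∈ G.alg →
      ∃ f' ∈ G.alg, ∀ l, ∀ c ∈ G.F.D l,
        HasLineDerivAt ℝ (fun c => (((M l c)⁻¹ : ℝ) : ℂ)) (f' l c) c v := by
    intro M hM h1 hi
    obtain ⟨g, hg, h⟩ := G.polyGen_deriv hM v
    refine ⟨-(g * (fun l c => (((M l c)⁻¹ : ℝ) : ℂ)) ^ 2),
      neg_mem (mul_mem (G.adjoin_polyGen_le hg) (pow_mem hi 2)), fun l c hc => ?_⟩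
    have h2 := h l c hc
    have hne : (M l (c + (0 : ℝ) • v) : ℂ) ≠ 0 := by
      have := h1 l c hc
      simp only [zero_smul, add_zero]
      exact_mod_cast (by linarith : M l c ≠ 0)
    have h3 := HasDerivAt.fun_inv h2 hne
    simp only [Complex.ofReal_inv, zero_smul, add_zero] at h3 ⊢
    refine HasDerivAt.congr_deriv h3 ?_
    simp [div_eq_mul_inv]
  refine exists_deriv_of_adjoin ?_ hf
  rintro f (hf | rfl | rfl)
  · obtain ⟨f', h1, h2⟩ := G.polyGen_deriv (Algebra.subset_adjoin hf) v
    exact ⟨f', G.adjoin_polyGen_le h1, h2⟩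
  · exact inv _ G.minorA_mem (fun l c hc => G.one_le_minorA hc) G.invA_mem
  · exact inv _ G.minorB_mem (fun l c hc => G.one_le_minorB hc) G.invB_mem

lemma polyGen_polyBdd {f : Λ → Coord n → ℂ} (hf : f ∈ Algebra.adjoin ℂ G.polyGen) (l : Λ)
    (D : Set (Coord n)) : PolyBdd D (f l) := by
  refine polyBdd_of_adjoin ?_ hf
  rintro f ((⟨e, rfl⟩ | ⟨ij, rfl⟩) | ⟨k, rfl⟩)
  · exact PolyBdd.coord e
  · exact PolyBdd.const _
  · exact PolyBdd.const _

lemma admissible : G.F.Admissible G.alg where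
  polyBdd f hf l := by
    have inv : ∀ M : Λ → Coord n → ℝ, (fun l c => (M l c : ℂ)) ∈ Algebra.adjoin ℂ G.polyGen →
        (∀ l, ∀ c ∈ G.F.D l, 1 ≤ M l c) →
        PolyBdd (G.F.D l) (fun c => (((M l c)⁻¹ : ℝ) : ℂ)) := by
      intro M hM h1
      have hc := (G.polyGen_polyBdd hM l (G.F.D l)).1
      refine ⟨?_, 1, 0, fun c hc => ?_⟩
      · simp only [Complex.ofReal_inv]
        refine hc.inv₀ fun c hc => ?_
        have := h1 l c hc
        exact_mod_cast (by linarith : M l c ≠ 0)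
      · have := h1 l c hc
        rw [Complex.norm_real, Real.norm_eq_abs, abs_of_nonneg (by positivity)]
        simpa using inv_le_one_of_one_le₀ this
    refine polyBdd_of_adjoin ?_ hf
    rintro f (hf | rfl | rfl)
    · exact G.polyGen_polyBdd (Algebra.subset_adjoin hf) l _
    · exact inv _ G.minorA_mem fun l c hc => G.one_le_minorA hc
    · exact inv _ G.minorB_mem fun l c hc => G.one_le_minorB hc
  deriv f hf i j := G.alg_deriv hf _
  y_mem i j := G.adjoin_polyGen_le (Algebra.subset_adjoin (Or.inl (Or.inr ⟨(i, j), rfl⟩)))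

end DiagFamily

end Confluent

/-! ### Integrals as Laplace transforms in log determinants; raising both exponents -/

namespace Confluent

/-- The weight w is turned into a density, which reduces the claim to
`integrable_exp_of_continuation`. -/
lemma integrable_mul_exp_of_continuation {Ω : Type*} [MeasurableSpace Ω] {μ : Measure Ω}
    {w X : Ω → ℝ} (hw : Measurable w) (hw0 : ∀ᵐ ω ∂μ, 0 ≤ w ω) (hX : Measurable X) {b₀ b₁ : ℝ}
    (h : ∀ t, b₀ < t → Integrable (fun ω => w ω * Real.exp (t * X ω)) μ) {g : ℂ → ℂ}
    (hg : DifferentiableOn ℂ g {z | b₁ < z.re})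
    (hgJ : ∀ z : ℂ, b₀ < z.re → g z = ∫ ω, (w ω : ℂ) * Complex.exp (z * X ω) ∂μ) {t : ℝ}
    (ht : b₁ < t) : Integrable (fun ω => w ω * Real.exp (t * X ω)) μ := by
  have hm : Measurable fun ω => (w ω).toNNReal := hw.real_toNNReal
  have e : ∀ s : ℝ, Integrable (fun ω => Real.exp (s * X ω))
      (μ.withDensity fun ω => ((w ω).toNNReal : ENNReal)) ↔
      Integrable (fun ω => w ω * Real.exp (s * X ω)) μ := fun s => by
    rw [integrable_withDensity_iff_integrable_smul hm]
    refine integrable_congr ?_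
    filter_upwards [hw0] with ω hω
    rw [NNReal.smul_def, Real.coe_toNNReal _ hω, smul_eq_mul]
  rw [← e]
  refine integrable_exp_of_continuation hX (fun t ht => (e t).2 (h t ht)) hg (fun z hz => ?_) ht
  rw [hgJ z hz, integral_withDensity_eq_integral_smul hm]
  refine integral_congr_ae ?_
  filter_upwards [hw0] with ω hω
  rw [NNReal.smul_def, Real.coe_toNNReal _ hω, Complex.real_smul]

namespace ConeFamily
variable {Λ : Type} {n : ℕ} (F : ConeFamily Λ n)

/-- The logarithm of `q det(u + B)`. -/
noncomputable def logB (l : Λ) (c : Coord n) : ℝ := Real.log (F.q l * (symMat c + F.B l).det)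

/-- The logarithm of `p det(u + A)`. -/
noncomputable def logA (l : Λ) (c : Coord n) : ℝ := Real.log (F.p l * (symMat c + F.A l).det)

lemma measurable_logB (l : Λ) : Measurable (F.logB l) :=
  Real.measurable_log.comp ((continuous_det_symMat _).measurable.const_mul _)

lemma measurable_logA (l : Λ) : Measurable (F.logA l) :=
  Real.measurable_log.comp ((continuous_det_symMat _).measurable.const_mul _)

/-- In this form J is a two-sided Laplace transform in the logarithms of the two determinants, as
needed for holomorphy in the exponents and for Landau's lemma. -/
lemma k_eq_exp {l : Λ} {c : Coord n} (hc : c ∈ F.D l) (a b : ℂ) :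
    F.k l a b c = (Real.exp (-(symMat c * F.y l).trace) : ℂ) *
      (Complex.exp (a * F.logB l c) * Complex.exp (b * F.logA l c)) := by
  have h1 := mul_pos (F.hq l) hc.2.det_pos
  have h2 := mul_pos (F.hp l) hc.1.det_pos
  unfold k kern logA logB
  rw [Complex.cpow_def_of_ne_zero (by exact_mod_cast h1.ne'),
    Complex.cpow_def_of_ne_zero (by exact_mod_cast h2.ne'), Complex.ofReal_log h1.le,
    Complex.ofReal_log h2.le, mul_assoc, mul_comm a, mul_comm b]

lemma J_eq_integral_exp (f : Λ → Coord n → ℂ) (l : Λ) (a b : ℂ) :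
    F.J f l a b = ∫ c in F.D l, (f l c * (Real.exp (-(symMat c * F.y l).trace) : ℂ)) *
      (Complex.exp (a * F.logB l c) * Complex.exp (b * F.logA l c)) := by
  unfold J
  refine setIntegral_congr_fun (F.measurableSet_D l) fun c hc => ?_
  rw [F.k_eq_exp hc, mul_assoc]

lemma differentiableOn_J {f : Λ → Coord n → ℂ} {l : Λ}
    (hf : AEStronglyMeasurable (f l) (volume.restrict (F.D l))) {a₀ b₀ : ℝ}
    (h : ∀ a b : ℝ, a₀ < a → b₀ < b → IntegrableOn (fun c => f l c * F.k l a b c) (F.D l)) :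
    DifferentiableOn ℂ (fun z : ℂ × ℂ => F.J f l z.1 z.2) {z | a₀ < z.1.re ∧ b₀ < z.2.re} := by
  simp only [J_eq_integral_exp]
  have hm : AEStronglyMeasurable (fun c => f l c * (Real.exp (-(symMat c * F.y l).trace) : ℂ))
      (volume.restrict (F.D l)) := by
    refine hf.mul (Continuous.aestronglyMeasurable ?_)
    exact Complex.continuous_ofReal.comp (Real.continuous_exp.comp continuous_trace_symMat.neg)
  refine differentiableOn_integral_exp hm
    (F.measurable_logB l).aemeasurable (F.measurable_logA l).aemeasurable fun a b ha hb => ?_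
  refine (h a b ha hb).norm.congr ((ae_restrict_iff' (F.measurableSet_D l)).2
    (Eventually.of_forall fun c hc => ?_))
  beta_reduce
  rw [F.k_eq_exp hc]
  simp [Complex.norm_exp, mul_assoc]

variable {F} {𝓐 : Subalgebra ℂ (Λ → Coord n → ℂ)}

lemma Admissible.integrableOn (h𝓐 : F.Admissible 𝓐) {f : Λ → Coord n → ℂ} (hf : f ∈ 𝓐) (l : Λ)
    {a b : ℂ} (ha : 0 ≤ a.re) (hb : 0 ≤ b.re) :
    IntegrableOn (fun c => f l c * F.k l a b c) (F.D l) :=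
  integrableOn_mul_kern (F.hA l) (F.hB l) (F.hp l) (F.hq l) (F.hy l) (h𝓐.polyBdd f hf l) ha hb

lemma Admissible.differentiableOn_J (h𝓐 : F.Admissible 𝓐) {f : Λ → Coord n → ℂ} (hf : f ∈ 𝓐)
    (l : Λ) : DifferentiableOn ℂ (fun z : ℂ × ℂ => F.J f l z.1 z.2)
      {z | 0 < z.1.re ∧ 0 < z.2.re} :=
  F.differentiableOn_J ((h𝓐.polyBdd f hf l).1.aestronglyMeasurable (F.measurableSet_D l))
    fun a b ha hb => h𝓐.integrableOn hf l (by simpa using ha.le) (by simpa using hb.le)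

lemma Admissible.swap (h𝓐 : F.Admissible 𝓐) : F.swap.Admissible 𝓐 where
  polyBdd f hf l := by
    rw [swap_D]
    exact h𝓐.polyBdd f hf l
  deriv f hf i j := by
    obtain ⟨f', h1, h2⟩ := h𝓐.deriv f hf i j
    exact ⟨f', h1, fun l c hc => h2 l c (by rwa [swap_D] at hc)⟩
  y_mem := h𝓐.y_mem

lemma Rep.swap {U : Set (ℂ × ℂ)} {L : ℝ} {da db : ℕ} {f : Λ → Coord n → ℂ}
    (h : F.swap.Rep 𝓐 U L da db (F.swap.J f)) :
    F.Rep 𝓐 (Prod.swap ⁻¹' U) L db da (F.J f) := by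
  obtain ⟨ι, _, r, g, hr, hg, h⟩ := h
  refine ⟨ι, inferInstance, fun i z => r i z.swap, g, fun i => ?_, hg, fun l a b ha hb => ?_⟩
  · refine (hr i).comp ?_ fun z hz => hz
    exact (Differentiable.prodMk differentiable_snd differentiable_fst).differentiableOn
  · have := h l b a hb ha
    simp only [swap_J] at this
    exact this

end ConeFamily

/-- The exponents at which none of the shifted gamma factors has a pole. -/
def goodSet (p j : ℕ) : Set (ℂ × ℂ) :=
  {z | (∀ i < j, ∀ k : ℕ, z.1 + 1 + (i : ℂ) / 2 + k ≠ 0) ∧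
    ∀ i < p, ∀ k : ℕ, z.2 + 1 + (i : ℂ) / 2 + k ≠ 0}

lemma mem_goodSet_of_re {p j : ℕ} {z : ℂ × ℂ} (h1 : -1 < z.1.re) (h2 : -1 < z.2.re) :
    z ∈ goodSet p j := by
  have key : ∀ w : ℂ, -1 < w.re → ∀ i k : ℕ, w + 1 + (i : ℂ) / 2 + k ≠ 0 := by
    intro w hw i k h
    have := congrArg Complex.re h
    have e : ((i : ℂ) / 2).re = (i : ℝ) / 2 := by
      rw [← Complex.ofReal_natCast, ← Complex.ofReal_ofNat, ← Complex.ofReal_div, Complex.ofReal_re]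
    simp [e] at this
    linarith [(Nat.cast_nonneg i : (0 : ℝ) ≤ i), (Nat.cast_nonneg k : (0 : ℝ) ≤ k)]
  exact ⟨fun i _ k => key _ h1 i k, fun i _ k => key _ h2 i k⟩

lemma add_mem_goodSet {p j : ℕ} {z : ℂ × ℂ} (hz : z ∈ goodSet p j) (a b : ℕ) :
    ((z.1 + a, z.2 + b) : ℂ × ℂ) ∈ goodSet p j := by
  refine ⟨fun i hi k h => hz.1 i hi (a + k) ?_, fun i hi k h => hz.2 i hi (b + k) ?_⟩
  · rw [← h]
    push_cast
    ring
  · rw [← h]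
    push_cast
    ring

lemma countable_poles (p : ℕ) :
    {w : ℂ | ¬ ∀ i < p, ∀ k : ℕ, w + 1 + (i : ℂ) / 2 + k ≠ 0}.Countable := by
  have : {w : ℂ | ¬ ∀ i < p, ∀ k : ℕ, w + 1 + (i : ℂ) / 2 + k ≠ 0} ⊆
      Set.range fun ik : ℕ × ℕ => -(1 + (ik.1 : ℂ) / 2 + ik.2) := by
    intro w hw
    simp only [Set.mem_ofPred_eq, not_forall, not_not] at hw
    obtain ⟨i, _, k, h⟩ := hw
    exact ⟨(i, k), by linear_combination -h⟩
  exact (Set.countable_range _).mono this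

namespace DiagFamily
variable {Λ : Type} {n : ℕ} (G : DiagFamily Λ n)

/-- The recursion runs over the rows of the positive entries of E: the complementary minor, that of
u on V, is the one bounded below on the cone. -/
lemma rep_shift_snd {f : Λ → Coord n → ℂ} (hf : f ∈ G.alg) :
    G.F.Rep G.alg (ConeFamily.stepSet G.Vᶜ.card) (2 * n + 2) 0 1 (G.F.J f) := by
  refine ConeFamily.rep_step G.admissible (K := G.Vᶜ) (ε := fun l k => (G.E l k)⁻¹) (E := G.E)
    (fun l => by simp [F]) (fun l k _ => inv_mul_cancel₀ (G.E_ne_zero l k))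
    (fun k _ => G.adjoin_polyGen_le (G.inv_mem k)) (fun k _ i => ?_) ?_ hf
  · have := G.adjoin_polyGen_le (G.inv_mul_B_mem (i := k) i)
    have e : ∀ (l : Λ) (c : Coord n), (symMat c + G.F.B l) k i = (symMat c + G.F.B l) i k :=
      fun l c => ((symMat_isHermitian c).add (G.F.hB l)).apply i k
    simpa only [e] using this
  · refine ⟨_, G.invA_mem, fun l c hc => ?_⟩
    have := G.one_le_minorA hc
    rw [compl_compl]
    change (((G.minorA l c)⁻¹ : ℝ) : ℂ) * ((G.minorA l c : ℝ) : ℂ) = 1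
    rw [← Complex.ofReal_mul, inv_mul_cancel₀ (by linarith), Complex.ofReal_one]

/-- The same with the two translations exchanged. The difference becomes -E, the rows are those of
V, and the complementary minor is that of u + E on the positive entries. -/
lemma rep_shift_fst {f : Λ → Coord n → ℂ} (hf : f ∈ G.alg) :
    G.F.Rep G.alg (Prod.swap ⁻¹' ConeFamily.stepSet G.V.card) (2 * n + 2) 1 0 (G.F.J f) := by
  refine ConeFamily.Rep.swap ?_
  refine ConeFamily.rep_step G.admissible.swap (K := G.V) (ε := fun l k => -(G.E l k)⁻¹)
    (E := fun l k => -G.E l k)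
    (fun l => by simp [F, ConeFamily.swap]) (fun l k _ => ?_)
    (fun k _ => ?_) (fun k _ i => ?_) ?_ hf
  · rw [neg_mul_neg]
    exact inv_mul_cancel₀ (G.E_ne_zero l k)
  · convert neg_mem (G.adjoin_polyGen_le (G.inv_mem k)) using 1
    ext l c
    simp
  · have := neg_mem (mul_mem (G.adjoin_polyGen_le (G.inv_mem k))
      (G.adjoin_polyGen_le (G.symMat_mem i k)))
    convert this using 1
    ext l c
    simp [F, ConeFamily.swap]
  · refine ⟨_, G.invB_mem, fun l c hc => ?_⟩
    rw [ConeFamily.swap_D] at hc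
    have := G.one_le_minorB hc
    change (((G.minorB l c)⁻¹ : ℝ) : ℂ) * ((G.minorB l c : ℝ) : ℂ) = 1
    rw [← Complex.ofReal_mul, inv_mul_cancel₀ (by linarith), Complex.ofReal_one]

/-- Raising both exponents by `N`. -/
lemma rep_shift (N : ℕ) : ∀ f ∈ G.alg,
    G.F.Rep G.alg (goodSet G.Vᶜ.card G.V.card) (2 * n + 2) N N (G.F.J f) := by
  induction N with
  | zero =>
    intro f hf
    refine (ConeFamily.Rep.of_mem hf).congr fun l a b _ _ => ?_
    simp
  | succ N ih =>
    intro f hf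
    have h1 := ConeFamily.Rep.trans (V := goodSet G.Vᶜ.card G.V.card) (G.rep_shift_snd hf)
      (fun g hg => G.rep_shift_fst hg) (fun z hz i hi => ?_) (fun z hz i hi => ?_)
    · have h2 := h1.trans ih subset_rfl fun z hz => ?_
      · rwa [add_comm N 1]
      · exact add_mem_goodSet hz _ _
    · simpa using hz.2 i hi 0
    · simpa using hz.1 i hi 0


end DiagFamily

end Confluent

/-! ### Absolute convergence and analytic continuation for diagonal families -/

namespace Confluent

/-- The domain is a product of two half planes with closed countable sets removed, each factor being
open and connected. The identity theorem on products therefore applies. -/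
lemma eq_of_eq_large {p j : ℕ} {x y : ℝ} {Φ Ψ : ℂ × ℂ → ℂ}
    (hΦ : DifferentiableOn ℂ Φ {z | z ∈ goodSet p j ∧ x < z.1.re ∧ x < z.2.re})
    (hΨ : DifferentiableOn ℂ Ψ {z | z ∈ goodSet p j ∧ x < z.1.re ∧ x < z.2.re})
    (h : ∀ z : ℂ × ℂ, y < z.1.re → y < z.2.re → Φ z = Ψ z) {z : ℂ × ℂ} (hz : z ∈ goodSet p j)
    (h1 : x < z.1.re) (h2 : x < z.2.re) : Φ z = Ψ z := by
  have hconn : ∀ r : ℕ, IsConnected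
      {w : ℂ | x < w.re ∧ ∀ i < r, ∀ k : ℕ, w + 1 + (i : ℂ) / 2 + k ≠ 0} := fun r => by
    simpa using isConnected_halfPlane_diff_countable x (countable_poles r)
  have hopen : ∀ r : ℕ, IsOpen
      {w : ℂ | x < w.re ∧ ∀ i < r, ∀ k : ℕ, w + 1 + (i : ℂ) / 2 + k ≠ 0} := fun r => by
    refine (isOpen_lt continuous_const Complex.continuous_re).inter ?_
    have : {w : ℂ | ∀ i < r, ∀ k : ℕ, w + 1 + (i : ℂ) / 2 + k ≠ 0} =
        ⋂ i ∈ Set.Iio r, {w : ℂ | ∀ k : ℕ, w + 1 + (i : ℂ) / 2 + k ≠ 0} := by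
      ext w; simp
    change IsOpen {w : ℂ | ∀ i < r, ∀ k : ℕ, w + 1 + (i : ℂ) / 2 + k ≠ 0}
    rw [this]
    refine (Set.finite_Iio r).isOpen_biInter fun i _ => ?_
    have hcl : IsClosed (Set.range fun k : ℕ => (k : ℂ)) := by
      have e : (fun k : ℕ => (k : ℂ)) = Complex.ofReal ∘ Nat.cast := by ext k; simp
      rw [e]
      exact (Complex.isometry_ofReal.isClosedEmbedding.comp
        Nat.isClosedEmbedding_coe_real).isClosed_range
    have : {w : ℂ | ∀ k : ℕ, w + 1 + (i : ℂ) / 2 + k ≠ 0} =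
        (fun w : ℂ => -(w + 1 + (i : ℂ) / 2)) ⁻¹' (Set.range fun k : ℕ => (k : ℂ))ᶜ := by
      ext w
      simp only [Set.mem_ofPred_eq, Set.mem_preimage, Set.mem_compl_iff, Set.mem_range, not_exists,
        eq_neg_iff_add_eq_zero, ne_eq, add_comm]
    rw [this]
    exact hcl.isOpen_compl.preimage (by fun_prop)
  have hne : ∀ r : ℕ, ({w : ℂ | x < w.re ∧ ∀ i < r, ∀ k : ℕ, w + 1 + (i : ℂ) / 2 + k ≠ 0} ∩
      {w : ℂ | y < w.re}).Nonempty := fun r => by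
    set t : ℝ := max (max x y) 0 + 1 with ht
    have t1 : x < t := by linarith [le_max_left x y, le_max_left (max x y) 0]
    have t2 : y < t := by linarith [le_max_right x y, le_max_left (max x y) 0]
    have t3 : 0 < t := by linarith [le_max_right (max x y) 0]
    refine ⟨(t : ℂ), ⟨by simpa using t1, ?_⟩, by simpa using t2⟩
    exact (mem_goodSet_of_re (p := r) (j := r) (z := ((t : ℂ), (t : ℂ)))
      (by simp; linarith) (by simp; linarith)).1
  have hprod : {w : ℂ | x < w.re ∧ ∀ i < j, ∀ k : ℕ, w + 1 + (i : ℂ) / 2 + k ≠ 0} ×ˢ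
      {w : ℂ | x < w.re ∧ ∀ i < p, ∀ k : ℕ, w + 1 + (i : ℂ) / 2 + k ≠ 0} =
      {z | z ∈ goodSet p j ∧ x < z.1.re ∧ x < z.2.re} := by
    ext z
    constructor
    · rintro ⟨⟨a, b⟩, c, d⟩
      exact ⟨⟨b, d⟩, a, c⟩
    · rintro ⟨⟨b, d⟩, a, c⟩
      exact ⟨⟨a, b⟩, c, d⟩
  rw [← hprod] at hΦ hΨ
  refine eqOn_prod_of_eqOn (hopen j) (hopen p) (hconn j).isPreconnected (hconn p).isPreconnected
    (isOpen_lt continuous_const Complex.continuous_re)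
    (isOpen_lt continuous_const Complex.continuous_re) (hne j) (hne p) hΦ hΨ
    (fun z _ ha hb => h z ha hb) z ?_
  rw [hprod]
  exact ⟨hz, h1, h2⟩

namespace DiagFamily
variable {Λ : Type} {n : ℕ} (G : DiagFamily Λ n)

lemma differentiableOn_sum_J {ι : Type} [Fintype ι] {r : ι → ℂ × ℂ → ℂ}
    {f : ι → Λ → Coord n → ℂ} {p j : ℕ} (hr : ∀ i, DifferentiableOn ℂ (r i) (goodSet p j))
    (hf : ∀ i, f i ∈ G.alg) (N : ℕ) (l : Λ) :
    DifferentiableOn ℂ (fun z => ∑ i, r i z * G.F.J (f i) l (z.1 + N) (z.2 + N))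
      {z | z ∈ goodSet p j ∧ -(N : ℝ) < z.1.re ∧ -(N : ℝ) < z.2.re} := by
  refine DifferentiableOn.fun_sum fun i _ => ?_
  refine ((hr i).mono fun z hz => hz.1).mul ?_
  refine (G.admissible.differentiableOn_J (hf i) l).comp
    (g := fun z : ℂ × ℂ => G.F.J (f i) l z.1 z.2) (f := fun z : ℂ × ℂ => (z.1 + N, z.2 + N)) ?_ ?_
  · exact (Differentiable.prodMk (by fun_prop) (by fun_prop)).differentiableOn
  · rintro z ⟨-, h1, h2⟩
    exact ⟨by simp; linarith, by simp; linarith⟩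

/-- After N shifts the integrals on the right converge once both real parts exceed -N, while the
coefficients are holomorphic on `goodSet`. -/
lemma exists_partial_continuation (N : ℕ) (l : Λ) : ∃ Φ : ℂ × ℂ → ℂ,
    DifferentiableOn ℂ Φ
      {z | z ∈ goodSet G.Vᶜ.card G.V.card ∧ -(N : ℝ) < z.1.re ∧ -(N : ℝ) < z.2.re} ∧
    ∀ z : ℂ × ℂ, 2 * (n : ℝ) + 2 ≤ z.1.re → 2 * (n : ℝ) + 2 ≤ z.2.re → Φ z = G.F.J 1 l z.1 z.2 := by
  obtain ⟨ι, _, r, f, hr, hf, h⟩ := G.rep_shift N 1 (one_mem _)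
  exact ⟨_, G.differentiableOn_sum_J hr hf N l, fun z h1 h2 => (h l z.1 z.2 h1 h2).symm⟩

lemma J_one (l : Λ) (a b : ℂ) : G.F.J 1 l a b = ∫ c in G.F.D l, G.F.k l a b c := by
  simp [ConeFamily.J]

lemma integrableOn_k_iff (l : Λ) (a b : ℝ) : IntegrableOn (G.F.k l a b) (G.F.D l) ↔
    IntegrableOn (fun c => Real.exp (-(symMat c * G.y l).trace) *
      (Real.exp (a * G.F.logB l c) * Real.exp (b * G.F.logA l c))) (G.F.D l) := by
  have : IntegrableOn (G.F.k l a b) (G.F.D l) ↔ IntegrableOn (fun c =>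
      ((Real.exp (-(symMat c * G.y l).trace) *
      (Real.exp (a * G.F.logB l c) * Real.exp (b * G.F.logA l c)) : ℝ) : ℂ)) (G.F.D l) := by
    refine integrableOn_congr_fun (fun c hc => ?_) (G.F.measurableSet_D l)
    rw [G.F.k_eq_exp hc]
    push_cast
    rfl
  rw [this]
  refine ⟨fun h => ?_, fun h => h.ofReal⟩
  have h' := Integrable.re h
  simp only [RCLike.re_to_complex, Complex.ofReal_re] at h'
  exact h'

/-- Landau's lemma in b for fixed large a. The abscissa -1 appears because the rightmost excluded
line of `goodSet` in b can be b = -1. -/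
lemma integrableOn_k_fst_large (l : Λ) {a b : ℝ} (ha : 2 * (n : ℝ) + 2 ≤ a) (hb : -1 < b) :
    IntegrableOn (G.F.k l a b) (G.F.D l) := by
  obtain ⟨Φ, hΦ, h⟩ := G.exists_partial_continuation 1 l
  rw [integrableOn_k_iff]
  have hn : (0 : ℝ) ≤ n := Nat.cast_nonneg n
  have key := integrable_mul_exp_of_continuation (μ := volume.restrict (G.F.D l))
    (w := fun c => Real.exp (-(symMat c * G.y l).trace) * Real.exp (a * G.F.logB l c))
    (X := G.F.logA l) (b₀ := 2 * n + 2) (b₁ := -1) (g := fun z => Φ (a, z)) ?_ ?_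
    (G.F.measurable_logA l) ?_ ?_ ?_ hb
  · refine key.congr (Eventually.of_forall fun c => ?_)
    beta_reduce
    ring
  · exact (continuous_trace_symMat.neg.measurable.exp).mul
      ((G.F.measurable_logB l).const_mul a).exp
  · exact Eventually.of_forall fun c => by positivity
  · intro t ht
    have := (G.integrableOn_k_iff l a t).1 (by
      simpa using G.admissible.integrableOn (one_mem _) l (a := a) (b := t)
        (by simp; linarith) (by simp; linarith))
    refine this.congr (Eventually.of_forall fun c => ?_)
    beta_reduce
    ring
  · refine hΦ.comp (by fun_prop : Differentiable ℂ fun w : ℂ => ((a : ℂ), w)).differentiableOn ?_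
    intro z hz
    have hz' : -1 < z.re := hz
    exact ⟨mem_goodSet_of_re (by simp; linarith) hz', by simp; linarith, by simpa using hz'⟩
  · intro z hz
    rw [h (a, z) (by simpa using ha) hz.le, J_one]
    refine setIntegral_congr_fun (G.F.measurableSet_D l) fun c hc => ?_
    rw [G.F.k_eq_exp hc]
    push_cast
    rw [mul_assoc]
    rfl

/-- Absolute convergence. -/
lemma integrableOn_k (l : Λ) {a b : ℝ} (ha : -1 < a) (hb : -1 < b) :
    IntegrableOn (G.F.k l a b) (G.F.D l) := by
  obtain ⟨Φ, hΦ, h⟩ := G.exists_partial_continuation 1 l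
  have hn : (0 : ℝ) ≤ n := Nat.cast_nonneg n
  have hd : DifferentiableOn ℂ (fun z : ℂ × ℂ => G.F.J 1 l z.1 z.2)
      {z | 2 * (n : ℝ) + 2 < z.1.re ∧ -1 < z.2.re} := by
    refine G.F.differentiableOn_J aestronglyMeasurable_const fun a b ha hb => ?_
    simpa using G.integrableOn_k_fst_large l ha.le hb
  -- The continuation is known to equal the integral only when both exponents are large. The
  -- convergence just obtained extends this to all b with real part above -1, which is what Landau's
  -- lemma in a requires.
  have hΦJ : ∀ z : ℂ × ℂ, 2 * (n : ℝ) + 2 < z.1.re → -1 < z.2.re → Φ z = G.F.J 1 l z.1 z.2 := by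
    intro z hz1 hz2
    have hconn : ∀ x : ℝ, IsPreconnected {w : ℂ | x < w.re} := fun x =>
      (convex_halfSpace_re_gt x).isPreconnected
    have hop : ∀ x : ℝ, IsOpen {w : ℂ | x < w.re} := fun x =>
      isOpen_lt continuous_const Complex.continuous_re
    refine eqOn_prod_of_eqOn (hop (2 * n + 2)) (hop (-1)) (hconn _) (hconn _) (hop (2 * n + 2))
      (hop (2 * n + 2)) ⟨((2 * n + 3 : ℝ) : ℂ), ?_, ?_⟩ ⟨((2 * n + 3 : ℝ) : ℂ), ?_, ?_⟩
      (hΦ.mono ?_) hd ?_ z ⟨hz1, hz2⟩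
    · show 2 * (n : ℝ) + 2 < ((2 * n + 3 : ℝ) : ℂ).re
      rw [Complex.ofReal_re]; linarith
    · show 2 * (n : ℝ) + 2 < ((2 * n + 3 : ℝ) : ℂ).re
      rw [Complex.ofReal_re]; linarith
    · show -1 < ((2 * n + 3 : ℝ) : ℂ).re
      rw [Complex.ofReal_re]; linarith
    · show 2 * (n : ℝ) + 2 < ((2 * n + 3 : ℝ) : ℂ).re
      rw [Complex.ofReal_re]; linarith
    · rintro w ⟨h1, h2⟩
      have h1' : 2 * (n : ℝ) + 2 < w.1.re := h1
      have h2' : -1 < w.2.re := h2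
      exact ⟨mem_goodSet_of_re (by linarith) h2', by simp; linarith, by simpa using h2'⟩
    · intro w _ h1 h2
      exact h w (le_of_lt h1) (le_of_lt h2)
  rw [integrableOn_k_iff]
  have key := integrable_mul_exp_of_continuation (μ := volume.restrict (G.F.D l))
    (w := fun c => Real.exp (-(symMat c * G.y l).trace) * Real.exp (b * G.F.logA l c))
    (X := G.F.logB l) (b₀ := 2 * n + 2) (b₁ := -1) (g := fun z => Φ (z, b)) ?_ ?_
    (G.F.measurable_logB l) ?_ ?_ ?_ ha
  · refine key.congr (Eventually.of_forall fun c => ?_)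
    beta_reduce
    ring
  · exact (continuous_trace_symMat.neg.measurable.exp).mul
      ((G.F.measurable_logA l).const_mul b).exp
  · exact Eventually.of_forall fun c => by positivity
  · intro t ht
    refine ((G.integrableOn_k_iff l t b).1 (G.integrableOn_k_fst_large l ht.le hb)).congr
      (Eventually.of_forall fun c => ?_)
    beta_reduce
    ring
  · refine hΦ.comp (by fun_prop : Differentiable ℂ fun w : ℂ => (w, (b : ℂ))).differentiableOn ?_
    intro z hz
    have hz' : -1 < z.re := hz
    exact ⟨mem_goodSet_of_re hz' (by simpa using hb), by simpa using hz', by simpa using hb⟩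
  · intro z hz
    rw [hΦJ (z, b) hz (by simpa using hb), J_one]
    refine setIntegral_congr_fun (G.F.measurableSet_D l) fun c hc => ?_
    rw [G.F.k_eq_exp hc]
    push_cast
    rw [mul_assoc, mul_comm (Complex.exp ((b : ℂ) * _))]
    rfl

lemma differentiableOn_J_one (l : Λ) : DifferentiableOn ℂ (fun z : ℂ × ℂ => G.F.J 1 l z.1 z.2)
    {z | -1 < z.1.re ∧ -1 < z.2.re} := by
  refine G.F.differentiableOn_J aestronglyMeasurable_const fun a b ha hb => ?_
  simpa using G.integrableOn_k l ha hb

/-- The integral continues holomorphically to all exponents without poles. -/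
lemma exists_continuation (l : Λ) : ∃ Φ : ℂ × ℂ → ℂ,
    DifferentiableOn ℂ Φ (goodSet G.Vᶜ.card G.V.card) ∧
    (∀ z : ℂ × ℂ, -1 < z.1.re → -1 < z.2.re → Φ z = G.F.J 1 l z.1 z.2) ∧
    ∀ (N : ℕ) (Ψ : ℂ × ℂ → ℂ), DifferentiableOn ℂ Ψ
        {z | z ∈ goodSet G.Vᶜ.card G.V.card ∧ -(N : ℝ) < z.1.re ∧ -(N : ℝ) < z.2.re} →
      (∃ L : ℝ, ∀ z : ℂ × ℂ, L < z.1.re → L < z.2.re → Ψ z = G.F.J 1 l z.1 z.2) →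
      ∀ z ∈ goodSet G.Vᶜ.card G.V.card, -(N : ℝ) < z.1.re → -(N : ℝ) < z.2.re → Φ z = Ψ z := by
  choose Φ hΦ h using fun N => G.exists_partial_continuation N l
  have huniq : ∀ (M N : ℕ) (Ψ : ℂ × ℂ → ℂ), DifferentiableOn ℂ Ψ
        {z | z ∈ goodSet G.Vᶜ.card G.V.card ∧ -(N : ℝ) < z.1.re ∧ -(N : ℝ) < z.2.re} →
      (∃ L : ℝ, ∀ z : ℂ × ℂ, L < z.1.re → L < z.2.re → Ψ z = G.F.J 1 l z.1 z.2) →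
      ∀ z ∈ goodSet G.Vᶜ.card G.V.card, -(M : ℝ) < z.1.re → -(M : ℝ) < z.2.re →
        -(N : ℝ) < z.1.re → -(N : ℝ) < z.2.re → Φ M z = Ψ z := by
    rintro M N Ψ hΨ ⟨L, hL⟩ z hz h1 h2 h3 h4
    refine eq_of_eq_large (x := max (-(M : ℝ)) (-(N : ℝ))) (y := max (2 * n + 2) L)
      ((hΦ M).mono ?_) (hΨ.mono ?_) ?_ hz (max_lt h1 h3) (max_lt h2 h4)
    · rintro w ⟨a, b, c⟩
      exact ⟨a, (le_max_left _ _).trans_lt b, (le_max_left _ _).trans_lt c⟩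
    · rintro w ⟨a, b, c⟩
      exact ⟨a, (le_max_right _ _).trans_lt b, (le_max_right _ _).trans_lt c⟩
    · intro w ha hb
      rw [h M w ((le_max_left _ _).trans ha.le) ((le_max_left _ _).trans hb.le),
        hL w ((le_max_right _ _).trans_lt ha) ((le_max_right _ _).trans_lt hb)]
  have hLarge : ∀ M, ∃ L : ℝ, ∀ z : ℂ × ℂ, L < z.1.re → L < z.2.re → Φ M z = G.F.J 1 l z.1 z.2 :=
    fun M => ⟨2 * n + 2, fun z h1 h2 => h M z h1.le h2.le⟩
  -- The partial continuations agree where they overlap, so the global one may use at each point an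
  -- N large enough for that point.
  set ν : ℂ × ℂ → ℕ := fun z => ⌈max (-z.1.re) (-z.2.re)⌉₊ + 1 with hν
  have hν1 : ∀ z : ℂ × ℂ, -(ν z : ℝ) < z.1.re ∧ -(ν z : ℝ) < z.2.re := by
    intro z
    have := Nat.le_ceil (max (-z.1.re) (-z.2.re))
    have h1 := le_max_left (-z.1.re) (-z.2.re)
    have h2 := le_max_right (-z.1.re) (-z.2.re)
    simp only [hν]
    push_cast
    constructor <;> linarith
  have main : ∀ (N : ℕ) (Ψ : ℂ × ℂ → ℂ), DifferentiableOn ℂ Ψ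
        {z | z ∈ goodSet G.Vᶜ.card G.V.card ∧ -(N : ℝ) < z.1.re ∧ -(N : ℝ) < z.2.re} →
      (∃ L : ℝ, ∀ z : ℂ × ℂ, L < z.1.re → L < z.2.re → Ψ z = G.F.J 1 l z.1 z.2) →
      ∀ z ∈ goodSet G.Vᶜ.card G.V.card, -(N : ℝ) < z.1.re → -(N : ℝ) < z.2.re →
        Φ (ν z) z = Ψ z := fun N Ψ hΨ hL z hz h1 h2 =>
    huniq (ν z) N Ψ hΨ hL z hz (hν1 z).1 (hν1 z).2 h1 h2
  refine ⟨fun z => Φ (ν z) z, fun z hz => ?_, fun z h1 h2 => ?_, main⟩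
  · have hopen : IsOpen {w : ℂ × ℂ | -(ν z : ℝ) < w.1.re ∧ -(ν z : ℝ) < w.2.re} :=
      (isOpen_lt continuous_const (Complex.continuous_re.comp continuous_fst)).inter
        (isOpen_lt continuous_const (Complex.continuous_re.comp continuous_snd))
    have hd := hΦ (ν z) z ⟨hz, hν1 z⟩
    have hd' : DifferentiableWithinAt ℂ (fun z => Φ (ν z) z)
        (goodSet G.Vᶜ.card G.V.card ∩ {w | -(ν z : ℝ) < w.1.re ∧ -(ν z : ℝ) < w.2.re}) z := by
      refine DifferentiableWithinAt.congr hd (fun w hw => ?_) ?_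
      · exact main (ν z) _ (hΦ (ν z)) (hLarge _) w hw.1 hw.2.1 hw.2.2
      · rfl
    rwa [differentiableWithinAt_inter (hopen.mem_nhds (hν1 z))] at hd'
  · refine main 1 (fun z => G.F.J 1 l z.1 z.2) ((G.differentiableOn_J_one l).mono ?_)
      ⟨0, fun z _ _ => rfl⟩ z (mem_goodSet_of_re h1 h2) (by simpa using h1) (by simpa using h2)
    rintro w ⟨-, a, b⟩
    exact ⟨by simpa using a, by simpa using b⟩

end DiagFamily

end Confluent

namespace Confluent

/-! ### The Jacobian of u ↦ h u ᵗh -/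

section Congruence
variable {n : ℕ}

lemma isSymm_mul_symMat_mul (h : Matrix (Fin n) (Fin n) ℝ) (c : Coord n) :
    (h * symMat c * hᵀ).IsSymm := by
  rw [IsSymm, transpose_mul, transpose_mul, transpose_transpose, (symMat_isSymm c).eq, mul_assoc]

/-- The action `u ↦ h u ᵗh` on symmetric matrices. -/
noncomputable def congrMap (h : Matrix (Fin n) (Fin n) ℝ) : Coord n →ₗ[ℝ] Coord n where
  toFun c := symCoord (h * symMat c * hᵀ)
  map_add' c d := by
    apply symMat_injective
    rw [symMat_symCoord (isSymm_mul_symMat_mul h _), Confluent.symMat_add, Confluent.symMat_add,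
      symMat_symCoord (isSymm_mul_symMat_mul h _), symMat_symCoord (isSymm_mul_symMat_mul h _),
      mul_add, add_mul]
  map_smul' t c := by
    apply symMat_injective
    rw [RingHom.id_apply, symMat_symCoord (isSymm_mul_symMat_mul h _), symMat_smul, symMat_smul,
      symMat_symCoord (isSymm_mul_symMat_mul h _), mul_smul_comm, smul_mul_assoc]

lemma symMat_congrMap (h : Matrix (Fin n) (Fin n) ℝ) (c : Coord n) :
    symMat (congrMap h c) = h * symMat c * hᵀ :=
  symMat_symCoord (isSymm_mul_symMat_mul h c)

lemma congrMap_mul (g h : Matrix (Fin n) (Fin n) ℝ) :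
    congrMap (g * h) = congrMap g * congrMap h := by
  refine LinearMap.ext fun c => ?_
  apply symMat_injective
  rw [Module.End.mul_apply, symMat_congrMap, symMat_congrMap, symMat_congrMap, transpose_mul]
  simp only [mul_assoc]

lemma congrMap_one : congrMap (1 : Matrix (Fin n) (Fin n) ℝ) = 1 := by
  refine LinearMap.ext fun c => ?_
  apply symMat_injective
  rw [symMat_congrMap]
  simp

/-- Over the pairs i ≤ j every index occurs n + 1 times, the diagonal pair counting twice. -/
lemma prod_sym2_mul (d : Fin n → ℝ) :
    ∏ e : Sym2 (Fin n), Sym2.mul (e.map d) = (∏ i, d i) ^ (n + 1) := by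
  rw [← (Sym2.sortEquiv (α := Fin n)).symm.prod_comp]
  have h1 : ∀ p : {p : Fin n × Fin n // p.1 ≤ p.2},
      Sym2.mul ((Sym2.sortEquiv.symm p).map d) = d p.1.1 * d p.1.2 := fun p => rfl
  simp only [h1]
  rw [← Finset.prod_subtype (Finset.univ.filter fun p : Fin n × Fin n => p.1 ≤ p.2)
    (by simp) (fun p : Fin n × Fin n => d p.1 * d p.2), Finset.prod_filter, Fintype.prod_prod_type]
  have h2 : ∀ i j : Fin n, (if i ≤ j then d i * d j else 1) =
      (if i ≤ j then d i else 1) * (if i ≤ j then d j else 1) := by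
    intro i j; split_ifs <;> simp
  simp only [h2, Finset.prod_mul_distrib]
  rw [Finset.prod_comm (f := fun i j => if i ≤ j then d j else 1), ← Finset.prod_mul_distrib,
    ← Finset.prod_pow]
  refine Finset.prod_congr rfl fun i _ => ?_
  rw [← Finset.prod_mul_distrib]
  have h3 : ∀ j : Fin n, ((if i ≤ j then d i else 1) * if j ≤ i then d i else 1) =
      d i * if j = i then d i else 1 := by
    intro j
    rcases lt_trichotomy i j with h | h | h
    · simp [h.le, h.not_ge, h.ne']
    · simp [h]
    · simp [h.le, h.not_ge, h.ne]
  simp only [h3, Finset.prod_mul_distrib, Finset.prod_const, Finset.card_univ, Fintype.card_fin,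
    Finset.prod_ite_eq', Finset.mem_univ, if_true, pow_succ]

lemma det_congrMap_diagonal (d : Fin n → ℝ) :
    LinearMap.det (congrMap (diagonal d)) = (diagonal d).det ^ (n + 1) := by
  have : congrMap (diagonal d) = toLin' (diagonal fun e : Sym2 (Fin n) => Sym2.mul (e.map d)) := by
    refine LinearMap.ext fun c => ?_
    ext e
    induction e with
    | _ i j =>
      have := congrFun (congrFun (symMat_congrMap (diagonal d) c) i) j
      rw [symMat_apply] at this
      rw [this]
      simp [mulVec_diagonal, symMat_apply]
      ring
  rw [this, LinearMap.det_toLin', det_diagonal, det_diagonal, prod_sym2_mul]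

lemma det_congrMap_ne_zero {h : Matrix (Fin n) (Fin n) ℝ} (hh : h.det ≠ 0) :
    LinearMap.det (congrMap h) ≠ 0 := by
  have : congrMap h * congrMap h⁻¹ = 1 := by
    rw [← congrMap_mul, mul_nonsing_inv _ hh.isUnit, congrMap_one]
  have := congrArg LinearMap.det this
  rw [map_mul, map_one] at this
  exact left_ne_zero_of_mul_eq_one this

lemma det_congrMap {h : Matrix (Fin n) (Fin n) ℝ} (hh : h.det ≠ 0) :
    LinearMap.det (congrMap h) = h.det ^ (n + 1) := by
  refine diagonal_transvection_induction_of_det_ne_zero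
    (fun h => LinearMap.det (congrMap h) = h.det ^ (n + 1)) h hh
    (fun D _ => det_congrMap_diagonal D) (fun t => ?_) (fun A B _ _ hA hB => ?_)
  · obtain ⟨i, j, hij, c⟩ := t
    have ht : ∀ c : ℝ, (transvection i j c).det = 1 := fun c => det_transvection_of_ne i j hij c
    show LinearMap.det (congrMap (transvection i j c)) = (transvection i j c).det ^ (n + 1)
    rw [ht, one_pow]
    -- Conjugation by this diagonal matrix turns the transvection into its square, so the Jacobian x
    -- of the transvection satisfies x = x²; being nonzero, it is 1.
    set d : Fin n → ℝ := fun k => if k = i then 2 else 1 with hd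
    have hd0 : (diagonal d).det ≠ 0 := by
      rw [det_diagonal]
      exact Finset.prod_ne_zero_iff.2 fun k _ => by simp only [hd]; split_ifs <;> norm_num
    have e : diagonal d * transvection i j c =
        transvection i j c * transvection i j c * diagonal d := by
      rw [transvection_mul_transvection_same i j hij]
      simp only [transvection, mul_add, add_mul, mul_one, one_mul]
      congr 1
      ext a b
      simp only [diagonal_mul, mul_diagonal, Matrix.single_apply, hd]
      by_cases ha : i = a <;> by_cases hb : j = b
      · subst ha hb
        simp [hij.symm]
        ring
      · simp [ha, hb]
      · simp [ha, hb]
      · simp [ha, hb]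
    have e2 := congrArg (fun M => LinearMap.det (congrMap M)) e
    simp only [congrMap_mul, map_mul] at e2
    have h1 := det_congrMap_ne_zero hd0
    have h2 : LinearMap.det (congrMap (transvection i j c)) ≠ 0 :=
      det_congrMap_ne_zero (by rw [ht]; exact one_ne_zero)
    have h3 : LinearMap.det (congrMap (diagonal d)) * LinearMap.det (congrMap (transvection i j c)) *
        (1 - LinearMap.det (congrMap (transvection i j c))) = 0 := by
      linear_combination e2
    have := (mul_eq_zero.1 h3).resolve_left (mul_ne_zero h1 h2)
    linarith
  · rw [congrMap_mul, map_mul, hA, hB, det_mul, mul_pow]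

/-- The affine change of variables `u = h (v + d) ᵗh`. -/
noncomputable def affMap (h : Matrix (Fin n) (Fin n) ℝ) (d : Coord n) (c : Coord n) : Coord n :=
  congrMap h (c + d)

lemma symMat_affMap (h : Matrix (Fin n) (Fin n) ℝ) (d c : Coord n) :
    symMat (affMap h d c) = h * (symMat c + symMat d) * hᵀ := by
  rw [affMap, symMat_congrMap, Confluent.symMat_add]

lemma measurableEmbedding_affMap {h : Matrix (Fin n) (Fin n) ℝ} (hh : h.det ≠ 0) (d : Coord n) :
    MeasurableEmbedding (affMap h d) := by
  have h1 : MeasurableEmbedding (congrMap h) := by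
    have := ((LinearEquiv.ofIsUnitDet (f := congrMap h) (v := Pi.basisFun ℝ _)
      (v' := Pi.basisFun ℝ _) (by
        rw [LinearMap.det_toMatrix]
        exact (det_congrMap_ne_zero hh).isUnit)).toContinuousLinearEquiv.toHomeomorph).measurableEmbedding
    exact this
  exact h1.comp (measurableEmbedding_addRight d)

lemma map_affMap {h : Matrix (Fin n) (Fin n) ℝ} (hh : h.det ≠ 0) (d : Coord n) :
    Measure.map (affMap h d) volume = ENNReal.ofReal ((|h.det| ^ (n + 1))⁻¹) • volume := by
  have h1 : affMap h d = congrMap h ∘ fun c => c + d := rfl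
  rw [h1, ← Measure.map_map (LinearMap.continuous_of_finiteDimensional _).measurable
    (measurable_add_const d), map_add_right_eq_self,
    Real.map_linearMap_volume_pi_eq_smul_volume_pi (det_congrMap_ne_zero hh), det_congrMap hh,
    abs_inv, abs_pow]

lemma setIntegral_affMap {h : Matrix (Fin n) (Fin n) ℝ} (hh : h.det ≠ 0) (d : Coord n)
    (s : Set (Coord n)) (g : Coord n → ℂ) :
    ∫ c in s, g c = (|h.det| ^ (n + 1) : ℝ) * ∫ c in affMap h d ⁻¹' s, g (affMap h d c) := by
  have hp : 0 < |h.det| ^ (n + 1) := by positivity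
  rw [← (measurableEmbedding_affMap hh d).setIntegral_map, map_affMap hh, Measure.restrict_smul,
    integral_smul_measure, ENNReal.toReal_ofReal (by positivity), Complex.real_smul, ← mul_assoc,
    ← Complex.ofReal_mul, mul_inv_cancel₀ hp.ne', Complex.ofReal_one, one_mul]

lemma integrableOn_affMap_iff {h : Matrix (Fin n) (Fin n) ℝ} (hh : h.det ≠ 0) (d : Coord n)
    (s : Set (Coord n)) (g : Coord n → ℂ) :
    IntegrableOn g s ↔ IntegrableOn (fun c => g (affMap h d c)) (affMap h d ⁻¹' s) := by
  have hp : 0 < |h.det| ^ (n + 1) := by positivity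
  have := (measurableEmbedding_affMap hh d).integrableOn_map_iff (μ := volume) (f := g) (s := s)
  rw [Function.comp_def] at this
  rw [← this, map_affMap hh, IntegrableOn, IntegrableOn, Measure.restrict_smul,
    integrable_smul_measure (by simpa using hp) ENNReal.ofReal_ne_top]

end Congruence

end Confluent

/-! ### From η to the diagonal family -/

namespace Confluent

/-- Sylvester's law of inertia: ᵗh carries the form of T to the weighted sum of squares with weights
d. -/
lemma negIndex_congr {n : ℕ} {h : Matrix (Fin n) (Fin n) ℝ} (hh : h.det ≠ 0) (d : Fin n → ℝ) :
    negIndex (h * diagonal d * hᵀ) = (Finset.univ.filter fun i => d i < 0).card := by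
  have hu : IsUnit hᵀ := by
    rw [isUnit_iff_isUnit_det, det_transpose]
    exact hh.isUnit
  have e : QuadraticMap.Equivalent (h * diagonal d * hᵀ).toQuadraticForm'
      (QuadraticMap.weightedSumSquares ℝ d) := by
    refine ⟨⟨toLinearEquiv' hᵀ hu.invertible, fun x => ?_⟩⟩
    have e1 : (toLinearEquiv' hᵀ hu.invertible).toFun x = hᵀ *ᵥ x := rfl
    rw [e1, QuadraticMap.weightedSumSquares_apply, toQuadraticForm',
      LinearMap.BilinMap.toQuadraticMap_apply, toLinearMap₂'_apply', ← mulVec_mulVec,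
      ← mulVec_mulVec, dotProduct_mulVec, ← mulVec_transpose, dotProduct]
    refine Finset.sum_congr rfl fun i _ => ?_
    rw [mulVec_diagonal, smul_eq_mul]
    ring
  rw [negIndex, QuadraticForm.sigNeg_of_equiv_weightedSumSquares e, ← Set.ncard_coe_finset]
  congr 1
  ext i
  simp

/-- The substitution i ↦ n - 1 - i matches the two indexings, because α - ρ_n + 1 + i/2 = α - (n - 1
- i)/2. -/
lemma mem_regularSet_iff {n j : ℕ} (hj : j ≤ n) (z : ℂ × ℂ) :
    z ∈ regularSet n j ↔ ((z.1 - rho n, z.2 - rho n) : ℂ × ℂ) ∈ goodSet (n - j) j := by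
  have key : ∀ (w : ℂ) (r : ℕ), r ≤ n →
      ((∀ i k : ℕ, n - r ≤ i → i < n → w - (i : ℂ) / 2 ≠ -(k : ℂ)) ↔
        ∀ i < r, ∀ k : ℕ, w - rho n + 1 + (i : ℂ) / 2 + k ≠ 0) := by
    intro w r hr
    have e : ∀ i < n, ∀ k : ℕ, w - rho n + 1 + ((n - 1 - i : ℕ) : ℂ) / 2 + k =
        w - (i : ℂ) / 2 + k := by
      intro i hi k
      have : ((n - 1 - i : ℕ) : ℂ) = (n : ℂ) - 1 - i := by
        rw [Nat.cast_sub (by omega), Nat.cast_sub (by omega), Nat.cast_one]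
      rw [this, rho]
      push_cast
      ring
    constructor
    · intro h i hi k h0
      refine h (n - 1 - i) k (by omega) (by omega) ?_
      have := e (n - 1 - i) (by omega) k
      rw [show n - 1 - (n - 1 - i) = i by omega] at this
      rw [eq_neg_iff_add_eq_zero, ← this, h0]
    · intro h i k h1 h2 h0
      refine h (n - 1 - i) (by omega) k ?_
      rw [e i h2 k, h0, neg_add_cancel]
  constructor
  · rintro ⟨h1, h2⟩
    refine ⟨(key z.1 j hj).1 h2, (key z.2 (n - j) (by omega)).1 ?_⟩
    rw [Nat.sub_sub_self hj]
    exact h1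
  · rintro ⟨h1, h2⟩
    have := (key z.2 (n - j) (by omega)).2 h2
    rw [Nat.sub_sub_self hj] at this
    exact ⟨this, (key z.1 j hj).2 h1⟩

namespace DiagFamily
variable {Λ : Type} {n : ℕ} (G : DiagFamily Λ n)

/-- The analytic continuation of the integral. -/
noncomputable def cont (l : Λ) : ℂ × ℂ → ℂ := (G.exists_continuation l).choose

lemma differentiableOn_cont (l : Λ) :
    DifferentiableOn ℂ (G.cont l) (goodSet G.Vᶜ.card G.V.card) :=
  (G.exists_continuation l).choose_spec.1

lemma cont_eq_J (l : Λ) {z : ℂ × ℂ} (h1 : -1 < z.1.re) (h2 : -1 < z.2.re) :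
    G.cont l z = G.F.J 1 l z.1 z.2 :=
  (G.exists_continuation l).choose_spec.2.1 z h1 h2

lemma cont_eq_of_eq_large (l : Λ) {N : ℕ} {Ψ : ℂ × ℂ → ℂ} (hΨ : DifferentiableOn ℂ Ψ
      {z | z ∈ goodSet G.Vᶜ.card G.V.card ∧ -(N : ℝ) < z.1.re ∧ -(N : ℝ) < z.2.re})
    {L : ℝ} (hL : ∀ z : ℂ × ℂ, L < z.1.re → L < z.2.re → Ψ z = G.F.J 1 l z.1 z.2)
    {z : ℂ × ℂ} (hz : z ∈ goodSet G.Vᶜ.card G.V.card) (h1 : -(N : ℝ) < z.1.re)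
    (h2 : -(N : ℝ) < z.2.re) : G.cont l z = Ψ z :=
  (G.exists_continuation l).choose_spec.2.2 N Ψ hΨ ⟨L, hL⟩ z hz h1 h2

/-- The factor between `η` and the integral of the diagonal family. -/
noncomputable def factor (l : Λ) (h : Matrix (Fin n) (Fin n) ℝ) (a b : ℂ) : ℂ :=
  (|h.det| ^ (n + 1) : ℝ) *
    ((Real.exp (-(diagonal (fun i => G.E l i / 2) * G.y l).trace) : ℂ) *
      (((h.det ^ 2 : ℝ) : ℂ) ^ (a + b) * (((G.F.q l)⁻¹ : ℝ) : ℂ) ^ a *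
        (((G.F.p l)⁻¹ : ℝ) : ℂ) ^ b))

lemma differentiable_factor {l : Λ} {h : Matrix (Fin n) (Fin n) ℝ} (hh : h.det ≠ 0) :
    Differentiable ℂ fun z : ℂ × ℂ => G.factor l h z.1 z.2 := by
  unfold factor
  have h1 : ((h.det ^ 2 : ℝ) : ℂ) ≠ 0 := by exact_mod_cast pow_ne_zero 2 hh
  have h2 : (((G.F.q l)⁻¹ : ℝ) : ℂ) ≠ 0 := by exact_mod_cast (inv_pos.2 (G.F.hq l)).ne'
  have h3 : (((G.F.p l)⁻¹ : ℝ) : ℂ) ≠ 0 := by exact_mod_cast (inv_pos.2 (G.F.hp l)).ne'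
  refine Differentiable.const_mul (Differentiable.const_mul ?_ _) _
  refine Differentiable.mul (Differentiable.mul ?_ ?_) ?_
  · exact (differentiable_fst.add differentiable_snd).const_cpow (Or.inl h1)
  · exact differentiable_fst.const_cpow (Or.inl h2)
  · exact differentiable_snd.const_cpow (Or.inl h3)

variable {G} {l : Λ} {h T y : Matrix (Fin n) (Fin n) ℝ}

/-- The translation by E/2 is what turns T and -T into E and 0: u + T corresponds to v + E and u - T
to v. Hence α belongs to the translate `B`, and β to `A`. -/
lemma symMat_affMap_add (hT : T = h * diagonal (fun i => G.E l i / 2) * hᵀ) (c : Coord n) :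
    symMat (affMap h (symCoord (diagonal fun i => G.E l i / 2)) c) + T =
      h * (symMat c + G.F.B l) * hᵀ := by
  rw [symMat_affMap, symMat_symCoord (isSymm_diagonal _), hT, ← add_mul, ← mul_add, add_assoc,
    diagonal_add]
  simp [F]

lemma symMat_affMap_sub (hT : T = h * diagonal (fun i => G.E l i / 2) * hᵀ) (c : Coord n) :
    symMat (affMap h (symCoord (diagonal fun i => G.E l i / 2)) c) - T =
      h * (symMat c + G.F.A l) * hᵀ := by
  rw [symMat_affMap, symMat_symCoord (isSymm_diagonal _), hT, ← sub_mul, ← mul_sub]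
  simp [F]

lemma posDef_conj_iff {M : Matrix (Fin n) (Fin n) ℝ} (hh : h.det ≠ 0) :
    (h * M * hᵀ).PosDef ↔ M.PosDef := by
  have := IsUnit.posDef_star_right_conjugate_iff (x := M) ((isUnit_iff_isUnit_det h).2 hh.isUnit)
  rwa [star_eq_conjTranspose, conjTranspose_eq_transpose_of_trivial] at this

lemma preimage_etaDomain (hh : h.det ≠ 0) (hT : T = h * diagonal (fun i => G.E l i / 2) * hᵀ) :
    affMap h (symCoord (diagonal fun i => G.E l i / 2)) ⁻¹' etaDomain n T = G.F.D l := by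
  ext c
  simp only [etaDomain, Set.mem_preimage, Set.mem_ofPred_eq, symMat_affMap_add hT,
    symMat_affMap_sub hT, posDef_conj_iff hh]
  exact and_comm

lemma ofReal_mul_cpow {x y z : ℝ} (hx : 0 ≤ x) (hy : 0 ≤ y) (hz : 0 ≤ z) (s : ℂ) :
    ((x * y * z : ℝ) : ℂ) ^ s = (x : ℂ) ^ s * (y : ℂ) ^ s * (z : ℂ) ^ s := by
  rw [Complex.ofReal_mul, Complex.mul_cpow_ofReal_nonneg (mul_nonneg hx hy) hz, Complex.ofReal_mul,
    Complex.mul_cpow_ofReal_nonneg hx hy]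

lemma etaIntegrand_affMap (hh : h.det ≠ 0)
    (hT : T = h * diagonal (fun i => G.E l i / 2) * hᵀ) (hy : G.y l = hᵀ * y * h) (α β : ℂ)
    {c : Coord n} (hc : c ∈ G.F.D l) :
    etaIntegrand n y T α β (affMap h (symCoord (diagonal fun i => G.E l i / 2)) c) =
      ((Real.exp (-(diagonal (fun i => G.E l i / 2) * G.y l).trace) : ℂ) *
      (((h.det ^ 2 : ℝ) : ℂ) ^ (α - rho n + (β - rho n)) *
        (((G.F.q l)⁻¹ : ℝ) : ℂ) ^ (α - rho n) * (((G.F.p l)⁻¹ : ℝ) : ℂ) ^ (β - rho n))) *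
        G.F.k l (α - rho n) (β - rho n) c := by
  have hA := mul_pos (G.F.hp l) hc.1.det_pos
  have hB := mul_pos (G.F.hq l) hc.2.det_pos
  have hp := G.F.hp l
  have hq := G.F.hq l
  have hne : ((h.det ^ 2 : ℝ) : ℂ) ≠ 0 := by exact_mod_cast pow_ne_zero 2 hh
  have h1 : (symMat (affMap h (symCoord (diagonal fun i => G.E l i / 2)) c) * y).trace =
      (symMat c * G.y l).trace + (diagonal (fun i => G.E l i / 2) * G.y l).trace := by
    rw [symMat_affMap, symMat_symCoord (isSymm_diagonal _), hy, ← trace_add, ← add_mul,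
      ← mul_assoc, ← mul_assoc, trace_mul_comm _ h]
    simp only [mul_assoc]
  have h2 : (h * (symMat c + G.F.B l) * hᵀ).det =
      h.det ^ 2 * (G.F.q l)⁻¹ * (G.F.q l * (symMat c + G.F.B l).det) := by
    rw [det_mul, det_mul, det_transpose]
    field_simp
  have h3 : (h * (symMat c + G.F.A l) * hᵀ).det =
      h.det ^ 2 * (G.F.p l)⁻¹ * (G.F.p l * (symMat c + G.F.A l).det) := by
    rw [det_mul, det_mul, det_transpose]
    field_simp
  unfold etaIntegrand ConeFamily.k kern
  rw [symMat_affMap_add hT, symMat_affMap_sub hT, h1, h2, h3,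
    ofReal_mul_cpow (by positivity) (by positivity) hB.le,
    ofReal_mul_cpow (by positivity) (by positivity) hA.le, Complex.cpow_add _ _ hne, neg_add,
    Real.exp_add, Complex.ofReal_mul]
  simp only [F]
  ring

lemma etaIntegral_eq (hh : h.det ≠ 0) (hT : T = h * diagonal (fun i => G.E l i / 2) * hᵀ)
    (hy : G.y l = hᵀ * y * h) (α β : ℂ) :
    etaIntegral n y T α β =
      G.factor l h (α - rho n) (β - rho n) * G.F.J 1 l (α - rho n) (β - rho n) := by
  rw [etaIntegral, setIntegral_affMap hh (symCoord (diagonal fun i => G.E l i / 2)),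
    preimage_etaDomain hh hT, setIntegral_congr_fun (G.F.measurableSet_D l)
      fun c hc => etaIntegrand_affMap hh hT hy α β hc, integral_const_mul, factor, J_one, ← mul_assoc]

lemma integrableOn_etaIntegrand (hh : h.det ≠ 0)
    (hT : T = h * diagonal (fun i => G.E l i / 2) * hᵀ)
    (hy : G.y l = hᵀ * y * h) {z : ℂ × ℂ} (hz : z ∈ convDomain n) :
    IntegrableOn (etaIntegrand n y T z.1 z.2) (etaDomain n T) := by
  rw [integrableOn_affMap_iff hh (symCoord (diagonal fun i => G.E l i / 2)),
    preimage_etaDomain hh hT, integrableOn_congr_fun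
      (fun c hc => etaIntegrand_affMap hh hT hy z.1 z.2 hc) (G.F.measurableSet_D l)]
  refine Integrable.const_mul ?_ _
  have h1 := G.integrableOn_k l (a := (z.1 - rho n).re) (b := (z.2 - rho n).re)
    (by have := hz.1; simp; linarith) (by have := hz.2; simp; linarith)
  refine Integrable.mono h1 ?_ ?_
  · exact (continuousOn_kern (G.F.hp l) (G.F.hq l) _ _).aestronglyMeasurable (G.F.measurableSet_D l)
  · refine (ae_restrict_iff' (G.F.measurableSet_D l)).2 (Eventually.of_forall fun c hc => ?_)
    unfold ConeFamily.k
    rw [norm_kern (G.F.hp l) (G.F.hq l) hc, norm_kern (G.F.hp l) (G.F.hq l) hc]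
    simp

lemma negIndex_eq (hh : h.det ≠ 0) (hT : T = h * diagonal (fun i => G.E l i / 2) * hᵀ) :
    negIndex T = G.V.card := by
  rw [hT, negIndex_congr hh]
  congr 1
  ext i
  simp only [Finset.mem_filter, Finset.mem_univ, true_and]
  constructor
  · intro h0
    by_contra hi
    linarith [G.hpos l i hi]
  · intro hi
    linarith [G.hneg l i hi]

lemma mem_regularSet (hh : h.det ≠ 0) (hT : T = h * diagonal (fun i => G.E l i / 2) * hᵀ)
    (z : ℂ × ℂ) : z ∈ regularSet n (negIndex T) ↔
      ((z.1 - rho n, z.2 - rho n) : ℂ × ℂ) ∈ goodSet G.Vᶜ.card G.V.card := by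
  rw [negIndex_eq hh hT, mem_regularSet_iff (by simpa using Finset.card_le_univ G.V),
    Finset.card_compl, Fintype.card_fin]

lemma isEtaContinuation (hh : h.det ≠ 0) (hT : T = h * diagonal (fun i => G.E l i / 2) * hᵀ)
    (hy : G.y l = hᵀ * y * h) :
    IsEtaContinuation n y T fun z => G.factor l h (z.1 - rho n) (z.2 - rho n) *
      G.cont l (z.1 - rho n, z.2 - rho n) := by
  have hs : Differentiable ℂ fun z : ℂ × ℂ => ((z.1 - rho n, z.2 - rho n) : ℂ × ℂ) :=
    Differentiable.prodMk (by fun_prop) (by fun_prop)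
  refine ⟨?_, fun z hz => ?_⟩
  · refine DifferentiableOn.mul ?_ ?_
    · exact ((G.differentiable_factor hh).comp hs).differentiableOn
    · exact (G.differentiableOn_cont l).comp hs.differentiableOn
        fun z hz => (mem_regularSet hh hT z).1 hz
  · beta_reduce
    rw [etaIntegral_eq hh hT hy, G.cont_eq_J l]
    · have := hz.1
      simp
      linarith
    · have := hz.2
      simp
      linarith

lemma etaDefined (hh : h.det ≠ 0) (hT : T = h * diagonal (fun i => G.E l i / 2) * hᵀ)
    (hy : G.y l = hᵀ * y * h) : EtaDefined n y T :=
  ⟨fun _ hz => integrableOn_etaIntegrand hh hT hy hz, _, isEtaContinuation hh hT hy⟩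

/-- The chosen continuation in `eta` and the explicit one agree on the domain of convergence, hence
at every regular point by the identity theorem. -/
lemma eta_eq (hh : h.det ≠ 0) (hT : T = h * diagonal (fun i => G.E l i / 2) * hᵀ)
    (hy : G.y l = hᵀ * y * h) {α β : ℂ} (hαβ : (α, β) ∈ regularSet n (negIndex T)) :
    eta n y T α β = G.factor l h (α - rho n) (β - rho n) * G.cont l (α - rho n, β - rho n) := by
  have hex : ∃ F : ℂ × ℂ → ℂ, IsEtaContinuation n y T F := ⟨_, isEtaContinuation hh hT hy⟩
  rw [eta, dif_pos hex]
  obtain ⟨h1, h2⟩ := hex.choose_spec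
  set Ψ := hex.choose
  have h3 := (mem_regularSet hh hT (α, β)).1 hαβ
  set x : ℝ := min (α - rho n).re (β - rho n).re - 1 with hx
  have hs : Differentiable ℂ fun z : ℂ × ℂ => ((z.1 + rho n, z.2 + rho n) : ℂ × ℂ) :=
    Differentiable.prodMk (by fun_prop) (by fun_prop)
  have key := eq_of_eq_large (p := G.Vᶜ.card) (j := G.V.card) (x := x) (y := -1)
    (Φ := fun z => Ψ (z.1 + rho n, z.2 + rho n))
    (Ψ := fun z => G.factor l h z.1 z.2 * G.cont l z) ?_ ?_ ?_ h3 ?_ ?_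
  · simpa using key
  · refine h1.comp hs.differentiableOn fun z hz => ?_
    rw [mem_regularSet hh hT]
    simpa using hz.1
  · exact (G.differentiable_factor hh).differentiableOn.mul
      ((G.differentiableOn_cont l).mono fun z hz => hz.1)
  · intro z hz1 hz2
    rw [h2 _ ⟨by simp; linarith, by simp; linarith⟩, etaIntegral_eq hh hT hy, G.cont_eq_J l hz1 hz2]
    simp
  · simp only [hx]
    linarith [min_le_left (α - rho n).re (β - rho n).re]
  · simp only [hx]
    linarith [min_le_right (α - rho n).re (β - rho n).re]

end DiagFamily

end Confluent

namespace Confluent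

/-! ### Block matrices, diagonalization and bounds uniform in the parameter -/

section Blocks
variable {m : ℕ}

/-- The block matrix with rows `(a, b)` and `(c, d)`. -/
def blockMat (a : ℝ) (b c : Fin m → ℝ) (d : Matrix (Fin m) (Fin m) ℝ) :
    Matrix (Fin (m + 1)) (Fin (m + 1)) ℝ :=
  Matrix.of (vecCons (vecCons a b) fun i => vecCons (c i) (d i))

variable {a a' : ℝ} {b b' c c' : Fin m → ℝ} {d d' : Matrix (Fin m) (Fin m) ℝ}

lemma blockSym_eq (a : ℝ) (b : Fin m → ℝ) (d : Matrix (Fin m) (Fin m) ℝ) :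
    blockSym a b d = blockMat a b b d := rfl

@[simp] lemma blockMat_zero_zero : blockMat a b c d 0 0 = a := rfl
@[simp] lemma blockMat_zero_succ (j : Fin m) : blockMat a b c d 0 j.succ = b j := rfl
@[simp] lemma blockMat_succ_zero (i : Fin m) : blockMat a b c d i.succ 0 = c i := rfl
@[simp] lemma blockMat_succ_succ (i j : Fin m) : blockMat a b c d i.succ j.succ = d i j := rfl

lemma blockMat_ext {M N : Matrix (Fin (m + 1)) (Fin (m + 1)) ℝ} (h1 : M 0 0 = N 0 0)
    (h2 : ∀ j : Fin m, M 0 j.succ = N 0 j.succ) (h3 : ∀ i : Fin m, M i.succ 0 = N i.succ 0)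
    (h4 : ∀ i j : Fin m, M i.succ j.succ = N i.succ j.succ) : M = N := by
  ext i j
  refine Fin.cases ?_ (fun i => ?_) i <;> refine Fin.cases ?_ (fun j => ?_) j
  · exact h1
  · exact h2 j
  · exact h3 i
  · exact h4 i j

lemma blockMat_mul : blockMat a b c d * blockMat a' b' c' d' =
    blockMat (a * a' + b ⬝ᵥ c') (a • b' + b ᵥ* d') (a' • c + d *ᵥ c')
      (vecMulVec c b' + d * d') := by
  refine blockMat_ext ?_ (fun j => ?_) (fun i => ?_) (fun i j => ?_) <;>
  simp [Matrix.mul_apply, Fin.sum_univ_succ, dotProduct, vecMul, mulVec, vecMulVec, mul_comm]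

lemma blockMat_transpose : (blockMat a b c d)ᵀ = blockMat a c b dᵀ := by
  refine blockMat_ext ?_ (fun j => ?_) (fun i => ?_) (fun i j => ?_) <;> simp

lemma blockMat_add : blockMat a b c d + blockMat a' b' c' d' =
    blockMat (a + a') (b + b') (c + c') (d + d') := by
  refine blockMat_ext ?_ (fun j => ?_) (fun i => ?_) (fun i j => ?_) <;> simp

lemma det_blockMat_zero : (blockMat a 0 c d).det = a * d.det := by
  rw [det_succ_row_zero, Fin.sum_univ_succ]
  simp only [blockMat_zero_zero, blockMat_zero_succ, Pi.zero_apply, mul_zero, zero_mul,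
    Finset.sum_const_zero, add_zero, Fin.val_zero, pow_zero, one_mul]
  congr 2

lemma trace_blockMat : (blockMat a b c d).trace = a + d.trace := by
  simp [trace, Fin.sum_univ_succ]

lemma diagonal_cons (t : ℝ) (e : Fin m → ℝ) :
    diagonal (vecCons t e) = blockMat t 0 0 (diagonal e) := by
  refine blockMat_ext ?_ (fun j => ?_) (fun i => ?_) (fun i j => ?_)
  · simp
  · simp [(Fin.succ_ne_zero j).symm]
  · simp
  · simp [diagonal_apply]

lemma blockSym_isSymm (hd : d.IsSymm) : (blockSym a b d).IsSymm := by
  rw [IsSymm, blockSym_eq, blockMat_transpose, hd.eq]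

lemma posDef_blockSym_zero (hd : d.PosDef) (ha : 0 < a) : (blockSym a 0 d).PosDef := by
  refine PosDef.of_dotProduct_mulVec_pos ?_ fun x hx => ?_
  · have h1 : d.IsSymm := by simpa [IsHermitian, IsSymm] using hd.1
    simpa [IsHermitian, IsSymm] using blockSym_isSymm (a := a) (b := 0) h1
  · have e : star x ⬝ᵥ blockSym a 0 d *ᵥ x =
        a * x 0 ^ 2 + (fun i : Fin m => x i.succ) ⬝ᵥ d *ᵥ fun i : Fin m => x i.succ := by
      rw [blockSym_eq]
      simp [dotProduct, mulVec, Fin.sum_univ_succ]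
      ring
    rw [e]
    by_cases h0 : (fun i : Fin m => x i.succ) = 0
    · have : x 0 ≠ 0 := by
        intro h
        refine hx (funext fun i => ?_)
        refine Fin.cases h (fun i => congrFun h0 i) i
      rw [h0]
      simp only [zero_dotProduct, add_zero]
      positivity
    · have := hd.dotProduct_mulVec_pos h0
      rw [star_trivial] at this
      positivity

lemma posDef_of_blockSym (h : (blockSym a b d).PosDef) : 0 < a ∧ d.PosDef := by
  refine ⟨by simpa using! h.diag_pos (i := 0), ?_⟩
  have := h.submatrix (e := Fin.succ) (Fin.succ_injective m)
  exact this

/-- The Schur complement. -/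
lemma blockSym_eq_conj (hd : d.IsSymm) (hdet : d.det ≠ 0) :
    blockSym a b d = blockMat 1 (d⁻¹ *ᵥ b) 0 1 * blockSym (a - b ⬝ᵥ d⁻¹ *ᵥ b) 0 d *
      (blockMat 1 (d⁻¹ *ᵥ b) 0 1)ᵀ := by
  have h1 : (d⁻¹ *ᵥ b) ᵥ* d = b := by
    rw [← mulVec_transpose, hd.eq, mulVec_mulVec, mul_nonsing_inv _ hdet.isUnit, one_mulVec]
  have h2 : d *ᵥ (d⁻¹ *ᵥ b) = b := by
    rw [mulVec_mulVec, mul_nonsing_inv _ hdet.isUnit, one_mulVec]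
  rw [blockSym_eq, blockSym_eq, blockMat_transpose, blockMat_mul, blockMat_mul]
  simp [h1, h2]

lemma det_blockMat_one (b : Fin m → ℝ) :
    (blockMat 1 b 0 (1 : Matrix (Fin m) (Fin m) ℝ)).det = 1 := by
  rw [← det_transpose, blockMat_transpose, det_blockMat_zero]
  simp

lemma det_blockSym (hd : d.IsSymm) (hdet : d.det ≠ 0) :
    (blockSym a b d).det = (a - b ⬝ᵥ d⁻¹ *ᵥ b) * d.det := by
  rw [blockSym_eq_conj hd hdet, det_mul, det_mul, det_transpose, det_blockMat_one, blockSym_eq,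
    det_blockMat_zero]
  ring

/-- Congruence to the block diagonal matrix formed by d and its Schur complement. -/
lemma posDef_blockSym_iff : (blockSym a b d).PosDef ↔ d.PosDef ∧ b ⬝ᵥ d⁻¹ *ᵥ b < a := by
  constructor
  · intro h
    have hd := (posDef_of_blockSym h).2
    refine ⟨hd, ?_⟩
    have h1 : d.IsSymm := by simpa [IsHermitian, IsSymm] using hd.1
    rw [blockSym_eq_conj h1 hd.det_pos.ne',
      DiagFamily.posDef_conj_iff (by rw [det_blockMat_one]; exact one_ne_zero)] at h
    linarith [(posDef_of_blockSym h).1]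
  · rintro ⟨hd, h⟩
    have h1 : d.IsSymm := by simpa [IsHermitian, IsSymm] using hd.1
    rw [blockSym_eq_conj h1 hd.det_pos.ne',
      DiagFamily.posDef_conj_iff (by rw [det_blockMat_one]; exact one_ne_zero)]
    exact posDef_blockSym_zero hd (by linarith)

end Blocks

lemma exists_diagonalization {n : ℕ} {T : Matrix (Fin n) (Fin n) ℝ} (hT : T.IsSymm)
    (hdet : T.det ≠ 0) : ∃ (h : Matrix (Fin n) (Fin n) ℝ) (d : Fin n → ℝ), h.det ≠ 0 ∧
      (∀ i, d i ≠ 0) ∧ T = h * diagonal d * hᵀ := by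
  have hH : T.IsHermitian := by simpa [IsHermitian, IsSymm] using hT
  set U : Matrix (Fin n) (Fin n) ℝ := hH.eigenvectorUnitary.1 with hU
  have e : T = U * diagonal hH.eigenvalues * Uᵀ := by
    have := hH.spectral_theorem
    rw [Unitary.conjStarAlgAut_apply] at this
    exact this
  have hd : T.det = U.det * (∏ i, hH.eigenvalues i) * U.det := by
    conv_lhs => rw [e]
    rw [det_mul, det_mul, det_transpose, det_diagonal]
  rw [hd] at hdet
  refine ⟨U, hH.eigenvalues, right_ne_zero_of_mul hdet, fun i => ?_, e⟩
  exact Finset.prod_ne_zero_iff.1 (right_ne_zero_of_mul (left_ne_zero_of_mul hdet)) i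
    (Finset.mem_univ i)

/-- The family attached to a diagonal matrix and varying `y`. -/
noncomputable def DiagFamily.ofDiagonal {Λ : Type} {n : ℕ} {d : Fin n → ℝ} (hd : ∀ i, d i ≠ 0)
    {y : Λ → Matrix (Fin n) (Fin n) ℝ} (hy : ∀ l, (y l).PosDef) : DiagFamily Λ n where
  E _ i := 2 * d i
  V := Finset.univ.filter fun i => d i < 0
  y := y
  hneg _ k hk := by linarith [(Finset.mem_filter.1 hk).2]
  hpos _ k hk := by
    have h1 : ¬ d k < 0 := fun h => hk (Finset.mem_filter.2 ⟨Finset.mem_univ k, h⟩)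
    have := lt_of_le_of_ne (not_lt.1 h1) (hd k).symm
    linarith
  hy := hy

lemma posDef_conj_transpose {n : ℕ} {h y : Matrix (Fin n) (Fin n) ℝ} (hh : h.det ≠ 0)
    (hy : y.PosDef) : (hᵀ * y * h).PosDef := by
  have := (DiagFamily.posDef_conj_iff (h := hᵀ) (M := y) (by rwa [det_transpose])).2 hy
  rwa [transpose_transpose] at this

/-- `η` is defined for every positive definite `y` and every regular symmetric `T`. -/
lemma etaDefined_of_posDef {n : ℕ} {T y : Matrix (Fin n) (Fin n) ℝ} (hT : T.IsSymm)
    (hdet : T.det ≠ 0) (hy : y.PosDef) : EtaDefined n y T := by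
  obtain ⟨h, d, hh, hd, e⟩ := exists_diagonalization hT hdet
  refine DiagFamily.etaDefined (G := DiagFamily.ofDiagonal (Λ := Unit) hd
    fun _ => posDef_conj_transpose hh hy) (l := ()) hh ?_ rfl
  rw [e]
  simp [DiagFamily.ofDiagonal]

namespace DiagFamily
variable {Λ : Type} {n : ℕ} (G : DiagFamily Λ n)

/-- The inverse minors are at most 1, so only y and the inverse of E need to be controlled in the
parameter. In the application with T₁ ≤ 0 the function w is y₁; with T₁ > 0 it is constant. -/
lemma exists_uniform_bound {w : Λ → ℝ} (hw : ∀ l, 1 ≤ w l)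
    (hy : ∀ i j, ∃ C, ∀ l, |G.y l i j| ≤ C * w l) (hE : ∀ k, ∃ C, ∀ l, |(G.E l k)⁻¹| ≤ C)
    {f : Λ → Coord n → ℂ} (hf : f ∈ G.alg) :
    ∃ C : ℝ, ∃ N : ℕ, 0 ≤ C ∧ ∀ l, ∀ c ∈ G.F.D l, ‖f l c‖ ≤ C * (w l * csize c) ^ N := by
  have h1 : ∀ l (c : Coord n), 1 ≤ w l * csize c := fun l c =>
    one_le_mul_of_one_le_of_one_le (hw l) (one_le_csize c)
  have abs : ∀ (f : Λ → Coord n → ℂ), (∃ C : ℝ, ∃ N : ℕ, ∀ l, ∀ c ∈ G.F.D l,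
      ‖f l c‖ ≤ C * (w l * csize c) ^ N) → ∃ C : ℝ, ∃ N : ℕ, 0 ≤ C ∧ ∀ l, ∀ c ∈ G.F.D l,
      ‖f l c‖ ≤ C * (w l * csize c) ^ N := by
    rintro f ⟨C, N, h⟩
    refine ⟨|C|, N, abs_nonneg C, fun l c hc => (h l c hc).trans ?_⟩
    exact mul_le_mul_of_nonneg_right (le_abs_self C) (pow_nonneg (by linarith [h1 l c]) N)
  induction hf using Algebra.adjoin_induction with
  | mem f hf =>
    apply abs
    rcases hf with ((⟨e, rfl⟩ | ⟨ij, rfl⟩) | ⟨k, rfl⟩) | rfl | rfl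
    · refine ⟨1, 1, fun l c _ => ?_⟩
      simp only [Complex.norm_real, Real.norm_eq_abs, one_mul, pow_one]
      exact (abs_le_csize c e).trans (le_mul_of_one_le_left (csize_pos c).le (hw l))
    · obtain ⟨C, hC⟩ := hy ij.1 ij.2
      refine ⟨|C|, 1, fun l c _ => ?_⟩
      simp only [Complex.norm_real, Real.norm_eq_abs, pow_one]
      have h2 : 0 ≤ w l := by linarith [hw l]
      refine (hC l).trans (mul_le_mul (le_abs_self C) ?_ h2 (abs_nonneg C))
      exact le_mul_of_one_le_right h2 (one_le_csize c)
    · obtain ⟨C, hC⟩ := hE k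
      refine ⟨C, 0, fun l c _ => ?_⟩
      simp only [Complex.norm_real, Real.norm_eq_abs, pow_zero, mul_one]
      exact hC l
    · refine ⟨1, 0, fun l c hc => ?_⟩
      have := G.one_le_minorA hc
      rw [Complex.norm_real, Real.norm_eq_abs, abs_of_nonneg (by positivity)]
      simpa using inv_le_one_of_one_le₀ this
    · refine ⟨1, 0, fun l c hc => ?_⟩
      have := G.one_le_minorB hc
      rw [Complex.norm_real, Real.norm_eq_abs, abs_of_nonneg (by positivity)]
      simpa using inv_le_one_of_one_le₀ this
  | algebraMap r => exact ⟨‖r‖, 0, norm_nonneg r, fun l c _ => by simp⟩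
  | add f g _ _ hf hg =>
    obtain ⟨C, N, hC, hf⟩ := hf
    obtain ⟨C', N', hC', hg⟩ := hg
    refine ⟨C + C', max N N', by positivity, fun l c hc => (norm_add_le _ _).trans ?_⟩
    rw [add_mul]
    refine add_le_add ((hf l c hc).trans ?_) ((hg l c hc).trans ?_)
    · exact mul_le_mul_of_nonneg_left (pow_le_pow_right₀ (h1 l c) (le_max_left _ _)) hC
    · exact mul_le_mul_of_nonneg_left (pow_le_pow_right₀ (h1 l c) (le_max_right _ _)) hC'
  | mul f g _ _ hf hg =>
    obtain ⟨C, N, hC, hf⟩ := hf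
    obtain ⟨C', N', hC', hg⟩ := hg
    refine ⟨C * C', N + N', by positivity, fun l c hc => ?_⟩
    have h0 : 0 ≤ w l * csize c := by linarith [h1 l c]
    rw [Pi.mul_apply, Pi.mul_apply, norm_mul]
    calc _ ≤ (C * (w l * csize c) ^ N) * (C' * (w l * csize c) ^ N') :=
          mul_le_mul (hf l c hc) (hg l c hc) (norm_nonneg _) (by positivity)
      _ = _ := by rw [pow_add]; ring

/-- The continuation is a combination of convergent integrals, with coefficients that do not
depend on the parameter. -/
lemma exists_cont_eq_sum {z : ℂ × ℂ} (hz : z ∈ goodSet G.Vᶜ.card G.V.card) :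
    ∃ N : ℕ, 0 < z.1.re + N ∧ 0 < z.2.re + N ∧ ∃ (ι : Type) (_ : Fintype ι) (r : ι → ℂ)
      (f : ι → Λ → Coord n → ℂ), (∀ i, f i ∈ G.alg) ∧
      ∀ l, G.cont l z = ∑ i, r i * G.F.J (f i) l (z.1 + N) (z.2 + N) := by
  obtain ⟨N, hN⟩ := exists_nat_gt (max (-z.1.re) (-z.2.re))
  have h1 := (le_max_left _ _).trans_lt hN
  have h2 := (le_max_right _ _).trans_lt hN
  obtain ⟨ι, _, r, f, hr, hf, h⟩ := G.rep_shift N 1 (one_mem _)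
  refine ⟨N, by linarith, by linarith, ι, inferInstance, fun i => r i z, f, hf, fun l => ?_⟩
  exact G.cont_eq_of_eq_large l (G.differentiableOn_sum_J hr hf N l)
    (fun w h1 h2 => (h l w.1 w.2 h1.le h2.le).symm) hz (by linarith) (by linarith)

end DiagFamily

end Confluent

/-! ### The case T₁ ≤ 0 -/

namespace Confluent

lemma sq_apply_le_mul {n : ℕ} {M : Matrix (Fin n) (Fin n) ℝ} (hM : M.PosSemidef) (i k : Fin n) :
    M i k ^ 2 ≤ M i i * M k k := by
  have h : ∀ t : ℝ, 0 ≤ M i i * (t * t) + (2 * M i k) * t + M k k := by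
    intro t
    have h1 := hM.dotProduct_mulVec_nonneg (t • Pi.single i 1 + Pi.single k 1)
    have h2 : M k i = M i k := by simpa using (hM.1.apply i k)
    rw [star_trivial, mulVec_add, mulVec_smul, mulVec_single_one, mulVec_single_one] at h1
    simp only [add_dotProduct, smul_dotProduct, dotProduct_add, dotProduct_smul,
      single_one_dotProduct, smul_eq_mul, col_apply] at h1
    rw [h2] at h1
    linarith
  have := discrim_le_zero h
  rw [discrim] at this
  nlinarith

lemma trace_diagonal_conj {n : ℕ} {h T y : Matrix (Fin n) (Fin n) ℝ} {d : Fin n → ℝ}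
    (hT : T = h * diagonal d * hᵀ) : (diagonal d * (hᵀ * y * h)).trace = (T * y).trace := by
  rw [hT, ← mul_assoc, ← mul_assoc, trace_mul_comm _ h]
  simp only [mul_assoc]

lemma trace_blockSym_mul {m : ℕ} (a a' : ℝ) (b b' : Fin m → ℝ) (d d' : Matrix (Fin m) (Fin m) ℝ) :
    (blockSym a b d * blockSym a' b' d').trace = a * a' + 2 * (b ⬝ᵥ b') + (d * d').trace := by
  rw [blockSym_eq, blockSym_eq, blockMat_mul, trace_blockMat, trace_add, trace_vecMulVec]
  ring

lemma exists_conj_diag_le {n : ℕ} (h : Matrix (Fin n) (Fin n) ℝ) (k : Fin n) :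
    ∃ C : ℝ, 0 ≤ C ∧ ∀ c : Coord n, (h * symMat c * hᵀ) k k ≤ C * csize c := by
  refine ⟨∑ j, ∑ i, |h k i| * |h k j|, by positivity, fun c => ?_⟩
  simp only [Matrix.mul_apply, transpose_apply, Finset.sum_mul]
  refine Finset.sum_le_sum fun j _ => Finset.sum_le_sum fun i _ => ?_
  refine (le_abs_self _).trans ?_
  rw [abs_mul, abs_mul, mul_right_comm]
  exact mul_le_mul_of_nonneg_left (abs_le_csize c _) (by positivity)

lemma exp_neg_le {x : ℝ} (hx : 0 < x) (P : ℕ) : Real.exp (-x) ≤ P.factorial * (x⁻¹) ^ P := by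
  have h1 := Real.pow_div_factorial_le_exp x hx.le P
  have h2 : (0 : ℝ) < P.factorial := by exact_mod_cast P.factorial_pos
  rw [Real.exp_neg, inv_pow, ← div_eq_mul_inv, le_div_iff₀ (by positivity),
    inv_mul_le_iff₀ (Real.exp_pos x)]
  rwa [div_le_iff₀ h2] at h1

lemma polyBdd_csize_pow {n : ℕ} (D : Set (Coord n)) (N : ℕ) :
    PolyBdd D fun c => ((csize c ^ N : ℝ) : ℂ) := by
  refine ⟨?_, 1, N, fun c _ => ?_⟩
  · exact (Complex.continuous_ofReal.comp (continuous_csize.pow N)).continuousOn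
  · rw [Complex.norm_real, Real.norm_of_nonneg (pow_nonneg (csize_pos c).le N), one_mul]

/-- If `T₁ ≤ 0`, the first entry of `w` is bounded below on the cone. -/
lemma exists_inv_apply_zero_le {n : ℕ} {T h : Matrix (Fin (n + 1)) (Fin (n + 1)) ℝ}
    (hdet : T.det ≠ 0) (hT0 : T 0 0 ≤ 0) :
    ∃ C : ℝ, 0 ≤ C ∧ ∀ c : Coord (n + 1), (h * symMat c * hᵀ).PosDef →
      (h * symMat c * hᵀ + (2 : ℝ) • T).PosDef → ((h * symMat c * hᵀ) 0 0)⁻¹ ≤ C * csize c := by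
  -- The first row of T is not zero because T is invertible.
  obtain ⟨k, hk⟩ : ∃ k, T 0 k ≠ 0 := by
    by_contra! h0
    exact hdet (det_eq_zero_of_row_eq_zero 0 h0)
  obtain ⟨C, hC0, hC⟩ := exists_conj_diag_le h k
  have hk2 : 0 < T 0 k ^ 2 := by positivity
  refine ⟨(C + |T k k|) / T 0 k ^ 2, by positivity, fun c h1 h2 => ?_⟩
  have hv : 0 < (h * symMat c * hᵀ) 0 0 := h1.diag_pos
  have hvk : 0 < (h * symMat c * hᵀ + (2 : ℝ) • T) k k := h2.diag_pos
  have e1 := sq_apply_le_mul h1.posSemidef 0 k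
  have e2 := sq_apply_le_mul h2.posSemidef 0 k
  have e3 := hC c
  simp only [Matrix.add_apply, Matrix.smul_apply, smul_eq_mul] at e2 hvk
  set w := h * symMat c * hᵀ
  -- The 2 × 2 minors of w and w + 2T bound w_{0k}² and (w_{0k} + 2T_{0k})², the second using T_{00}
  -- ≤ 0. Half the sum of these squares is (w_{0k} + T_{0k})² + T_{0k}².
  have e4 : T 0 k ^ 2 ≤ w 0 0 * (w k k + T k k) := by nlinarith [sq_nonneg (w 0 k + T 0 k)]
  have e5 : w k k + T k k ≤ (C + |T k k|) * csize c := by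
    have := le_mul_of_one_le_right (abs_nonneg (T k k)) (one_le_csize c)
    nlinarith [le_abs_self (T k k)]
  rw [div_mul_eq_mul_div, inv_eq_one_div, div_le_div_iff₀ hv hk2, one_mul, mul_comm _ (w 0 0)]
  exact e4.trans (mul_le_mul_of_nonneg_left e5 hv.le)

section Nonpos
variable {m : ℕ} {T₁ : ℝ} {T₁₂ y₁₂ : Fin m → ℝ} {T₂ y₂ : Matrix (Fin m) (Fin m) ℝ}

lemma tendsto_eta_of_nonpos (hT₂ : T₂.IsSymm) (hT : (blockSym T₁ T₁₂ T₂).det ≠ 0)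
    (hy₂ : y₂.PosDef) {α β : ℂ}
    (hαβ : (α, β) ∈ regularSet (m + 1) (negIndex (blockSym T₁ T₁₂ T₂))) (hT₁ : T₁ ≤ 0) :
    Tendsto (fun y₁ : ℝ => (Real.exp (T₁ * y₁) : ℂ) * (y₁ : ℂ) ^ β *
      eta (m + 1) (blockSym y₁ y₁₂ y₂) (blockSym T₁ T₁₂ T₂) α β) atTop (𝓝 0) := by
  obtain ⟨h, d, hh, hd, hTd⟩ := exists_diagonalization (blockSym_isSymm hT₂) hT
  -- Beyond this threshold the Schur complement of y₂ is positive. The bound 1 allows powers of y₁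
  -- to absorb constants.
  set y₀ : ℝ := max 1 (y₁₂ ⬝ᵥ y₂⁻¹ *ᵥ y₁₂ + 1) with hy₀
  have hy₀1 : 1 ≤ y₀ := le_max_left _ _
  have hpos : ∀ t, y₀ ≤ t → (blockSym t y₁₂ y₂).PosDef := fun t ht =>
    posDef_blockSym_iff.2 ⟨hy₂, by linarith [le_max_right 1 (y₁₂ ⬝ᵥ y₂⁻¹ *ᵥ y₁₂ + 1)]⟩
  set G : DiagFamily {t : ℝ // y₀ ≤ t} (m + 1) := DiagFamily.ofDiagonal hd
    (y := fun l => hᵀ * blockSym l.1 y₁₂ y₂ * h)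
    (fun l => posDef_conj_transpose hh (hpos l.1 l.2)) with hG
  have hTG : ∀ l, blockSym T₁ T₁₂ T₂ = h * diagonal (fun i => G.E l i / 2) * hᵀ := fun l => by
    rw [hTd]
    simp [hG, DiagFamily.ofDiagonal]
  have hyG : ∀ l, G.y l = hᵀ * blockSym l.1 y₁₂ y₂ * h := fun l => rfl
  set l₀ : {t : ℝ // y₀ ≤ t} := ⟨y₀, le_rfl⟩ with hl₀
  have hz := (DiagFamily.mem_regularSet hh (hTG l₀) (α, β)).1 hαβ
  obtain ⟨N, hN1, hN2, ι, _, r, f, hf, hsum⟩ := G.exists_cont_eq_sum hz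
  set a : ℂ := α - rho (m + 1) + N with ha
  set b : ℂ := β - rho (m + 1) + N with hb
  have ha0 : 0 < a.re := by simpa [ha] using hN1
  have hb0 : 0 < b.re := by simpa [hb] using hN2
  obtain ⟨C₁, hC₁, hv⟩ := exists_inv_apply_zero_le (h := h) hT hT₁
  have hD : ∀ l, G.F.D l = G.F.D l₀ := fun l => rfl
  -- Here h v ᵗh is u - T. Since y₁ is a single diagonal entry of y, changing it multiplies the
  -- kernel by the exponential of a multiple of the first diagonal entry of u - T.
  have hk : ∀ l, ∀ c ∈ G.F.D l₀, 0 < (h * symMat c * hᵀ) 0 0 ∧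
      ((h * symMat c * hᵀ) 0 0)⁻¹ ≤ C₁ * csize c ∧
      ‖G.F.k l a b c‖ = Real.exp (-((l.1 - y₀) * (h * symMat c * hᵀ) 0 0)) *
        ‖G.F.k l₀ a b c‖ := by
    intro l c hc
    have h1 : (h * symMat c * hᵀ).PosDef := by
      have : (symMat c + 0).PosDef := hc.1
      rw [add_zero] at this
      exact (DiagFamily.posDef_conj_iff hh).2 this
    have h2 : (h * symMat c * hᵀ + (2 : ℝ) • blockSym T₁ T₁₂ T₂).PosDef := by
      have := (DiagFamily.posDef_conj_iff hh).2 hc.2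
      convert this using 1
      rw [hTd, mul_add, add_mul, ← smul_mul_assoc, ← mul_smul_comm, ← diagonal_smul]
      rfl
    refine ⟨h1.diag_pos, hv c h1 h2, ?_⟩
    have e1 : (symMat c * G.y l).trace = (symMat c * G.y l₀).trace +
        (l.1 - y₀) * (h * symMat c * hᵀ) 0 0 := by
      have e2 : ∀ y, (symMat c * (hᵀ * y * h)).trace = (h * symMat c * hᵀ * y).trace := by
        intro y
        rw [← mul_assoc, ← mul_assoc, trace_mul_comm _ h]
        simp only [mul_assoc]
      have e3 : blockSym l.1 y₁₂ y₂ = blockSym y₀ y₁₂ y₂ + (l.1 - y₀) • Matrix.single 0 0 1 := by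
        rw [blockSym_eq, blockSym_eq]
        refine blockMat_ext ?_ (fun j => ?_) (fun i => ?_) (fun i j => ?_)
        · simp
        · simp [(Fin.succ_ne_zero j).symm]
        · simp [(Fin.succ_ne_zero i).symm]
        · simp [(Fin.succ_ne_zero i).symm]
      rw [hyG, hyG, e2, e2, e3, mul_add, trace_add, mul_smul_comm, trace_smul, smul_eq_mul,
        trace_mul_single]
      simp only [hl₀, MulOpposite.op_one, one_smul]
    unfold ConeFamily.k
    rw [norm_kern (G.F.hp l) (G.F.hq l) (show c ∈ cone (G.F.A l) (G.F.B l) from hc),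
      norm_kern (G.F.hp l₀) (G.F.hq l₀) hc]
    have e4 : (symMat c * G.F.y l).trace = (symMat c * G.F.y l₀).trace +
        (l.1 - y₀) * (h * symMat c * hᵀ) 0 0 := e1
    rw [e4, neg_add, Real.exp_add]
    have : G.F.p l = G.F.p l₀ ∧ G.F.q l = G.F.q l₀ ∧ G.F.A l = G.F.A l₀ ∧ G.F.B l = G.F.B l₀ :=
      ⟨rfl, rfl, rfl, rfl⟩
    rw [this.1, this.2.1, this.2.2.1, this.2.2.2]
    ring
  have hyb : ∀ i j, ∃ C, ∀ l, |G.y l i j| ≤ C * l.1 := by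
    intro i j
    refine ⟨|(hᵀ * blockSym 0 y₁₂ y₂ * h) i j| +
      |(hᵀ * (Matrix.single 0 0 1 : Matrix (Fin (m + 1)) (Fin (m + 1)) ℝ) * h) i j|,
      fun l => ?_⟩
    have e3 : blockSym l.1 y₁₂ y₂ = blockSym 0 y₁₂ y₂ + l.1 • Matrix.single 0 0 1 := by
      rw [blockSym_eq, blockSym_eq]
      refine blockMat_ext ?_ (fun j => ?_) (fun i => ?_) (fun i j => ?_)
      · simp
      · simp [(Fin.succ_ne_zero j).symm]
      · simp [(Fin.succ_ne_zero i).symm]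
      · simp [(Fin.succ_ne_zero i).symm]
    have hl1 : 1 ≤ l.1 := hy₀1.trans l.2
    rw [hyG, e3, mul_add, add_mul, mul_smul_comm, smul_mul_assoc, Matrix.add_apply,
      Matrix.smul_apply, smul_eq_mul, add_mul]
    refine (abs_add_le _ _).trans (add_le_add ?_ ?_)
    · exact le_mul_of_one_le_right (abs_nonneg _) hl1
    · rw [abs_mul, abs_of_pos (by linarith), mul_comm]
  -- The weight costs a fixed power M of y₁. Bounding e^{-x} by P!/x^P and the inverse of the first
  -- entry by a multiple of `csize` gains an arbitrary power P, at the price of more powers of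
  -- `csize`, which are still integrable.
  have hbound : ∀ g ∈ G.alg, ∃ M : ℕ, ∀ P : ℕ, ∃ C : ℝ, ∀ l, y₀ < l.1 →
      ‖G.F.J g l a b‖ ≤ C * (l.1 ^ M * ((l.1 - y₀)⁻¹) ^ P) := by
    intro g hg
    obtain ⟨C, M, hC, hbd⟩ := G.exists_uniform_bound (w := fun l => l.1)
      (fun l => hy₀1.trans l.2) hyb (fun k => ⟨|(2 * d k)⁻¹|, fun l => le_rfl⟩) hg
    refine ⟨M, fun P => ⟨C * P.factorial * C₁ ^ P *
      ∫ c in G.F.D l₀, csize c ^ (M + P) * ‖G.F.k l₀ a b c‖, fun l hl => ?_⟩⟩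
    have hs : 0 < l.1 - y₀ := sub_pos.2 hl
    have hl0 : 0 < l.1 := by linarith
    have hint : IntegrableOn (fun c => csize c ^ (M + P) * ‖G.F.k l₀ a b c‖) (G.F.D l₀) := by
      have := (integrableOn_mul_kern (G.F.hA l₀) (G.F.hB l₀) (G.F.hp l₀) (G.F.hq l₀) (G.F.hy l₀)
        (polyBdd_csize_pow (G.F.D l₀) (M + P)) ha0.le hb0.le).norm
      refine this.congr (Eventually.of_forall fun c => ?_)
      simp only [norm_mul, Complex.norm_real, Real.norm_eq_abs]
      rw [abs_of_nonneg (pow_nonneg (csize_pos c).le _)]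
      rfl
    have hle : ‖G.F.J g l a b‖ ≤ ∫ c in G.F.D l₀, (C * P.factorial * C₁ ^ P *
        (l.1 ^ M * ((l.1 - y₀)⁻¹) ^ P)) * (csize c ^ (M + P) * ‖G.F.k l₀ a b c‖) := by
      refine norm_integral_le_of_norm_le (hint.const_mul _) ?_
      rw [hD l]
      refine (ae_restrict_iff' (G.F.measurableSet_D l₀)).2 (Eventually.of_forall fun c hc => ?_)
      obtain ⟨k1, k2, k3⟩ := hk l c hc
      rw [norm_mul, k3]
      have b1 := hbd l c hc
      have b2 := exp_neg_le (mul_pos hs k1) P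
      have b3 : (((l.1 - y₀) * (h * symMat c * hᵀ) 0 0)⁻¹) ^ P ≤
          ((l.1 - y₀)⁻¹ * (C₁ * csize c)) ^ P := by
        refine pow_le_pow_left₀ (by positivity) ?_ P
        rw [mul_inv]
        exact mul_le_mul_of_nonneg_left k2 (by positivity)
      have b4 : Real.exp (-((l.1 - y₀) * (h * symMat c * hᵀ) 0 0)) ≤
          P.factorial * ((l.1 - y₀)⁻¹ * (C₁ * csize c)) ^ P :=
        b2.trans (mul_le_mul_of_nonneg_left b3 (by positivity))
      have hcs := csize_pos c
      calc _ ≤ C * (l.1 * csize c) ^ M * (P.factorial * ((l.1 - y₀)⁻¹ * (C₁ * csize c)) ^ P *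
            ‖G.F.k l₀ a b c‖) :=
            mul_le_mul b1 (mul_le_mul_of_nonneg_right b4 (norm_nonneg _)) (by positivity)
              (by positivity)
        _ = _ := by rw [mul_pow, mul_pow, mul_pow, pow_add]; ring
    rw [integral_const_mul] at hle
    refine hle.trans (le_of_eq ?_)
    ring
  set lt : ℝ → {t : ℝ // y₀ ≤ t} := fun t => ⟨max t y₀, le_max_right t y₀⟩ with hlt
  have hJ : ∀ g ∈ G.alg, Tendsto (fun t : ℝ => (t : ℂ) ^ β * G.F.J g (lt t) a b) atTop (𝓝 0) := by
    intro g hg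
    obtain ⟨M, hM⟩ := hbound g hg
    -- P is chosen to beat both the growth of the weight and the factor y₁^β.
    obtain ⟨P, hP⟩ := exists_nat_gt (β.re + M)
    obtain ⟨C, hC⟩ := hM P
    have hlim : Tendsto (fun t : ℝ => (C * 2 ^ P) * t ^ (-(P - (β.re + M)))) atTop (𝓝 0) := by
      simpa using (tendsto_rpow_neg_atTop (sub_pos.2 hP)).const_mul (C * 2 ^ P)
    refine squeeze_zero_norm' ?_ hlim
    filter_upwards [eventually_ge_atTop (2 * y₀)] with t ht
    have ht0 : 0 < t := by linarith
    have hlt' : (lt t).1 = t := max_eq_left (by linarith)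
    have hb1 := hC (lt t) (by rw [hlt']; linarith)
    rw [hlt'] at hb1
    rw [norm_mul, Complex.norm_cpow_eq_rpow_re_of_pos ht0]
    have hC0 : 0 ≤ C := by
      have h0 : 0 < t ^ M * ((t - y₀)⁻¹) ^ P := by
        have : 0 < t - y₀ := by linarith
        positivity
      exact nonneg_of_mul_nonneg_left ((norm_nonneg _).trans hb1) h0
    have h2 : ((t - y₀)⁻¹) ^ P ≤ (2 * t⁻¹) ^ P := by
      refine pow_le_pow_left₀ (inv_nonneg.2 (by linarith)) ?_ P
      rw [← div_eq_mul_inv, inv_le_comm₀ (by linarith) (by positivity), inv_div]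
      linarith
    calc t ^ β.re * ‖G.F.J g (lt t) a b‖ ≤ t ^ β.re * (C * (t ^ M * (2 * t⁻¹) ^ P)) := by
          refine mul_le_mul_of_nonneg_left (hb1.trans ?_) (by positivity)
          exact mul_le_mul_of_nonneg_left (mul_le_mul_of_nonneg_left h2 (by positivity)) hC0
      _ = C * 2 ^ P * t ^ (-(P - (β.re + M))) := by
          rw [neg_sub, Real.rpow_sub ht0, Real.rpow_add ht0, Real.rpow_natCast, Real.rpow_natCast,
            mul_pow, inv_pow]
          field_simp
  have hcont : Tendsto (fun t : ℝ => (t : ℂ) ^ β *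
      G.cont (lt t) (α - rho (m + 1), β - rho (m + 1))) atTop (𝓝 0) := by
    simp only [hsum, Finset.mul_sum]
    have : Tendsto (fun t : ℝ => ∑ i, r i * ((t : ℂ) ^ β * G.F.J (f i) (lt t) a b)) atTop
        (𝓝 (∑ i : ι, r i * 0)) := tendsto_finsetSum _ fun i _ => (hJ (f i) (hf i)).const_mul (r i)
    simp only [mul_zero, Finset.sum_const_zero] at this
    refine this.congr fun t => Finset.sum_congr rfl fun i _ => ?_
    rw [ha, hb]
    ring
  -- The part of the factor that is independent of y₁: e^{-tr(Ty)} without e^{-T₁ y₁}, which cancels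
  -- the prefactor of the theorem.
  set κ : ℂ := (Real.exp (-(2 * (T₁₂ ⬝ᵥ y₁₂) + (T₂ * y₂).trace)) : ℂ) *
    ((|h.det| ^ (m + 1 + 1) : ℝ) * (((h.det ^ 2 : ℝ) : ℂ) ^
      (α - rho (m + 1) + (β - rho (m + 1))) *
      (((G.F.q l₀)⁻¹ : ℝ) : ℂ) ^ (α - rho (m + 1)) *
        (((G.F.p l₀)⁻¹ : ℝ) : ℂ) ^ (β - rho (m + 1)))) with hκ
  have hfin := hcont.const_mul κ
  rw [mul_zero] at hfin
  refine hfin.congr' ?_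
  filter_upwards [eventually_ge_atTop y₀] with t ht
  have hlt' : (lt t).1 = t := max_eq_left ht
  have e0 : blockSym t y₁₂ y₂ = blockSym (lt t).1 y₁₂ y₂ := by rw [hlt']
  rw [e0, DiagFamily.eta_eq hh (hTG (lt t)) (hyG (lt t)) hαβ, DiagFamily.factor, hyG,
    trace_diagonal_conj (hTG (lt t)), trace_blockSym_mul, hlt']
  have e1 : G.F.p (lt t) = G.F.p l₀ ∧ G.F.q (lt t) = G.F.q l₀ := ⟨rfl, rfl⟩
  rw [e1.1, e1.2, hκ, show -(T₁ * t + 2 * (T₁₂ ⬝ᵥ y₁₂) + (T₂ * y₂).trace) =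
    -(T₁ * t) + -(2 * (T₁₂ ⬝ᵥ y₁₂) + (T₂ * y₂).trace) by ring, Real.exp_add, Complex.ofReal_mul]
  have e2 : (Real.exp (T₁ * t) : ℂ) * (Real.exp (-(T₁ * t)) : ℂ) = 1 := by
    rw [← Complex.ofReal_mul, ← Real.exp_add, add_neg_cancel, Real.exp_zero, Complex.ofReal_one]
  linear_combination (-(Real.exp (-(2 * (T₁₂ ⬝ᵥ y₁₂) + (T₂ * y₂).trace)) : ℂ) *
    ((|h.det| ^ (m + 1 + 1) : ℝ) * (((h.det ^ 2 : ℝ) : ℂ) ^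
      (α - rho (m + 1) + (β - rho (m + 1))) *
      (((G.F.q l₀)⁻¹ : ℝ) : ℂ) ^ (α - rho (m + 1)) *
        (((G.F.p l₀)⁻¹ : ℝ) : ℂ) ^ (β - rho (m + 1)))) * (t : ℂ) ^ β *
      G.cont (lt t) (α - rho (m + 1), β - rho (m + 1))) * e2

end Nonpos

end Confluent

/-! ### The degeneration in which the first diagonal entry tends to infinity -/

namespace Confluent

section FirstRow
variable {m : ℕ}

/-- The coordinates of the lower right block. -/
def lowerBlock (c : Coord (m + 1)) : Coord m := fun e => c (e.map Fin.succ)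

lemma continuous_lowerBlock : Continuous (lowerBlock (m := m)) := by
  unfold lowerBlock
  fun_prop

lemma symMat_eq_blockSym (c : Coord (m + 1)) :
    symMat c = blockSym (c s(0, 0)) (fun j => c s(0, j.succ)) (symMat (lowerBlock c)) := by
  rw [blockSym_eq]
  refine blockMat_ext ?_ (fun j => ?_) (fun i => ?_) (fun i j => ?_)
  · rfl
  · rfl
  · exact congrArg c Sym2.eq_swap
  · rfl

lemma csize_lowerBlock_le (c : Coord (m + 1)) : csize (lowerBlock c) ≤ csize c := by
  unfold csize lowerBlock
  have h := Sym2.map.injective (Fin.succ_injective m)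
  have e : ∑ e : Sym2 (Fin m), |c (e.map Fin.succ)| =
      ∑ e ∈ Finset.univ.map ⟨_, h⟩, |c e| := by simp
  rw [e]
  gcongr
  exact Finset.subset_univ _

/-- The determinant is affine in its corner entry, with the complementary minor as slope; this
isolates the term that survives when the corner tends to infinity. -/
lemma det_blockMat_add (a s : ℝ) (b c : Fin m → ℝ) (d : Matrix (Fin m) (Fin m) ℝ) :
    (blockMat (a + s) b c d).det = (blockMat a b c d).det + s * d.det := by
  rw [det_succ_row_zero, det_succ_row_zero (blockMat a b c d), Fin.sum_univ_succ,
    Fin.sum_univ_succ]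
  have e0 : ∀ t, (blockMat t b c d).submatrix Fin.succ (Fin.succAbove 0) = d := fun t => by
    ext i j; simp
  have e1 : ∀ t, ∀ j : Fin m, (blockMat t b c d).submatrix Fin.succ (Fin.succAbove j.succ) =
      (blockMat a b c d).submatrix Fin.succ (Fin.succAbove j.succ) := fun t j => by
    ext i k; rfl
  simp only [e0, e1 (a + s), blockMat_zero_zero, blockMat_zero_succ]
  simp
  ring

lemma rpow_le_of_le_csize {n : ℕ} {x K r : ℝ} {M k : ℕ} (hr : 0 ≤ r) (hk : r ≤ k) (hx : 0 < x)
    {c : Coord n} (h : x ≤ K * csize c ^ M) :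
    x ^ r ≤ (K + 1) ^ k * csize c ^ (M * k) := by
  have h1 : 1 ≤ csize c ^ M := one_le_pow₀ (one_le_csize c)
  have h2 : x ≤ (K + 1) * csize c ^ M := by nlinarith
  have h3 : 1 ≤ (K + 1) * csize c ^ M := by nlinarith
  calc x ^ r ≤ ((K + 1) * csize c ^ M) ^ r := Real.rpow_le_rpow hx.le h2 hr
    _ ≤ ((K + 1) * csize c ^ M) ^ (k : ℝ) := Real.rpow_le_rpow_of_exponent_le h3 hk
    _ = _ := by rw [Real.rpow_natCast, mul_pow, pow_mul]

end FirstRow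

/-- The first diagonal entry tends to infinity and everything else converges. -/
structure Degenerates {Λ : Type} {m : ℕ} (G : DiagFamily Λ (m + 1)) (G₂ : DiagFamily Unit m)
    (𝓕 : Filter Λ) : Prop where
  one_le : ∀ l, 1 ≤ G.E l 0
  E_succ : ∀ l k, G.E l k.succ = G₂.E () k
  V_eq : G.V = G₂.V.map (Fin.succEmb m)
  tendsto_E : Tendsto (fun l => G.E l 0) 𝓕 atTop
  tendsto_y : ∀ i j, Tendsto (fun l => G.y l i j) 𝓕 (𝓝 (blockSym 1 0 (G₂.y ()) i j))
  bdd_y : ∀ i j, ∃ C, ∀ l, |G.y l i j| ≤ C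

namespace Degenerates
variable {Λ : Type} {m : ℕ} {G : DiagFamily Λ (m + 1)} {G₂ : DiagFamily Unit m} {𝓕 : Filter Λ}

variable (G₂) in
/-- The limit of the cones. -/
def limD : Set (Coord (m + 1)) := {c | (symMat c).PosDef ∧ lowerBlock c ∈ G₂.F.D ()}

variable (G₂) in
/-- The limit of the kernels. -/
noncomputable def limK (a b : ℂ) (c : Coord (m + 1)) : ℂ :=
  (Real.exp (-(symMat c * blockSym 1 0 (G₂.y ())).trace) : ℂ) *
    ((G₂.F.q () * (symMat (lowerBlock c) + G₂.F.B ()).det : ℝ) : ℂ) ^ a *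
    ((G₂.F.p () * (symMat c).det : ℝ) : ℂ) ^ b

lemma isOpen_limD : IsOpen (limD G₂) :=
  (isOpen_posDef continuous_symMat symMat_isHermitian).inter
    ((isOpen_cone (G₂.F.hA ()) (G₂.F.hB ())).preimage continuous_lowerBlock)

lemma norm_limK {c : Coord (m + 1)} (hc : c ∈ limD G₂) (a b : ℂ) :
    ‖limK G₂ a b c‖ = Real.exp (-(symMat c * blockSym 1 0 (G₂.y ())).trace) *
      (G₂.F.q () * (symMat (lowerBlock c) + G₂.F.B ()).det) ^ a.re *
      (G₂.F.p () * (symMat c).det) ^ b.re := by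
  unfold limK
  rw [norm_mul, norm_mul, Complex.norm_cpow_eq_rpow_re_of_pos (mul_pos (G₂.F.hq ()) hc.2.2.det_pos),
    Complex.norm_cpow_eq_rpow_re_of_pos (mul_pos (G₂.F.hp ()) hc.1.det_pos), Complex.norm_real,
    Real.norm_of_nonneg (Real.exp_pos _).le]

lemma continuousOn_limK (a b : ℂ) : ContinuousOn (limK G₂ a b) (limD G₂) := by
  unfold limK
  refine ContinuousOn.mul (ContinuousOn.mul ?_ ?_) ?_
  · exact (Complex.continuous_ofReal.comp
      (Real.continuous_exp.comp continuous_trace_symMat.neg)).continuousOn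
  · intro c hc
    have h := mul_pos (G₂.F.hq ()) hc.2.2.det_pos
    refine ContinuousWithinAt.cpow ?_ continuousWithinAt_const (Or.inl (by simpa using h))
    exact (Complex.continuous_ofReal.comp (continuous_const.mul
      ((continuous_det_symMat _).comp continuous_lowerBlock))).continuousWithinAt
  · intro c hc
    have h := mul_pos (G₂.F.hp ()) hc.1.det_pos
    refine ContinuousWithinAt.cpow ?_ continuousWithinAt_const (Or.inl (by simpa using h))
    exact (Complex.continuous_ofReal.comp (continuous_const.mul
      continuous_symMat.matrix_det)).continuousWithinAt

lemma posDef_lim : (blockSym 1 0 (G₂.y ())).PosDef := posDef_blockSym_zero (G₂.hy ()) one_pos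

lemma symMat_add_B (H : Degenerates G G₂ 𝓕) (l : Λ) (c : Coord (m + 1)) :
    symMat c + G.F.B l = blockSym (c s(0, 0) + G.E l 0) (fun j => c s(0, j.succ))
      (symMat (lowerBlock c) + G₂.F.B ()) := by
  have e : G.E l = vecCons (G.E l 0) (G₂.E ()) := by
    ext i
    refine Fin.cases rfl (fun i => ?_) i
    exact H.E_succ l i
  have e1 : G.F.B l = blockMat (G.E l 0) 0 0 (G₂.F.B ()) := by
    change diagonal (G.E l) = _
    rw [e, diagonal_cons]
    rfl
  rw [e1, symMat_eq_blockSym, blockSym_eq, blockMat_add, add_zero, blockSym_eq]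

lemma D_subset (H : Degenerates G G₂ 𝓕) (l : Λ) : G.F.D l ⊆ limD G₂ := by
  rintro c ⟨h1, h2⟩
  have h1' : (symMat c).PosDef := by
    have : (symMat c + 0).PosDef := h1
    rwa [add_zero] at this
  refine ⟨h1', ?_, ?_⟩
  · change (symMat (lowerBlock c) + 0).PosDef
    rw [add_zero]
    rw [symMat_eq_blockSym] at h1'
    exact (posDef_of_blockSym h1').2
  · rw [H.symMat_add_B] at h2
    exact (posDef_of_blockSym h2).2

/-- Once the lower block of u + E is positive definite, the remaining condition is positivity of a
Schur complement in which the large entry of E enters additively. -/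
lemma eventually_mem_D (H : Degenerates G G₂ 𝓕) {c : Coord (m + 1)} (hc : c ∈ limD G₂) :
    ∀ᶠ l in 𝓕, c ∈ G.F.D l := by
  filter_upwards [H.tendsto_E.eventually_gt_atTop ((fun j : Fin m => c s(0, j.succ)) ⬝ᵥ
    (symMat (lowerBlock c) + G₂.F.B ())⁻¹ *ᵥ (fun j : Fin m => c s(0, j.succ)) - c s(0, 0))]
    with l hl
  refine ⟨?_, ?_⟩
  · change (symMat c + 0).PosDef
    rw [add_zero]
    exact hc.1
  · rw [H.symMat_add_B]
    exact posDef_blockSym_iff.2 ⟨hc.2.2, by linarith⟩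

lemma succ_mem_V (H : Degenerates G G₂ 𝓕) (k : Fin m) : k.succ ∈ G.V ↔ k ∈ G₂.V := by
  rw [H.V_eq]
  simp

lemma zero_notMem_V (H : Degenerates G G₂ 𝓕) : (0 : Fin (m + 1)) ∉ G.V := by
  rw [H.V_eq]
  simp

lemma p_eq (H : Degenerates G G₂ 𝓕) (l : Λ) : G.F.p l = G₂.F.p () := by
  simp only [DiagFamily.F]
  rw [H.V_eq, Finset.prod_map]
  exact Finset.prod_congr rfl fun k _ => by rw [Fin.coe_succEmb, H.E_succ]

lemma q_eq (H : Degenerates G G₂ 𝓕) (l : Λ) : G.F.q l = (G.E l 0)⁻¹ * G₂.F.q () := by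
  simp only [DiagFamily.F]
  have e : ∀ {n : ℕ} (V : Finset (Fin n)) (g : Fin n → ℝ),
      ∏ k ∈ Vᶜ, g k = ∏ k, if k ∈ V then 1 else g k := fun V g => by
    rw [Finset.prod_ite, Finset.prod_const_one, one_mul]
    congr 1
    ext k
    simp
  rw [e, e, Fin.prod_univ_succ, if_neg H.zero_notMem_V,
    abs_of_pos (inv_pos.2 (by linarith [H.one_le l]))]
  simp only [H.succ_mem_V, H.E_succ]

lemma card_V (H : Degenerates G G₂ 𝓕) : G.V.card = G₂.V.card := by
  rw [H.V_eq, Finset.card_map]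

lemma card_compl_V (H : Degenerates G G₂ 𝓕) : G.Vᶜ.card = G₂.Vᶜ.card + 1 := by
  have h := Finset.card_le_univ G₂.V
  rw [Fintype.card_fin] at h
  rw [Finset.card_compl, Finset.card_compl, H.card_V, Fintype.card_fin, Fintype.card_fin]
  omega

/-- The normalization q contains the inverse of the first entry of E, so the determinant of the
lower block is the limit and the rest carries that vanishing inverse. -/
lemma q_mul_det (H : Degenerates G G₂ 𝓕) (l : Λ) (c : Coord (m + 1)) :
    G.F.q l * (symMat c + G.F.B l).det = G₂.F.q () *
      ((G.E l 0)⁻¹ * (blockSym (c s(0, 0)) (fun j => c s(0, j.succ))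
        (symMat (lowerBlock c) + G₂.F.B ())).det + (symMat (lowerBlock c) + G₂.F.B ()).det) := by
  have h0 : G.E l 0 ≠ 0 := G.E_ne_zero l 0
  rw [H.q_eq, H.symMat_add_B, blockSym_eq, det_blockMat_add, blockSym_eq]
  field_simp

lemma tendsto_q_mul_det (H : Degenerates G G₂ 𝓕) (c : Coord (m + 1)) :
    Tendsto (fun l => G.F.q l * (symMat c + G.F.B l).det) 𝓕
      (𝓝 (G₂.F.q () * (symMat (lowerBlock c) + G₂.F.B ()).det)) := by
  simp only [H.q_mul_det]
  have := ((H.tendsto_E.inv_tendsto_atTop).mul_const ((blockSym (c s(0, 0))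
    (fun j => c s(0, j.succ)) (symMat (lowerBlock c) + G₂.F.B ())).det)).add_const
      (symMat (lowerBlock c) + G₂.F.B ()).det
  rw [zero_mul, zero_add] at this
  exact this.const_mul _

lemma exists_q_mul_det_le (H : Degenerates G G₂ 𝓕) : ∃ K : ℝ, ∃ M : ℕ, 0 ≤ K ∧
    ∀ c : Coord (m + 1), (∀ l, G.F.q l * (symMat c + G.F.B l).det ≤ K * csize c ^ M) ∧
      G₂.F.q () * (symMat (lowerBlock c) + G₂.F.B ()).det ≤ K * csize c ^ M := by
  have h1 : PolyBdd (Set.univ : Set (Coord (m + 1))) fun c =>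
      ((blockSym (c s(0, 0)) (fun j => c s(0, j.succ))
        (symMat (lowerBlock c) + G₂.F.B ())).det : ℂ) := by
    have e : ∀ c : Coord (m + 1), blockSym (c s(0, 0)) (fun j => c s(0, j.succ))
        (symMat (lowerBlock c) + G₂.F.B ()) = symMat c + blockMat 0 0 0 (G₂.F.B ()) := fun c => by
      rw [symMat_eq_blockSym, blockSym_eq, blockSym_eq, blockMat_add]
      simp
    simp only [e]
    exact PolyBdd.det fun i j => PolyBdd.symMat_add _ i j
  have h2 : PolyBdd (Set.univ : Set (Coord m)) fun c => ((symMat c + G₂.F.B ()).det : ℂ) :=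
    PolyBdd.det fun i j => PolyBdd.symMat_add _ i j
  obtain ⟨C₁, N₁, hC₁, b1⟩ := h1.exists_bound
  obtain ⟨C₂, N₂, hC₂, b2⟩ := h2.exists_bound
  have hq := G₂.F.hq ()
  refine ⟨G₂.F.q () * (C₁ + C₂), max N₁ N₂, by positivity, fun c => ?_⟩
  have hc1 := one_le_csize c
  have hcp := csize_pos c
  have g1 := b1 c trivial
  have g2 := b2 (lowerBlock c) trivial
  rw [Complex.norm_real, Real.norm_eq_abs] at g1 g2
  have g1' := g1.trans (mul_le_mul_of_nonneg_left
    (pow_le_pow_right₀ hc1 (le_max_left N₁ N₂)) hC₁)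
  have g2' := g2.trans (mul_le_mul_of_nonneg_left ((pow_le_pow_left₀ (csize_pos _).le
    (csize_lowerBlock_le c) N₂).trans (pow_le_pow_right₀ hc1 (le_max_right N₁ N₂))) hC₂)
  have hpow : 0 ≤ C₁ * csize c ^ max N₁ N₂ := by positivity
  constructor
  · intro l
    have hE : |(G.E l 0)⁻¹| ≤ 1 := by
      rw [abs_of_pos (inv_pos.2 (by linarith [H.one_le l]))]
      exact inv_le_one_of_one_le₀ (H.one_le l)
    rw [H.q_mul_det, mul_assoc]
    refine mul_le_mul_of_nonneg_left ?_ hq.le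
    rw [add_mul]
    refine add_le_add ((le_abs_self _).trans ?_) ((le_abs_self _).trans g2')
    rw [abs_mul]
    exact (mul_le_of_le_one_left (abs_nonneg _) hE).trans g1'
  · rw [mul_assoc]
    refine mul_le_mul_of_nonneg_left ?_ hq.le
    rw [add_mul]
    linarith [le_abs_self (symMat (lowerBlock c) + G₂.F.B ()).det]

/-- The generators converge because E enters only through its inverse. A minor that is eventually at
least 1 has a nonzero limit, so the inverses of the minors converge too. -/
lemma exists_weight_limit [𝓕.NeBot] (H : Degenerates G G₂ 𝓕) {f : Λ → Coord (m + 1) → ℂ}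
    (hf : f ∈ G.alg) :
    ∃ g : Coord (m + 1) → ℂ, ∀ c ∈ limD G₂, Tendsto (fun l => f l c) 𝓕 (𝓝 (g c)) := by
  have key : ∀ s : Set (Λ → Coord (m + 1) → ℂ), (∀ f ∈ s, ∃ g : Coord (m + 1) → ℂ,
      ∀ c ∈ limD G₂, Tendsto (fun l => f l c) 𝓕 (𝓝 (g c))) → ∀ f ∈ Algebra.adjoin ℂ s,
      ∃ g : Coord (m + 1) → ℂ, ∀ c ∈ limD G₂, Tendsto (fun l => f l c) 𝓕 (𝓝 (g c)) := by
    intro s hs f hf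
    induction hf using Algebra.adjoin_induction with
    | mem f hf => exact hs f hf
    | algebraMap r => exact ⟨fun _ => r, fun c _ => tendsto_const_nhds⟩
    | add f g _ _ hf hg =>
      obtain ⟨f', hf⟩ := hf
      obtain ⟨g', hg⟩ := hg
      exact ⟨f' + g', fun c hc => (hf c hc).add (hg c hc)⟩
    | mul f g _ _ hf hg =>
      obtain ⟨f', hf⟩ := hf
      obtain ⟨g', hg⟩ := hg
      exact ⟨f' * g', fun c hc => (hf c hc).mul (hg c hc)⟩
  have hpoly : ∀ f ∈ G.polyGen, ∃ g : Coord (m + 1) → ℂ,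
      ∀ c ∈ limD G₂, Tendsto (fun l => f l c) 𝓕 (𝓝 (g c)) := by
    rintro f ((⟨e, rfl⟩ | ⟨ij, rfl⟩) | ⟨k, rfl⟩)
    · exact ⟨fun c => c e, fun c _ => tendsto_const_nhds⟩
    · exact ⟨fun c => (blockSym 1 0 (G₂.y ()) ij.1 ij.2 : ℝ), fun c _ =>
        (Complex.continuous_ofReal.tendsto _).comp (H.tendsto_y ij.1 ij.2)⟩
    · refine Fin.cases ?_ (fun k => ?_) k
      · exact ⟨fun c => (0 : ℝ), fun c _ =>
          (Complex.continuous_ofReal.tendsto _).comp H.tendsto_E.inv_tendsto_atTop⟩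
      · refine ⟨fun c => (((G₂.E () k)⁻¹ : ℝ) : ℂ), fun c _ => ?_⟩
        simp only [H.E_succ]
        exact tendsto_const_nhds
  have inv : ∀ M : Λ → Coord (m + 1) → ℝ,
      (fun l c => (M l c : ℂ)) ∈ Algebra.adjoin ℂ G.polyGen →
      (∀ l, ∀ c ∈ G.F.D l, 1 ≤ M l c) → ∃ g : Coord (m + 1) → ℂ,
      ∀ c ∈ limD G₂, Tendsto (fun l => (((M l c)⁻¹ : ℝ) : ℂ)) 𝓕 (𝓝 (g c)) := by
    intro M hM h1
    obtain ⟨g, hg⟩ := key _ hpoly _ hM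
    refine ⟨fun c => (g c)⁻¹, fun c hc => ?_⟩
    have h2 : 1 ≤ ‖g c‖ := by
      refine ge_of_tendsto (hg c hc).norm ?_
      filter_upwards [H.eventually_mem_D hc] with l hl
      rw [Complex.norm_real]
      exact (h1 l c hl).trans (le_abs_self _)
    have h3 : g c ≠ 0 := fun h0 => by
      rw [h0, norm_zero] at h2
      linarith
    simpa using (hg c hc).inv₀ h3
  refine key _ ?_ f hf
  rintro f (hf | rfl | rfl)
  · exact hpoly f hf
  · exact inv _ G.minorA_mem fun l c hc => G.one_le_minorA hc
  · exact inv _ G.minorB_mem fun l c hc => G.one_le_minorB hc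

/-- The limit of the integrals. -/
noncomputable def limJ (G₂ : DiagFamily Unit m) (g : Coord (m + 1) → ℂ) (a b : ℂ) : ℂ :=
  ∫ c in limD G₂, g c * limK G₂ a b c

/-- Uniformity has three sources: `exists_trace_bound` tolerates small changes of y, p is constant
along the family, and q det(u + B) has a polynomial bound independent of the parameter. -/
lemma exists_dominating (H : Degenerates G G₂ 𝓕) {a b : ℂ} (ha : 0 ≤ a.re) (hb : 0 ≤ b.re)
    (C : ℝ) (N : ℕ) (hC : 0 ≤ C) : ∃ φ : Coord (m + 1) → ℝ, Integrable φ ∧ (∀ c, 0 ≤ φ c) ∧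
      (∀ c ∈ limD G₂, C * csize c ^ N * ‖limK G₂ a b c‖ ≤ φ c) ∧
      ∀ᶠ l in 𝓕, ∀ c ∈ G.F.D l, C * csize c ^ N * ‖G.F.k l a b c‖ ≤ φ c := by
  obtain ⟨δ, hδ, η, hη, C₀, h0⟩ := exists_trace_bound (posDef_lim (G₂ := G₂)) (A := 0)
  obtain ⟨K, M, hK, h1⟩ := H.exists_q_mul_det_le
  obtain ⟨C₃, N₃, hC₃, h3⟩ := exists_det_rpow_bound (0 : Matrix (Fin (m + 1)) (Fin (m + 1)) ℝ)
    (G₂.F.p ()) hb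
  obtain ⟨k, hk⟩ := exists_nat_ge a.re
  refine ⟨fun c => (C * Real.exp C₀ * (K + 1) ^ k * C₃) *
    (csize c ^ (N + M * k + N₃) * Real.exp (-δ * csize c)),
    (integrable_csize_pow_mul_exp hδ _).const_mul _, fun c => ?_, fun c hc => ?_, ?_⟩
  · have := csize_pos c
    positivity
  · have hcs := csize_pos c
    have e1 := h0 (blockSym 1 0 (G₂.y ())) (fun i j => by simpa using hη.le) c (by simpa using hc.1.posSemidef)
    rw [norm_limK hc]
    have e2 := rpow_le_of_le_csize ha hk (mul_pos (G₂.F.hq ()) hc.2.2.det_pos) (h1 c).2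
    have e3 := h3 c (by simpa using mul_pos (G₂.F.hp ()) hc.1.det_pos)
    rw [add_zero] at e3
    have e4 := Real.exp_le_exp.2 e1
    rw [sub_eq_add_neg, Real.exp_add, ← neg_mul] at e4
    have hp := G₂.F.hp ()
    have hq := G₂.F.hq ()
    have hd1 := hc.1.det_pos
    have hd2 := hc.2.2.det_pos
    calc _ ≤ C * csize c ^ N * ((Real.exp C₀ * Real.exp (-δ * csize c)) *
          ((K + 1) ^ k * csize c ^ (M * k)) * (C₃ * csize c ^ N₃)) := by gcongr
      _ = _ := by beta_reduce; rw [pow_add, pow_add]; ring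
  · have hev : ∀ᶠ l in 𝓕, ∀ i j, |G.y l i j - blockSym 1 0 (G₂.y ()) i j| ≤ η := by
      refine eventually_all.2 fun i => eventually_all.2 fun j => ?_
      have := (H.tendsto_y i j).eventually (Metric.ball_mem_nhds _ hη)
      filter_upwards [this] with l hl
      exact (le_of_lt hl : dist _ _ ≤ η)
    filter_upwards [hev] with l hl c hc
    have hcs := csize_pos c
    have hc' := H.D_subset l hc
    have e1 := h0 _ hl c (by simpa using hc'.1.posSemidef)
    unfold ConeFamily.k
    rw [norm_kern (G.F.hp l) (G.F.hq l) hc]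
    have e2 := rpow_le_of_le_csize ha hk (mul_pos (G.F.hq l) hc.2.det_pos) ((h1 c).1 l)
    have e3 := h3 c (by simpa using mul_pos (G₂.F.hp ()) hc'.1.det_pos)
    have e4 := Real.exp_le_exp.2 e1
    rw [sub_eq_add_neg, Real.exp_add, ← neg_mul] at e4
    have hA : G.F.A l = 0 := rfl
    have hy : G.F.y l = G.y l := rfl
    rw [H.p_eq, hA, hy]
    have hp := G₂.F.hp ()
    have hq := G.F.hq l
    have hd1 : 0 < (symMat c + 0).det := hc.1.det_pos
    have hd2 := hc.2.det_pos
    calc _ ≤ C * csize c ^ N * ((Real.exp C₀ * Real.exp (-δ * csize c)) *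
          ((K + 1) ^ k * csize c ^ (M * k)) * (C₃ * csize c ^ N₃)) := by gcongr
      _ = _ := by rw [pow_add, pow_add]; ring

end Degenerates

end Confluent

namespace Confluent
namespace Degenerates
variable {Λ : Type} {m : ℕ} {G : DiagFamily Λ (m + 1)} {G₂ : DiagFamily Unit m} {𝓕 : Filter Λ}

lemma exists_bound (H : Degenerates G G₂ 𝓕) {f : Λ → Coord (m + 1) → ℂ} (hf : f ∈ G.alg) :
    ∃ C : ℝ, ∃ N : ℕ, 0 ≤ C ∧ ∀ l, ∀ c ∈ G.F.D l, ‖f l c‖ ≤ C * csize c ^ N := by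
  have := G.exists_uniform_bound (w := fun _ => 1) (fun _ => le_rfl)
    (fun i j => by simpa using H.bdd_y i j) (fun k => ?_) hf
  · simpa using this
  · refine Fin.cases ⟨1, fun l => ?_⟩ (fun k => ⟨|(G₂.E () k)⁻¹|, fun l => ?_⟩) k
    · rw [abs_of_pos (inv_pos.2 (by linarith [H.one_le l]))]
      exact inv_le_one_of_one_le₀ (H.one_le l)
    · rw [H.E_succ]

lemma tendsto_k (H : Degenerates G G₂ 𝓕) (a b : ℂ) {c : Coord (m + 1)} (hc : c ∈ limD G₂) :
    Tendsto (fun l => G.F.k l a b c) 𝓕 (𝓝 (limK G₂ a b c)) := by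
  unfold ConeFamily.k kern limK
  have hA : ∀ l, G.F.A l = 0 := fun l => rfl
  have hy : ∀ l, G.F.y l = G.y l := fun l => rfl
  simp only [H.p_eq, hA, hy, add_zero]
  have hY : Tendsto G.y 𝓕 (𝓝 (blockSym 1 0 (G₂.y ()))) :=
    tendsto_pi_nhds.2 fun i => tendsto_pi_nhds.2 fun j => H.tendsto_y i j
  refine Tendsto.mul (Tendsto.mul ?_ ?_) tendsto_const_nhds
  · have : Continuous fun y : Matrix (Fin (m + 1)) (Fin (m + 1)) ℝ =>
        ((Real.exp (-(symMat c * y).trace) : ℝ) : ℂ) :=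
      Complex.continuous_ofReal.comp (Real.continuous_exp.comp
        ((continuous_const.matrix_mul continuous_id).matrix_trace).neg)
    exact (this.tendsto _).comp hY
  · have h := mul_pos (G₂.F.hq ()) hc.2.2.det_pos
    exact ((Complex.continuous_ofReal.tendsto _).comp (H.tendsto_q_mul_det c)).cpow
      tendsto_const_nhds (Or.inl (by simpa using h))

lemma tendsto_indicator (H : Degenerates G G₂ 𝓕) {f : Λ → Coord (m + 1) → ℂ}
    {g : Coord (m + 1) → ℂ} (hg : ∀ c ∈ limD G₂, Tendsto (fun l => f l c) 𝓕 (𝓝 (g c)))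
    (c : Coord (m + 1)) :
    Tendsto (fun l => (G.F.D l).indicator (f l) c) 𝓕 (𝓝 ((limD G₂).indicator g c)) := by
  by_cases hc : c ∈ limD G₂
  · rw [Set.indicator_of_mem hc]
    refine (hg c hc).congr' ?_
    filter_upwards [H.eventually_mem_D hc] with l hl
    rw [Set.indicator_of_mem hl]
  · rw [Set.indicator_of_notMem hc]
    refine tendsto_const_nhds.congr fun l => ?_
    rw [Set.indicator_of_notMem fun h => hc (H.D_subset l h)]

/-- Dominated convergence for the integrands extended by zero; both the cones and the kernels vary
with the parameter. -/
lemma tendsto_J [𝓕.NeBot] [𝓕.IsCountablyGenerated] (H : Degenerates G G₂ 𝓕)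
    {f : Λ → Coord (m + 1) → ℂ} (hf : f ∈ G.alg) {g : Coord (m + 1) → ℂ}
    (hg : ∀ c ∈ limD G₂, Tendsto (fun l => f l c) 𝓕 (𝓝 (g c))) {a b : ℂ} (ha : 0 ≤ a.re)
    (hb : 0 ≤ b.re) : Tendsto (fun l => G.F.J f l a b) 𝓕 (𝓝 (limJ G₂ g a b)) := by
  obtain ⟨C, N, hC, hbd⟩ := H.exists_bound hf
  obtain ⟨φ, hφ, hφ0, -, hφk⟩ := H.exists_dominating ha hb C N hC
  have e1 : ∀ l, G.F.J f l a b =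
      ∫ c, (G.F.D l).indicator (fun c => f l c * G.F.k l a b c) c := fun l =>
    (integral_indicator (G.F.measurableSet_D l)).symm
  have e2 : limJ G₂ g a b = ∫ c, (limD G₂).indicator (fun c => g c * limK G₂ a b c) c :=
    (integral_indicator isOpen_limD.measurableSet).symm
  simp only [e1, e2]
  refine tendsto_integral_filter_of_dominated_convergence φ (Eventually.of_forall fun l => ?_) ?_ hφ
    (Eventually.of_forall fun c => ?_)
  · exact ((integrable_indicator_iff (G.F.measurableSet_D l)).2
      (G.admissible.integrableOn hf l ha hb)).aestronglyMeasurable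
  · filter_upwards [hφk] with l hl
    refine Eventually.of_forall fun c => ?_
    by_cases hc : c ∈ G.F.D l
    · rw [Set.indicator_of_mem hc, norm_mul]
      exact (mul_le_mul_of_nonneg_right (hbd l c hc) (norm_nonneg _)).trans (hl c hc)
    · rw [Set.indicator_of_notMem hc, norm_zero]
      exact hφ0 c
  · exact H.tendsto_indicator (f := fun l c => f l c * G.F.k l a b c)
      (fun c hc => (hg c hc).mul (H.tendsto_k a b hc)) c

lemma limK_eq_exp {c : Coord (m + 1)} (hc : c ∈ limD G₂) (a b : ℂ) :
    limK G₂ a b c = (Real.exp (-(symMat c * blockSym 1 0 (G₂.y ())).trace) : ℂ) *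
      (Complex.exp (a * (Real.log (G₂.F.q () * (symMat (lowerBlock c) + G₂.F.B ()).det) : ℝ)) *
        Complex.exp (b * (Real.log (G₂.F.p () * (symMat c).det) : ℝ))) := by
  have h1 := mul_pos (G₂.F.hq ()) hc.2.2.det_pos
  have h2 := mul_pos (G₂.F.hp ()) hc.1.det_pos
  unfold limK
  rw [Complex.cpow_def_of_ne_zero (by exact_mod_cast h1.ne'),
    Complex.cpow_def_of_ne_zero (by exact_mod_cast h2.ne'), Complex.ofReal_log h1.le,
    Complex.ofReal_log h2.le, mul_assoc, mul_comm a, mul_comm b]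

/-- The limit weight is measurable as a pointwise limit and inherits the uniform polynomial bound,
so the limit integral is again an absolutely convergent Laplace transform. -/
lemma differentiableOn_limJ [𝓕.NeBot] [𝓕.IsCountablyGenerated] (H : Degenerates G G₂ 𝓕)
    {f : Λ → Coord (m + 1) → ℂ} (hf : f ∈ G.alg) {g : Coord (m + 1) → ℂ}
    (hg : ∀ c ∈ limD G₂, Tendsto (fun l => f l c) 𝓕 (𝓝 (g c))) :
    DifferentiableOn ℂ (fun z : ℂ × ℂ => limJ G₂ g z.1 z.2) {z | 0 < z.1.re ∧ 0 < z.2.re} := by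
  have hm := (isOpen_limD (G₂ := G₂)).measurableSet
  obtain ⟨C, N, hC, hbd⟩ := H.exists_bound hf
  have hgm : AEStronglyMeasurable g (volume.restrict (limD G₂)) := by
    rw [← aestronglyMeasurable_indicator_iff hm]
    refine aestronglyMeasurable_of_tendsto_ae 𝓕 (fun l => ?_)
      (Eventually.of_forall (H.tendsto_indicator hg))
    rw [aestronglyMeasurable_indicator_iff (G.F.measurableSet_D l)]
    exact (G.admissible.polyBdd f hf l).1.aestronglyMeasurable (G.F.measurableSet_D l)
  have hgb : ∀ c ∈ limD G₂, ‖g c‖ ≤ C * csize c ^ N := fun c hc => by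
    refine le_of_tendsto (hg c hc).norm ?_
    filter_upwards [H.eventually_mem_D hc] with l hl
    exact hbd l c hl
  have e : (fun z : ℂ × ℂ => limJ G₂ g z.1 z.2) = fun z : ℂ × ℂ => ∫ c in limD G₂,
      (g c * (Real.exp (-(symMat c * blockSym 1 0 (G₂.y ())).trace) : ℂ)) *
      (Complex.exp (z.1 * (Real.log (G₂.F.q () * (symMat (lowerBlock c) + G₂.F.B ()).det) : ℝ)) *
        Complex.exp (z.2 * (Real.log (G₂.F.p () * (symMat c).det) : ℝ))) := by
    ext z
    refine setIntegral_congr_fun hm fun c hc => ?_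
    rw [limK_eq_exp hc, mul_assoc]
  rw [e]
  refine differentiableOn_integral_exp ?_ ?_ ?_ fun a b ha hb => ?_
  · refine hgm.mul (Continuous.aestronglyMeasurable ?_)
    exact Complex.continuous_ofReal.comp (Real.continuous_exp.comp continuous_trace_symMat.neg)
  · exact (Real.measurable_log.comp (((continuous_det_symMat _).comp
      continuous_lowerBlock).measurable.const_mul _)).aemeasurable
  · exact (Real.measurable_log.comp
      (continuous_symMat.matrix_det.measurable.const_mul _)).aemeasurable
  · obtain ⟨φ, hφ, -, hφk, -⟩ := H.exists_dominating (a := a) (b := b) (by simpa using ha.le)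
      (by simpa using hb.le) C N hC
    have hK : AEStronglyMeasurable (fun c => g c * limK G₂ a b c)
        (volume.restrict (limD G₂)) :=
      hgm.mul ((continuousOn_limK _ _).aestronglyMeasurable hm)
    have hI : Integrable (fun c => g c * limK G₂ a b c) (volume.restrict (limD G₂)) := by
      refine hφ.integrableOn.mono' hK ((ae_restrict_iff' hm).2 (Eventually.of_forall
        fun c hc => ?_))
      rw [norm_mul]
      exact (mul_le_mul_of_nonneg_right (hgb c hc) (norm_nonneg _)).trans (hφk c hc)
    refine hI.norm.congr ((ae_restrict_iff' hm).2 (Eventually.of_forall fun c hc => ?_))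
    beta_reduce
    rw [limK_eq_exp hc]
    simp [Complex.norm_exp, mul_assoc]

/-- The continued integrals converge to a holomorphic function of the exponents. -/
lemma exists_tendsto_cont [𝓕.NeBot] [𝓕.IsCountablyGenerated] (H : Degenerates G G₂ 𝓕) (N : ℕ) :
    ∃ Ψ : ℂ × ℂ → ℂ, DifferentiableOn ℂ Ψ
        {z | z ∈ goodSet G.Vᶜ.card G.V.card ∧ -(N : ℝ) < z.1.re ∧ -(N : ℝ) < z.2.re} ∧
      ∀ z ∈ goodSet G.Vᶜ.card G.V.card, -(N : ℝ) < z.1.re → -(N : ℝ) < z.2.re →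
        Tendsto (fun l => G.cont l z) 𝓕 (𝓝 (Ψ z)) := by
  obtain ⟨ι, _, r, f, hr, hf, h⟩ := G.rep_shift N 1 (one_mem _)
  choose g hg using fun i => H.exists_weight_limit (hf i)
  -- The coefficients do not depend on the parameter, so only the convergent weighted integrals pass
  -- to the limit.
  refine ⟨fun z => ∑ i, r i z * limJ G₂ (g i) (z.1 + N) (z.2 + N), ?_, fun z hz h1 h2 => ?_⟩
  · refine DifferentiableOn.fun_sum fun i _ => ?_
    refine ((hr i).mono fun z hz => hz.1).mul ?_
    refine (H.differentiableOn_limJ (hf i) (hg i)).comp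
      (g := fun z : ℂ × ℂ => limJ G₂ (g i) z.1 z.2) (f := fun z : ℂ × ℂ => (z.1 + N, z.2 + N))
      ?_ ?_
    · exact (Differentiable.prodMk (by fun_prop) (by fun_prop)).differentiableOn
    · rintro z ⟨-, h1, h2⟩
      exact ⟨by simp; linarith, by simp; linarith⟩
  · have e : ∀ l, G.cont l z = ∑ i, r i z * G.F.J (f i) l (z.1 + N) (z.2 + N) := fun l =>
      G.cont_eq_of_eq_large l (G.differentiableOn_sum_J hr hf N l) (L := 2 * (m + 1 : ℕ) + 2)
        (fun w h1 h2 => (h l w.1 w.2 h1.le h2.le).symm) hz h1 h2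
    simp only [e]
    refine tendsto_finsetSum _ fun i _ => ?_
    exact (H.tendsto_J (hf i) (hg i) (by simp; linarith) (by simp; linarith)).const_mul _

end Degenerates
end Confluent

/-! ### Gaussian integrals and integration over the first row -/

namespace Confluent

section Gaussian
variable {m : ℕ}

lemma integral_comp_mulVec {A : Matrix (Fin m) (Fin m) ℝ} (hA : A.det ≠ 0)
    (g : (Fin m → ℝ) → ℝ) : ∫ r, g (A *ᵥ r) = |A.det|⁻¹ * ∫ r, g r := by
  have hemb : MeasurableEmbedding (toLin' A) :=
    ((LinearEquiv.ofIsUnitDet (f := toLin' A) (v := Pi.basisFun ℝ _) (v' := Pi.basisFun ℝ _) (by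
      rw [LinearMap.det_toMatrix, LinearMap.det_toLin']
      exact hA.isUnit)).toContinuousLinearEquiv.toHomeomorph).measurableEmbedding
  have h := hemb.integral_map (μ := volume) g
  rw [Real.map_matrix_volume_pi_eq_smul_volume_pi hA, integral_smul_measure,
    ENNReal.toReal_ofReal (abs_nonneg _), abs_inv, smul_eq_mul] at h
  rw [h]
  rfl

/-- The Gaussian integral of a positive definite quadratic form. -/
lemma integral_exp_neg_quadratic {M : Matrix (Fin m) (Fin m) ℝ} (hM : M.PosDef) :
    ∫ r : Fin m → ℝ, Real.exp (-(r ⬝ᵥ M *ᵥ r)) = √(Real.pi ^ m / M.det) := by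
  have hs : M.IsSymm := by simpa [IsHermitian, IsSymm] using hM.1
  obtain ⟨h, e, hh, -, rfl⟩ := exists_diagonalization hs hM.det_pos.ne'
  have he : ∀ i, 0 < e i := by
    rw [DiagFamily.posDef_conj_iff hh, posDef_diagonal_iff] at hM
    exact hM
  have e1 : ∀ r : Fin m → ℝ, r ⬝ᵥ (h * diagonal e * hᵀ) *ᵥ r = ∑ i, e i * (hᵀ *ᵥ r) i ^ 2 := by
    intro r
    rw [← mulVec_mulVec, ← mulVec_mulVec, dotProduct_mulVec, ← mulVec_transpose, dotProduct]
    exact Finset.sum_congr rfl fun i _ => by rw [mulVec_diagonal]; ring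
  simp only [e1]
  rw [integral_comp_mulVec (A := hᵀ) (by rwa [det_transpose])
    (fun r => Real.exp (-∑ i, e i * r i ^ 2))]
  simp only [← Finset.sum_neg_distrib, Real.exp_sum, ← neg_mul]
  rw [integral_fintype_prod_volume_eq_prod (fun i x => Real.exp (-e i * x ^ 2))]
  simp only [integral_gaussian]
  rw [det_transpose, det_mul, det_mul, det_diagonal, det_transpose,
    ← Real.sqrt_prod _ fun i _ => (div_pos Real.pi_pos (he i)).le, Finset.prod_div_distrib,
    Finset.prod_const, Finset.card_univ, Fintype.card_fin]
  have hpos : 0 < ∏ i, e i := Finset.prod_pos fun i _ => he i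
  rw [show h.det * (∏ i, e i) * h.det = h.det ^ 2 * ∏ i, e i by ring, mul_comm (h.det ^ 2),
    ← div_div, Real.sqrt_div (div_nonneg (by positivity) hpos.le), Real.sqrt_sq_eq_abs]
  ring

end Gaussian

section Coordinates
variable {m : ℕ}

/-- An unordered pair either avoids 0, and then comes from the lower block, or contains 0, and then
lies in the first row. -/
lemma bijective_rowIndex : Function.Bijective
    (Sum.elim (fun z : Sym2 (Fin m) => z.map Fin.succ) (fun i : Fin (m + 1) => s(0, i))) := by
  constructor
  · have h1 : ∀ (z : Sym2 (Fin m)) (i : Fin (m + 1)), z.map Fin.succ ≠ s(0, i) := by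
      intro z i h
      have : (0 : Fin (m + 1)) ∈ z.map Fin.succ := by rw [h]; simp
      obtain ⟨a, -, ha⟩ := Sym2.mem_map.1 this
      exact Fin.succ_ne_zero a ha
    rintro (z | i) (w | j) h
    · exact congrArg Sum.inl (Sym2.map.injective (Fin.succ_injective m) h)
    · exact (h1 z j h).elim
    · exact (h1 w i h.symm).elim
    · have : i = j ∨ 0 = j ∧ i = 0 := by simpa using h
      have : i = j := this.elim id fun h => h.2.trans h.1
      rw [this]
  · intro z
    induction z using Sym2.ind with
    | _ i j =>
      refine Fin.cases ⟨Sum.inr j, rfl⟩ (fun i => ?_) i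
      refine Fin.cases ⟨Sum.inr i.succ, Sym2.eq_swap⟩ (fun j => ⟨Sum.inl s(i, j), rfl⟩) j

/-- The lower right block and the first row. -/
noncomputable def splitRow : Coord (m + 1) ≃ᵐ Coord m × (Fin (m + 1) → ℝ) :=
  (MeasurableEquiv.piCongrLeft (fun _ => ℝ) (Equiv.ofBijective _ bijective_rowIndex)).symm.trans
    (MeasurableEquiv.sumPiEquivProdPi fun _ => ℝ)

lemma splitRow_apply (c : Coord (m + 1)) :
    splitRow c = (lowerBlock c, fun i => c s(0, i)) := rfl

lemma measurePreserving_splitRow : MeasurePreserving (splitRow (m := m)) :=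
  (volume_measurePreserving_piCongrLeft (fun _ => ℝ) (Equiv.ofBijective _ bijective_rowIndex)).symm.trans
    (volume_measurePreserving_sumPiEquivProdPi fun _ => ℝ)

/-- The inner integral over the first row. -/
lemma integral_row {d : Matrix (Fin m) (Fin m) ℝ} (hd : d.PosDef) {κ : ℝ} (hκ : 0 < κ) {b : ℂ}
    (hb : -1 < b.re) :
    ∫ w : Fin (m + 1) → ℝ, (if vecTail w ⬝ᵥ d⁻¹ *ᵥ vecTail w < w 0 then
      (Real.exp (-w 0) : ℂ) * ((κ * (w 0 - vecTail w ⬝ᵥ d⁻¹ *ᵥ vecTail w) : ℝ) : ℂ) ^ b else 0) =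
    (√(Real.pi ^ m * d.det) : ℝ) * (Complex.Gamma (b + 1) * (κ : ℂ) ^ b) := by
  set φ : (Fin m → ℝ) → ℝ := fun r => r ⬝ᵥ d⁻¹ *ᵥ r with hφ
  have hφc : Continuous φ := continuous_id.dotProduct (continuous_const.matrix_mulVec continuous_id)
  set g : (Fin m → ℝ) × ℝ → ℂ := fun z => if φ z.1 < z.2 then
    (Real.exp (-z.2) : ℂ) * ((κ * (z.2 - φ z.1) : ℝ) : ℂ) ^ b else 0 with hg
  have e1 := (volume_preserving_piFinSuccAbove (fun _ : Fin (m + 1) => ℝ) 0).integral_comp'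
    (fun z => g z.swap)
  have e2 : ∫ z : ℝ × (Fin m → ℝ), g z.swap = ∫ z, g z := integral_prod_swap g
  rw [e2] at e1
  refine Eq.trans ?_ (e1.trans ?_)
  · rfl
  -- The shear w₀ = φ(r) + t preserves the measure and separates the variables: a Gaussian integral
  -- in r and a Gamma integral in t > 0.
  have hS : MeasurePreserving (fun z : (Fin m → ℝ) × ℝ => (z.1, φ z.1 + z.2)) := by
    refine (MeasurePreserving.id volume).skew_product (μc := volume) (μd := volume)
      (g := fun r t => φ r + t) ?_ ?_
    · exact ((hφc.comp continuous_fst).add continuous_snd).measurable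
    · exact Eventually.of_forall fun r => map_add_left_eq_self volume (φ r)
  have hSe : MeasurableEmbedding (fun z : (Fin m → ℝ) × ℝ => (z.1, φ z.1 + z.2)) := by
    refine (Homeomorph.measurableEmbedding
      { toFun := fun z => (z.1, φ z.1 + z.2)
        invFun := fun z => (z.1, -φ z.1 + z.2)
        left_inv := fun z => by simp
        right_inv := fun z => by simp
        continuous_toFun := by fun_prop
        continuous_invFun := by fun_prop } : _)
  rw [← hS.integral_comp hSe]
  have e3 : ∀ z : (Fin m → ℝ) × ℝ, g (z.1, φ z.1 + z.2) = ((Real.exp (-φ z.1) : ℝ) : ℂ) *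
      (Set.Ioi (0 : ℝ)).indicator (fun t => (Real.exp (-t) : ℂ) * ((κ * t : ℝ) : ℂ) ^ b) z.2 := by
    intro z
    by_cases hz : 0 < z.2
    · rw [Set.indicator_of_mem (show z.2 ∈ Set.Ioi 0 from hz)]
      simp only [hg, lt_add_iff_pos_right, hz, if_true, add_sub_cancel_left, neg_add, Real.exp_add]
      push_cast
      ring
    · rw [Set.indicator_of_notMem (show z.2 ∉ Set.Ioi 0 from hz)]
      simp [hg, hz]
  simp only [e3]
  rw [Measure.volume_eq_prod, integral_prod_mul (fun r => ((Real.exp (-φ r) : ℝ) : ℂ)),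
    integral_indicator measurableSet_Ioi, integral_complex_ofReal]
  congr 1
  · rw [integral_exp_neg_quadratic hd.inv, det_nonsing_inv, Ring.inverse_eq_inv', div_inv_eq_mul]
  · rw [Complex.Gamma_eq_integral (by simpa using by linarith), Complex.GammaIntegral,
      ← integral_mul_const]
    refine setIntegral_congr_fun measurableSet_Ioi fun t ht => ?_
    have ht' : (0 : ℝ) < t := ht
    rw [Complex.ofReal_mul, Complex.mul_cpow_ofReal_nonneg hκ.le ht'.le, add_sub_cancel_right]
    ring

end Coordinates

namespace Degenerates
variable {m : ℕ} {G₂ : DiagFamily Unit m}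

/-- Integrating out the first row. -/
lemma limJ_one {a b : ℂ} (hb : -1 < b.re) (hint : IntegrableOn (limK G₂ a b) (limD G₂)) :
    limJ G₂ 1 a b = Complex.Gamma (b + 1) * (√(Real.pi ^ m / G₂.F.p ()) : ℝ) *
      G₂.F.J 1 () a (b + 1 / 2) := by
  have hp := G₂.F.hp ()
  have hD := G₂.F.measurableSet_D ()
  have hm := (isOpen_limD (G₂ := G₂)).measurableSet
  set K₂ : Coord m → ℂ := fun d => (Real.exp (-(symMat d * G₂.y ()).trace) : ℂ) *
    ((G₂.F.q () * (symMat d + G₂.F.B ()).det : ℝ) : ℂ) ^ a with hK₂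
  set R : Coord m → (Fin (m + 1) → ℝ) → ℂ := fun d w =>
    if vecTail w ⬝ᵥ (symMat d)⁻¹ *ᵥ vecTail w < w 0 then
      (Real.exp (-w 0) : ℂ) * ((G₂.F.p () * (symMat d).det *
        (w 0 - vecTail w ⬝ᵥ (symMat d)⁻¹ *ᵥ vecTail w) : ℝ) : ℂ) ^ b else 0 with hR
  set H : Coord m × (Fin (m + 1) → ℝ) → ℂ := fun z =>
    (G₂.F.D ()).indicator (fun d => K₂ d * R d z.2) z.1 with hH
  have posDef_of_mem : ∀ d ∈ G₂.F.D (), (symMat d).PosDef := fun d hd => by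
    have : (symMat d + 0).PosDef := hd.1
    rwa [add_zero] at this
  -- For a fixed lower block d, the Schur complement expresses positivity of u as a lower bound on
  -- the corner entry, and det u as the Schur complement times det d. The exponent splits because
  -- the limit of y is block diagonal.
  have e1 : (limD G₂).indicator (limK G₂ a b) = fun c => H (splitRow c) := by
    ext c
    rw [splitRow_apply]
    simp only [hH]
    by_cases hd : lowerBlock c ∈ G₂.F.D ()
    · have hpd := posDef_of_mem _ hd
      have hs : (symMat (lowerBlock c)).IsSymm := by simpa [IsHermitian, IsSymm] using hpd.1
      have htail : vecTail (fun i => c s(0, i)) = fun j => c s(0, j.succ) := rfl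
      rw [Set.indicator_of_mem hd]
      simp only [hR, htail]
      have hiff : c ∈ limD G₂ ↔ (fun j : Fin m => c s(0, j.succ)) ⬝ᵥ
          (symMat (lowerBlock c))⁻¹ *ᵥ (fun j => c s(0, j.succ)) < c s(0, 0) := by
        have : c ∈ limD G₂ ↔ (symMat c).PosDef := ⟨fun h => h.1, fun h => ⟨h, hd⟩⟩
        rw [this, symMat_eq_blockSym, posDef_blockSym_iff]
        exact and_iff_right hpd
      by_cases hc : c ∈ limD G₂
      · rw [Set.indicator_of_mem hc, if_pos (hiff.1 hc), limK]
        conv_lhs => rw [symMat_eq_blockSym c, trace_blockSym_mul,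
          det_blockSym hs hpd.det_pos.ne']
        simp only [hK₂, dotProduct_zero, mul_zero, add_zero, mul_one, neg_add, Real.exp_add]
        rw [show G₂.F.p () * ((c s(0, 0) - (fun j : Fin m => c s(0, j.succ)) ⬝ᵥ
          (symMat (lowerBlock c))⁻¹ *ᵥ (fun j => c s(0, j.succ))) * (symMat (lowerBlock c)).det) =
          G₂.F.p () * (symMat (lowerBlock c)).det * (c s(0, 0) - (fun j : Fin m => c s(0, j.succ))
          ⬝ᵥ (symMat (lowerBlock c))⁻¹ *ᵥ (fun j => c s(0, j.succ))) by ring]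
        push_cast
        ring
      · rw [Set.indicator_of_notMem hc, if_neg fun h => hc (hiff.2 h), mul_zero]
    · rw [Set.indicator_of_notMem hd, Set.indicator_of_notMem fun h => hd h.2]
  have e2 : limJ G₂ 1 a b = ∫ c, H (splitRow c) := by
    rw [← e1, integral_indicator hm]
    simp [limJ]
  have hHi : Integrable H := by
    rw [← measurePreserving_splitRow.integrable_comp_emb splitRow.measurableEmbedding]
    change Integrable fun c => H (splitRow c)
    rw [← e1]
    exact (integrable_indicator_iff hm).2 hint
  rw [e2, measurePreserving_splitRow.integral_comp' H, Measure.volume_eq_prod, integral_prod H hHi,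
    G₂.J_one, ← integral_const_mul, ← integral_indicator hD]
  refine integral_congr_ae (Eventually.of_forall fun d => ?_)
  simp only [hH]
  by_cases hd : d ∈ G₂.F.D ()
  · have hpd := posDef_of_mem _ hd
    have hκ := mul_pos hp hpd.det_pos
    simp only [Set.indicator_of_mem hd]
    rw [integral_const_mul, integral_row hpd hκ hb]
    have hk : G₂.F.k () a (b + 1 / 2) d = K₂ d *
        (((G₂.F.p () * (symMat d).det : ℝ) : ℂ) ^ b * (√(G₂.F.p () * (symMat d).det) : ℝ)) := by
      have hA : symMat d + G₂.F.A () = symMat d := add_zero _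
      rw [Real.sqrt_eq_rpow, Complex.ofReal_cpow hκ.le]
      unfold ConeFamily.k kern
      rw [hA, Complex.cpow_add _ _ (by exact_mod_cast hκ.ne')]
      simp only [hK₂, show G₂.F.y () = G₂.y () from rfl]
      push_cast
      ring
    -- The root of det d from the Gaussian integral becomes a root of p det d, which raises the
    -- exponent b by 1/2; the rest is the constant of the statement.
    have hsq : √(Real.pi ^ m * (symMat d).det) = √(Real.pi ^ m / G₂.F.p ()) *
        √(G₂.F.p () * (symMat d).det) := by
      rw [← Real.sqrt_mul (by positivity)]
      congr 1
      field_simp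
    rw [hk, hsq]
    push_cast
    ring
  · simp [Set.indicator_of_notMem hd]

end Degenerates

end Confluent

/-! ### The limit of the continued integrals -/

namespace Confluent
namespace Degenerates
variable {Λ : Type} {m : ℕ} {G : DiagFamily Λ (m + 1)} {G₂ : DiagFamily Unit m} {𝓕 : Filter Λ}

lemma integrableOn_limK (H : Degenerates G G₂ 𝓕) {a b : ℂ} (ha : 0 ≤ a.re) (hb : 0 ≤ b.re) :
    IntegrableOn (limK G₂ a b) (limD G₂) := by
  have hm := (isOpen_limD (G₂ := G₂)).measurableSet
  obtain ⟨φ, hφ, -, h, -⟩ := H.exists_dominating ha hb 1 0 zero_le_one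
  refine hφ.integrableOn.mono' ((continuousOn_limK a b).aestronglyMeasurable hm)
    ((ae_restrict_iff' hm).2 (Eventually.of_forall fun c hc => ?_))
  simpa using h c hc

/-- Raising b by 1/2 moves the index i to i + 1, and the larger family has one more positive entry
to account for it. -/
lemma shift_mem_goodSet (H : Degenerates G G₂ 𝓕) {z : ℂ × ℂ}
    (hz : z ∈ goodSet G.Vᶜ.card G.V.card) :
    ((z.1, z.2 + 1 / 2) : ℂ × ℂ) ∈ goodSet G₂.Vᶜ.card G₂.V.card := by
  rw [H.card_V, H.card_compl_V] at hz
  refine ⟨hz.1, fun i hi k h => hz.2 (i + 1) (by omega) k ?_⟩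
  rw [← h]
  push_cast
  ring

/-- The limit of the continued integrals. -/
lemma tendsto_cont [𝓕.NeBot] [𝓕.IsCountablyGenerated] (H : Degenerates G G₂ 𝓕) {z : ℂ × ℂ}
    (hz : z ∈ goodSet G.Vᶜ.card G.V.card) :
    Tendsto (fun l => G.cont l z) 𝓕 (𝓝 (Complex.Gamma (z.2 + 1) *
      (√(Real.pi ^ m / G₂.F.p ()) : ℝ) * G₂.cont () (z.1, z.2 + 1 / 2))) := by
  obtain ⟨N, hN⟩ := exists_nat_gt (max (-z.1.re) (-z.2.re))
  have h1 := (le_max_left _ _).trans_lt hN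
  have h2 := (le_max_right _ _).trans_lt hN
  obtain ⟨Ψ, hΨ, h⟩ := H.exists_tendsto_cont N
  suffices hs : Ψ z = Complex.Gamma (z.2 + 1) * (√(Real.pi ^ m / G₂.F.p ()) : ℝ) *
      G₂.cont () (z.1, z.2 + 1 / 2) by
    rw [← hs]
    exact h z hz (by linarith) (by linarith)
  -- Both sides are holomorphic in the exponents, and for positive real parts the limit is an honest
  -- integral, evaluated by `limJ_one`.
  refine eq_of_eq_large (x := -(N : ℝ)) (y := 0) (Ψ := fun z => Complex.Gamma (z.2 + 1) *
    (√(Real.pi ^ m / G₂.F.p ()) : ℝ) * G₂.cont () (z.1, z.2 + 1 / 2)) hΨ ?_ ?_ hz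
    (by linarith) (by linarith)
  · refine DifferentiableOn.mul (DifferentiableOn.mul_const (fun w hw => ?_) _) ?_
    · refine ((Complex.differentiableAt_Gamma (w.2 + 1) fun k hk => ?_).comp w
        (by fun_prop : DifferentiableAt ℂ (fun z : ℂ × ℂ => z.2 + 1) w)).differentiableWithinAt
      -- Index 0 is excluded in `goodSet` because the complement of V has at least one element; this
      -- removes exactly the poles of Γ(b + 1).
      refine hw.1.2 0 (by rw [H.card_compl_V]; omega) k ?_
      rw [hk]
      simp
    · refine (G₂.differentiableOn_cont ()).comp (f := fun z : ℂ × ℂ => (z.1, z.2 + 1 / 2)) ?_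
        fun w hw => H.shift_mem_goodSet hw.1
      exact (Differentiable.prodMk (by fun_prop) (by fun_prop)).differentiableOn
  · intro w hw1 hw2
    have hN0 : (0 : ℝ) ≤ N := Nat.cast_nonneg N
    have t1 := h w (mem_goodSet_of_re (by linarith) (by linarith)) (by linarith) (by linarith)
    have t2 := H.tendsto_J (f := 1) (g := 1) (one_mem _) (fun c _ => tendsto_const_nhds)
      hw1.le hw2.le
    have e : ∀ l, G.cont l w = G.F.J 1 l w.1 w.2 := fun l =>
      G.cont_eq_J l (by linarith) (by linarith)
    simp only [e] at t1
    rw [tendsto_nhds_unique t1 t2, limJ_one (by linarith) (H.integrableOn_limK hw1.le hw2.le),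
      G₂.cont_eq_J () (by simpa using by linarith) (by simp; linarith)]

end Degenerates
end Confluent

/-! ### Scaling by the square root of y₁, and the case T₁ > 0 -/

namespace Confluent

section Scaling
variable {m : ℕ}

/-- T₁ is split off by completing the square. The scalar s, with s² = 1/t, moves the factor t from
y₁ into the first diagonal entry of the transformed T. -/
lemma blockSym_eq_scaled {T₁ s t : ℝ} {T₁₂ : Fin m → ℝ} {T₂ V : Matrix (Fin m) (Fin m) ℝ}
    {e : Fin m → ℝ} (hT₁ : T₁ ≠ 0) (hst : s * s * t = 1)
    (hV : T₂ - T₁⁻¹ • vecMulVec T₁₂ T₁₂ = V * diagonal e * Vᵀ) :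
    blockSym T₁ T₁₂ T₂ = blockMat s 0 (s • T₁⁻¹ • T₁₂) V * diagonal (vecCons (T₁ * t) e) *
      (blockMat s 0 (s • T₁⁻¹ • T₁₂) V)ᵀ := by
  rw [diagonal_cons, blockMat_transpose, blockMat_mul, blockMat_mul, blockSym_eq]
  have h1 : ∀ x, s * (T₁ * t) * (s * (T₁⁻¹ * x)) = x := fun x => by
    field_simp
    linear_combination x * hst
  refine blockMat_ext ?_ (fun j => ?_) (fun i => ?_) (fun i j => ?_)
  · simp
    linear_combination (-T₁) * hst
  · simp [h1]
  · simp
    linear_combination -(h1 (T₁₂ i))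
  · have h2 := congrFun (congrFun hV i) j
    simp only [Matrix.sub_apply, Matrix.smul_apply, vecMulVec_apply, smul_eq_mul] at h2
    simp [vecMulVec_apply, ← h2]
    have h3 : s * (T₁⁻¹ * T₁₂ i) * (T₁ * t) * (s * (T₁⁻¹ * T₁₂ j)) =
        T₁⁻¹ * (T₁₂ i * T₁₂ j) := by
      field_simp
      linear_combination (T₁₂ i * T₁₂ j) * hst
    linear_combination -h3

/-- With s² = 1/y₁ the corner tends to 1, the off-diagonal part is of order s and tends to 0, and
the lower block does not change. -/
lemma conj_blockSym {s y₁ : ℝ} {c y₁₂ : Fin m → ℝ} {y₂ V : Matrix (Fin m) (Fin m) ℝ}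
    (hy : y₂.IsSymm) :
    (blockMat s 0 (s • c) V)ᵀ * blockSym y₁ y₁₂ y₂ * blockMat s 0 (s • c) V =
      blockSym (s * s * (y₁ + (2 * (c ⬝ᵥ y₁₂) + c ⬝ᵥ y₂ *ᵥ c)))
        (s • Vᵀ *ᵥ (y₁₂ + y₂ *ᵥ c)) (Vᵀ * y₂ * V) := by
  have hc : c ᵥ* y₂ = y₂ *ᵥ c := by rw [← mulVec_transpose, hy.eq]
  rw [blockMat_transpose, blockSym_eq, blockMat_mul, blockMat_mul, blockSym_eq]
  refine blockMat_ext ?_ (fun j => ?_) (fun i => ?_) (fun i j => ?_)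
  · simp only [blockMat_zero_zero, smul_dotProduct, smul_vecMul, hc, dotProduct_smul,
      add_dotProduct, smul_eq_mul]
    rw [dotProduct_comm y₁₂ c, dotProduct_comm (y₂ *ᵥ c) c]
    ring
  · simp only [blockMat_zero_succ, smul_vecMul, hc, mulVec_transpose, ← smul_add]
    simp
  · simp only [blockMat_succ_zero, smul_zero, zero_add, mulVec_add, mulVec_smul,
      vecMulVec_zero, zero_vecMulVec]
    simp [mulVec_mulVec]
    ring
  · simp

/-- All powers of t cancel. With a = α - ρ and b = β - ρ, the Jacobian gives t^{-ρ} because ρ = (m +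
2)/2, the squared determinant gives t^{-(a+b)}, and the normalization q gives t^a; together with t^β
the exponent is 0. -/
lemma scaled_power {t D T q : ℝ} (ht : 0 < t) (hT : 0 < T) (hq : 0 < q) (α β : ℂ) :
    (t : ℂ) ^ β * ((|(√t)⁻¹ * D| ^ (m + 1 + 1) : ℝ) *
      (((((√t)⁻¹ * D) ^ 2 : ℝ) : ℂ) ^ (α - rho (m + 1) + (β - rho (m + 1))) *
        ((((T * t)⁻¹ * q)⁻¹ : ℝ) : ℂ) ^ (α - rho (m + 1)))) =
    (|D| ^ (m + 1 + 1) : ℝ) * (((D ^ 2 : ℝ) : ℂ) ^ (α - rho (m + 1) + (β - rho (m + 1))) *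
      ((T : ℂ) ^ (α - rho (m + 1)) * ((q⁻¹ : ℝ) : ℂ) ^ (α - rho (m + 1)))) := by
  have ht0 : (t : ℂ) ≠ 0 := by exact_mod_cast ht.ne'
  set a : ℂ := α - rho (m + 1)
  set b : ℂ := β - rho (m + 1) with hb
  have e1 : (t : ℂ) ^ β = (t : ℂ) ^ (rho (m + 1) : ℂ) * (t : ℂ) ^ b := by
    rw [← Complex.cpow_add _ _ ht0, hb, add_sub_cancel]
  have e2 : ((((√t)⁻¹ * D) ^ 2 : ℝ) : ℂ) ^ (a + b) =
      ((D ^ 2 : ℝ) : ℂ) ^ (a + b) * ((t : ℂ) ^ a * (t : ℂ) ^ b)⁻¹ := by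
    rw [← Complex.cpow_add _ _ ht0, mul_pow, inv_pow, Real.sq_sqrt ht.le, mul_comm,
      Complex.ofReal_mul, Complex.mul_cpow_ofReal_nonneg (sq_nonneg D) (inv_nonneg.2 ht.le),
      Complex.ofReal_inv, Complex.inv_cpow _ _ (by
        rw [Complex.arg_ofReal_of_nonneg ht.le]
        exact Real.pi_ne_zero.symm)]
  have e3 : ((((T * t)⁻¹ * q)⁻¹ : ℝ) : ℂ) ^ a =
      (T : ℂ) ^ a * (t : ℂ) ^ a * ((q⁻¹ : ℝ) : ℂ) ^ a := by
    rw [mul_inv, inv_inv, Complex.ofReal_mul,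
      Complex.mul_cpow_ofReal_nonneg (mul_pos hT ht).le (inv_nonneg.2 hq.le), Complex.ofReal_mul,
      Complex.mul_cpow_ofReal_nonneg hT.le ht.le]
  have e4 : ((|(√t)⁻¹ * D| ^ (m + 1 + 1) : ℝ) : ℂ) =
      (|D| ^ (m + 1 + 1) : ℝ) * ((t : ℂ) ^ (rho (m + 1) : ℂ))⁻¹ := by
    rw [abs_mul, abs_of_pos (inv_pos.2 (Real.sqrt_pos.2 ht)), mul_pow, inv_pow, mul_comm,
      Complex.ofReal_mul, Complex.ofReal_inv]
    congr 2
    rw [Real.sqrt_eq_rpow, ← Real.rpow_natCast, ← Real.rpow_mul ht.le, Complex.ofReal_cpow ht.le]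
    congr 2
    unfold rho
    push_cast
    ring
  rw [e1, e2, e3, e4]
  have h1 : (t : ℂ) ^ a ≠ 0 := Complex.cpow_ne_zero_iff.2 (Or.inl ht0)
  have h2 : (t : ℂ) ^ b ≠ 0 := Complex.cpow_ne_zero_iff.2 (Or.inl ht0)
  have h3 : (t : ℂ) ^ (rho (m + 1) : ℂ) ≠ 0 := Complex.cpow_ne_zero_iff.2 (Or.inl ht0)
  field_simp

end Scaling

section Pos
variable {m : ℕ} {T₁ : ℝ} {T₁₂ y₁₂ : Fin m → ℝ} {T₂ y₂ : Matrix (Fin m) (Fin m) ℝ}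

lemma isSymm_schur (hT₂ : T₂.IsSymm) : (T₂ - T₁⁻¹ • vecMulVec T₁₂ T₁₂).IsSymm := by
  refine hT₂.sub (IsSymm.smul ?_ _)
  ext i j
  simp [vecMulVec_apply, mul_comm]

lemma det_schur_ne_zero (hT₁ : T₁ ≠ 0) (hT : (blockSym T₁ T₁₂ T₂).det ≠ 0) :
    (T₂ - T₁⁻¹ • vecMulVec T₁₂ T₁₂).det ≠ 0 := by
  intro h
  refine hT ?_
  have e : blockSym T₁ T₁₂ T₂ = blockMat 1 0 (T₁⁻¹ • T₁₂) 1 *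
      blockMat T₁ 0 0 (T₂ - T₁⁻¹ • vecMulVec T₁₂ T₁₂) * (blockMat 1 0 (T₁⁻¹ • T₁₂) 1)ᵀ := by
    rw [blockMat_transpose, blockMat_mul, blockMat_mul, blockSym_eq]
    refine blockMat_ext ?_ (fun j => ?_) (fun i => ?_) (fun i j => ?_)
    · simp
    · simp [hT₁]
    · simp [hT₁]
    · simp [vecMulVec_apply]
      field_simp
      ring
  rw [e, det_mul, det_mul, det_blockMat_zero, det_blockMat_zero, h]
  simp

end Pos

end Confluent

namespace Confluent

section Pos
variable {m : ℕ} {T₁ : ℝ} {T₁₂ y₁₂ : Fin m → ℝ} {T₂ y₂ : Matrix (Fin m) (Fin m) ℝ}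

/-- The scaled diagonal family of `blockSym T₁ T₁₂ T₂`. -/
noncomputable def DiagFamily.scaled {y₀ : ℝ} (hy₀ : 0 < y₀) (hT₁ : 0 < T₁) {e : Fin m → ℝ}
    (he : ∀ i, e i ≠ 0) {y : {t : ℝ // y₀ ≤ t} → Matrix (Fin (m + 1)) (Fin (m + 1)) ℝ}
    (hy : ∀ l, (y l).PosDef) : DiagFamily {t : ℝ // y₀ ≤ t} (m + 1) where
  E l := vecCons (2 * T₁ * l.1) fun i => 2 * e i
  V := (Finset.univ.filter fun i => e i < 0).map (Fin.succEmb m)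
  y := y
  hneg l k hk := by
    obtain ⟨i, hi, rfl⟩ := Finset.mem_map.1 hk
    have := (Finset.mem_filter.1 hi).2
    change 2 * e i < 0
    linarith
  hpos l k hk := by
    revert hk
    refine Fin.cases (fun _ => ?_) (fun i hk => ?_) k
    · have := hy₀.trans_le l.2
      change 0 < 2 * T₁ * l.1
      positivity
    · have h1 : ¬ e i < 0 := fun h =>
        hk (Finset.mem_map.2 ⟨i, Finset.mem_filter.2 ⟨Finset.mem_univ i, h⟩, rfl⟩)
      have := lt_of_le_of_ne (not_lt.1 h1) (he i).symm
      change 0 < 2 * e i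
      linarith
  hy := hy

lemma tendsto_eta_of_pos (hT₂ : T₂.IsSymm) (hT : (blockSym T₁ T₁₂ T₂).det ≠ 0)
    (hy₂ : y₂.PosDef) {α β : ℂ}
    (hαβ : (α, β) ∈ regularSet (m + 1) (negIndex (blockSym T₁ T₁₂ T₂))) (hT₁ : 0 < T₁) :
    Tendsto (fun y₁ : ℝ => (Real.exp (T₁ * y₁) : ℂ) * (y₁ : ℂ) ^ β *
      eta (m + 1) (blockSym y₁ y₁₂ y₂) (blockSym T₁ T₁₂ T₂) α β) atTop
      (𝓝 ((Real.exp (-2 * (T₁₂ ⬝ᵥ y₁₂) +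
            (((T₂ - T₁⁻¹ • vecMulVec T₁₂ T₁₂) - T₂) * y₂).trace) : ℂ) *
          Complex.Gamma (β + 1 - (rho (m + 1) : ℂ)) * (Real.pi : ℂ) ^ ((m : ℂ) / 2) *
          ((2 * T₁ : ℝ) : ℂ) ^ (α - (rho (m + 1) : ℂ)) *
          eta m y₂ (T₂ - T₁⁻¹ • vecMulVec T₁₂ T₁₂) (α - 1 / 2) β)) := by
  set S := T₂ - T₁⁻¹ • vecMulVec T₁₂ T₁₂ with hS
  obtain ⟨V, e, hV, he, hSV⟩ :=
    exists_diagonalization (isSymm_schur (T₁ := T₁) (T₁₂ := T₁₂) hT₂) (det_schur_ne_zero hT₁.ne' hT)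
  have hy₂s : y₂.IsSymm := by simpa [IsHermitian, IsSymm] using hy₂.1
  set x := T₁⁻¹ • T₁₂ with hx
  -- Besides positivity of y, the threshold ensures that the first entry 2 T₁ y₁ of E is at least 1.
  set y₀ : ℝ := max (max 1 (2 * T₁)⁻¹) (y₁₂ ⬝ᵥ y₂⁻¹ *ᵥ y₁₂ + 1) with hy₀
  have hy₀1 : 1 ≤ y₀ := (le_max_left _ _).trans (le_max_left _ _)
  have hy₀2 : (2 * T₁)⁻¹ ≤ y₀ := (le_max_right _ _).trans (le_max_left _ _)
  have hpos : ∀ t, y₀ ≤ t → (blockSym t y₁₂ y₂).PosDef := fun t ht => posDef_blockSym_iff.2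
    ⟨hy₂, by linarith [le_max_right (max 1 (2 * T₁)⁻¹) (y₁₂ ⬝ᵥ y₂⁻¹ *ᵥ y₁₂ + 1)]⟩
  have hl0 : ∀ l : {t : ℝ // y₀ ≤ t}, 0 < l.1 := fun l => by linarith [l.2]
  -- The first column completes the square for T₁ and carries the scaling y₁^{-1/2}; V diagonalizes
  -- the Schur complement.
  set h : {t : ℝ // y₀ ≤ t} → Matrix (Fin (m + 1)) (Fin (m + 1)) ℝ :=
    fun l => blockMat (√l.1)⁻¹ 0 ((√l.1)⁻¹ • x) V with hh_def
  have hdet : ∀ l, (h l).det = (√l.1)⁻¹ * V.det := fun l => det_blockMat_zero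
  have hh : ∀ l, (h l).det ≠ 0 := fun l => by
    rw [hdet]
    exact mul_ne_zero (inv_ne_zero (Real.sqrt_pos.2 (hl0 l)).ne') hV
  have hss : ∀ l : {t : ℝ // y₀ ≤ t}, (√l.1)⁻¹ * (√l.1)⁻¹ = l.1⁻¹ := fun l => by
    rw [← mul_inv, Real.mul_self_sqrt (hl0 l).le]
  set G : DiagFamily {t : ℝ // y₀ ≤ t} (m + 1) := DiagFamily.scaled (y₀ := y₀) (by linarith) hT₁ he
    (y := fun l => (h l)ᵀ * blockSym l.1 y₁₂ y₂ * h l)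
    (fun l => posDef_conj_transpose (hh l) (hpos l.1 l.2)) with hG
  set G₂ : DiagFamily Unit m := DiagFamily.ofDiagonal he (y := fun _ => Vᵀ * y₂ * V)
    (fun _ => posDef_conj_transpose hV hy₂) with hG₂
  have hTG : ∀ l, blockSym T₁ T₁₂ T₂ = h l * diagonal (fun i => G.E l i / 2) * (h l)ᵀ := fun l => by
    have e1 : (fun i => G.E l i / 2) = vecCons (T₁ * l.1) e := by
      ext i
      refine Fin.cases ?_ (fun i => ?_) i
      · change 2 * T₁ * l.1 / 2 = T₁ * l.1
        ring
      · change 2 * e i / 2 = e i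
        ring
    rw [e1]
    exact blockSym_eq_scaled hT₁.ne' (by rw [hss]; exact inv_mul_cancel₀ (hl0 l).ne') hSV
  have hTG₂ : S = V * diagonal (fun i => G₂.E () i / 2) * Vᵀ := by
    refine hSV.trans ?_
    simp [hG₂, DiagFamily.ofDiagonal]
  have hyG : ∀ l, G.y l = (h l)ᵀ * blockSym l.1 y₁₂ y₂ * h l := fun l => rfl
  have hyG' : ∀ l, G.y l = blockSym (1 + l.1⁻¹ * (2 * (x ⬝ᵥ y₁₂) + x ⬝ᵥ y₂ *ᵥ x))
      ((√l.1)⁻¹ • Vᵀ *ᵥ (y₁₂ + y₂ *ᵥ x)) (Vᵀ * y₂ * V) := fun l => by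
    rw [hyG, conj_blockSym hy₂s, hss, mul_add, inv_mul_cancel₀ (hl0 l).ne']
  set lt : ℝ → {t : ℝ // y₀ ≤ t} := fun t => ⟨max t y₀, le_max_right t y₀⟩ with hlt
  have hltv : ∀ t, y₀ ≤ t → (lt t).1 = t := fun t ht => max_eq_left ht
  have hltt : Tendsto (fun t => (lt t).1) atTop atTop :=
    tendsto_id.congr' ((eventually_ge_atTop y₀).mono fun t ht => (hltv t ht).symm)
  have hinv : Tendsto (fun l : {t : ℝ // y₀ ≤ t} => l.1⁻¹) (map lt atTop) (𝓝 0) :=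
    tendsto_map'_iff.2 hltt.inv_tendsto_atTop
  have hsqrt : Tendsto (fun l : {t : ℝ // y₀ ≤ t} => (√l.1)⁻¹) (map lt atTop) (𝓝 0) :=
    tendsto_map'_iff.2 (Real.tendsto_sqrt_atTop.comp hltt).inv_tendsto_atTop
  have hinv1 : ∀ l : {t : ℝ // y₀ ≤ t}, |l.1⁻¹| ≤ 1 := fun l => by
    rw [abs_of_pos (inv_pos.2 (hl0 l))]
    exact inv_le_one_of_one_le₀ (hy₀1.trans l.2)
  have hsqrt1 : ∀ l : {t : ℝ // y₀ ≤ t}, |(√l.1)⁻¹| ≤ 1 := fun l => by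
    rw [abs_of_pos (inv_pos.2 (Real.sqrt_pos.2 (hl0 l)))]
    exact inv_le_one_of_one_le₀ (Real.one_le_sqrt.2 (hy₀1.trans l.2))
  -- The filter of large y₁ is transported to the parameter space by truncation below at y₀, which
  -- changes nothing eventually.
  have H : Degenerates G G₂ (map lt atTop) := by
    refine ⟨fun l => ?_, fun l k => rfl, rfl, ?_, fun i j => ?_, fun i j => ?_⟩
    · change 1 ≤ 2 * T₁ * l.1
      have := mul_le_mul_of_nonneg_left (hy₀2.trans l.2) (by positivity : 0 ≤ 2 * T₁)
      rwa [mul_inv_cancel₀ (by positivity)] at this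
    · exact tendsto_map'_iff.2 (hltt.const_mul_atTop (by positivity : 0 < 2 * T₁))
    · simp only [hyG', blockSym_eq]
      have t1 : ∀ k : Fin m, Tendsto (fun l : {t : ℝ // y₀ ≤ t} =>
          ((√l.1)⁻¹ • Vᵀ *ᵥ (y₁₂ + y₂ *ᵥ x)) k) (map lt atTop) (𝓝 0) := fun k => by
        simpa using hsqrt.mul_const ((Vᵀ *ᵥ (y₁₂ + y₂ *ᵥ x)) k)
      refine Fin.cases (Fin.cases ?_ (fun j => ?_) j) (fun i => Fin.cases ?_ (fun j => ?_) j) i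
      · simpa using (hinv.mul_const (2 * (x ⬝ᵥ y₁₂) + x ⬝ᵥ y₂ *ᵥ x)).const_add 1
      · exact t1 j
      · exact t1 i
      · exact tendsto_const_nhds
    · simp only [hyG', blockSym_eq]
      have t1 : ∀ k : Fin m, ∃ C, ∀ l : {t : ℝ // y₀ ≤ t},
          |((√l.1)⁻¹ • Vᵀ *ᵥ (y₁₂ + y₂ *ᵥ x)) k| ≤ C := fun k => by
        refine ⟨|(Vᵀ *ᵥ (y₁₂ + y₂ *ᵥ x)) k|, fun l => ?_⟩
        rw [Pi.smul_apply, smul_eq_mul, abs_mul]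
        exact mul_le_of_le_one_left (abs_nonneg _) (hsqrt1 l)
      refine Fin.cases (Fin.cases ?_ (fun j => ?_) j) (fun i => Fin.cases ?_ (fun j => ?_) j) i
      · refine ⟨1 + |2 * (x ⬝ᵥ y₁₂) + x ⬝ᵥ y₂ *ᵥ x|, fun l => (abs_add_le _ _).trans ?_⟩
        rw [abs_one, abs_mul]
        exact add_le_add_right (mul_le_of_le_one_left (abs_nonneg _) (hinv1 l)) 1
      · exact t1 j
      · exact t1 i
      · exact ⟨|(Vᵀ * y₂ * V) i j|, fun l => le_of_eq rfl⟩
  set l₀ : {t : ℝ // y₀ ≤ t} := ⟨y₀, le_rfl⟩ with hl₀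
  have hz := (DiagFamily.mem_regularSet (hh l₀) (hTG l₀) (α, β)).1 hαβ
  -- Since ρ decreases by 1/2 with the size, α - 1/2 - ρ_m = α - ρ_{m+1} and β - ρ_m = β - ρ_{m+1} +
  -- 1/2. This is the shift of b by 1/2 from the Gaussian integral.
  have hz₂ : ((α - 1 / 2, β) : ℂ × ℂ) ∈ regularSet m (negIndex S) := by
    rw [DiagFamily.mem_regularSet hV hTG₂]
    convert H.shift_mem_goodSet hz using 2
    · simp only [rho]; push_cast; ring
    · simp only [rho]; push_cast; ring
  have hlim := tendsto_map'_iff.1 (H.tendsto_cont hz)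
  have hp := G₂.F.hp ()
  have hq := G₂.F.hq ()
  set a : ℂ := α - rho (m + 1) with ha
  set b : ℂ := β - rho (m + 1) with hb
  have ea : α - 1 / 2 - rho m = a := by simp only [ha, rho]; push_cast; ring
  have eb : β - rho m = b + 1 / 2 := by simp only [hb, rho]; push_cast; ring
  set κ : ℂ := (Real.exp (-(2 * (T₁₂ ⬝ᵥ y₁₂) + (T₂ * y₂).trace)) : ℂ) *
    ((|V.det| ^ (m + 1 + 1) : ℝ) * (((V.det ^ 2 : ℝ) : ℂ) ^ (a + b) *
      (((2 * T₁ : ℝ) : ℂ) ^ a * (((G₂.F.q ())⁻¹ : ℝ) : ℂ) ^ a)) *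
        (((G₂.F.p ())⁻¹ : ℝ) : ℂ) ^ b) with hκ
  have hfin := hlim.const_mul κ
  -- Matching with the factor of the smaller η: the extra 1/2 in the exponent of det(V)² supplies
  -- the missing factor |det V| of the Jacobian, and the extra 1/2 in the exponent of 1/p supplies
  -- the root left from √(π^m / p). The factor e^{-tr(S y₂)} of the smaller η is compensated by
  -- e^{tr(S y₂)}.
  have hval : κ * (Complex.Gamma (b + 1) * (√(Real.pi ^ m / G₂.F.p ()) : ℝ) *
      G₂.cont () (a, b + 1 / 2)) = (Real.exp (-2 * (T₁₂ ⬝ᵥ y₁₂) + ((S - T₂) * y₂).trace) : ℂ) *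
          Complex.Gamma (β + 1 - (rho (m + 1) : ℂ)) * (Real.pi : ℂ) ^ ((m : ℂ) / 2) *
          ((2 * T₁ : ℝ) : ℂ) ^ a * eta m y₂ S (α - 1 / 2) β := by
    rw [DiagFamily.eta_eq hV hTG₂ (l := ()) (y := y₂) rfl hz₂, ea, eb, DiagFamily.factor,
      show G₂.y () = Vᵀ * y₂ * V from rfl, trace_diagonal_conj hTG₂,
      show β + 1 - (rho (m + 1) : ℂ) = b + 1 by rw [hb]; ring, hκ, sub_mul, trace_sub,
      show -2 * (T₁₂ ⬝ᵥ y₁₂) + ((S * y₂).trace - (T₂ * y₂).trace) =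
        -(2 * (T₁₂ ⬝ᵥ y₁₂) + (T₂ * y₂).trace) + (S * y₂).trace by ring, Real.exp_add,
      Real.exp_neg (S * y₂).trace]
    have hV2 : 0 < V.det ^ 2 := by positivity
    have f1 : ((V.det ^ 2 : ℝ) : ℂ) ^ (a + (b + 1 / 2)) =
        ((V.det ^ 2 : ℝ) : ℂ) ^ (a + b) * (|V.det| : ℝ) := by
      rw [← add_assoc, Complex.cpow_add _ _ (by exact_mod_cast hV2.ne'), ← Real.sqrt_sq_eq_abs,
        Real.sqrt_eq_rpow, Complex.ofReal_cpow hV2.le]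
      norm_num
    have f2 : (((G₂.F.p ())⁻¹ : ℝ) : ℂ) ^ (b + 1 / 2) =
        (((G₂.F.p ())⁻¹ : ℝ) : ℂ) ^ b * (√(G₂.F.p ())⁻¹ : ℝ) := by
      rw [Complex.cpow_add _ _ (by exact_mod_cast (inv_pos.2 hp).ne'), Real.sqrt_eq_rpow,
        Complex.ofReal_cpow (inv_pos.2 hp).le]
      norm_num
    have f3 : ((√(Real.pi ^ m / G₂.F.p ()) : ℝ) : ℂ) =
        (Real.pi : ℂ) ^ ((m : ℂ) / 2) * (√(G₂.F.p ())⁻¹ : ℝ) := by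
      rw [div_eq_mul_inv, Real.sqrt_mul (by positivity), Complex.ofReal_mul, Real.sqrt_eq_rpow,
        ← Real.rpow_natCast, ← Real.rpow_mul Real.pi_pos.le, Complex.ofReal_cpow Real.pi_pos.le]
      congr 2
      push_cast
      ring
    have f4 : (Real.exp (S * y₂).trace : ℂ) * ((Real.exp (S * y₂).trace)⁻¹ : ℝ) = 1 := by
      rw [← Complex.ofReal_mul, mul_inv_cancel₀ (Real.exp_pos _).ne', Complex.ofReal_one]
    rw [f1, f2, f3, pow_succ _ (m + 1)]
    generalize ((2 * T₁ : ℝ) : ℂ) ^ a = Q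
    generalize ((V.det ^ 2 : ℝ) : ℂ) ^ (a + b) = R
    simp only [Complex.ofReal_mul]
    linear_combination (-(Real.exp (-(2 * (T₁₂ ⬝ᵥ y₁₂) + (T₂ * y₂).trace)) : ℂ) *
      ((|V.det| ^ (m + 1) : ℝ) * (|V.det| : ℝ) * (R *
      (Q * (((G₂.F.q ())⁻¹ : ℝ) : ℂ) ^ a)) *
        (((G₂.F.p ())⁻¹ : ℝ) : ℂ) ^ b) * (Complex.Gamma (b + 1) * ((Real.pi : ℂ) ^ ((m : ℂ) / 2) *
        (√(G₂.F.p ())⁻¹ : ℝ)) * G₂.cont () (a, b + 1 / 2))) * f4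
  rw [hval] at hfin
  refine hfin.congr' ?_
  filter_upwards [eventually_ge_atTop y₀] with t ht
  have ht0 : 0 < t := by linarith
  have e0 : blockSym t y₁₂ y₂ = blockSym (lt t).1 y₁₂ y₂ := by rw [hltv t ht]
  rw [e0, DiagFamily.eta_eq (hh (lt t)) (hTG (lt t)) (hyG (lt t)) hαβ, DiagFamily.factor, hyG,
    trace_diagonal_conj (hTG (lt t)), trace_blockSym_mul, hdet, H.q_eq, H.p_eq,
    show G.E (lt t) 0 = 2 * T₁ * (lt t).1 from rfl, hltv t ht, Function.comp_apply]
  -- After the powers of y₁ have been removed, only e^{T₁ y₁} e^{-T₁ y₁} = 1 remains.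
  have hsp := scaled_power (m := m) (D := V.det) ht0 (by positivity : 0 < 2 * T₁) hq α β
  rw [← ha, ← hb] at hsp
  rw [hκ, ← hsp, show -(T₁ * t + 2 * (T₁₂ ⬝ᵥ y₁₂) + (T₂ * y₂).trace) =
    -(T₁ * t) + -(2 * (T₁₂ ⬝ᵥ y₁₂) + (T₂ * y₂).trace) by ring, Real.exp_add, Real.exp_neg (T₁ * t)]
  have e2 : (Real.exp (T₁ * t) : ℂ) * ((Real.exp (T₁ * t))⁻¹ : ℝ) = 1 := by
    rw [← Complex.ofReal_mul, mul_inv_cancel₀ (Real.exp_pos _).ne', Complex.ofReal_one]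
  rw [Complex.ofReal_mul (Real.exp (T₁ * t))⁻¹]
  generalize ((((2 * T₁ * t)⁻¹ * G₂.F.q ())⁻¹ : ℝ) : ℂ) ^ a = Q
  generalize (((G₂.F.p ())⁻¹ : ℝ) : ℂ) ^ b = P
  generalize (((((√t)⁻¹ * V.det) ^ 2 : ℝ) : ℂ)) ^ (a + b) = R
  generalize ((|(√t)⁻¹ * V.det| ^ (m + 1 + 1) : ℝ) : ℂ) = W
  generalize (Real.exp (-(2 * (T₁₂ ⬝ᵥ y₁₂) + (T₂ * y₂).trace)) : ℂ) = X at *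
  generalize ((Real.exp (T₁ * t))⁻¹ : ℝ) = Y at *
  linear_combination (-X * ((t : ℂ) ^ β * (W * (R * Q))) * P * G.cont (lt t) (a, b)) * e2

end Pos

end Confluent
theorem theorem4p9 (m : ℕ) (T₁ : ℝ) (T₁₂ : Fin m → ℝ) (T₂ : Matrix (Fin m) (Fin m) ℝ)
    (hT₂ : T₂.IsSymm) (hT : (Confluent.blockSym T₁ T₁₂ T₂).det ≠ 0)
    (y₁₂ : Fin m → ℝ) (y₂ : Matrix (Fin m) (Fin m) ℝ) (hy₂ : y₂.PosDef) :
    (∀ y₁ : ℝ, (Confluent.blockSym y₁ y₁₂ y₂).PosDef →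
      Confluent.EtaDefined (m + 1) (Confluent.blockSym y₁ y₁₂ y₂)
        (Confluent.blockSym T₁ T₁₂ T₂)) ∧
    (0 < T₁ → Confluent.EtaDefined m y₂ (T₂ - T₁⁻¹ • Matrix.vecMulVec T₁₂ T₁₂)) ∧
    ∀ α β : ℂ,
      (α, β) ∈ Confluent.regularSet (m + 1)
        (Confluent.negIndex (Confluent.blockSym T₁ T₁₂ T₂)) →
      (T₁ ≤ 0 →
        Tendsto (fun y₁ : ℝ => (Real.exp (T₁ * y₁) : ℂ) * (y₁ : ℂ) ^ β *
            Confluent.eta (m + 1) (Confluent.blockSym y₁ y₁₂ y₂)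
              (Confluent.blockSym T₁ T₁₂ T₂) α β)
          atTop (𝓝 0)) ∧
      (0 < T₁ →
        Tendsto (fun y₁ : ℝ => (Real.exp (T₁ * y₁) : ℂ) * (y₁ : ℂ) ^ β *
            Confluent.eta (m + 1) (Confluent.blockSym y₁ y₁₂ y₂)
              (Confluent.blockSym T₁ T₁₂ T₂) α β)
          atTop
          (𝓝 ((Real.exp (-2 * (T₁₂ ⬝ᵥ y₁₂) +
                (((T₂ - T₁⁻¹ • Matrix.vecMulVec T₁₂ T₁₂) - T₂) * y₂).trace) : ℂ) *
              Complex.Gamma (β + 1 - (Confluent.rho (m + 1) : ℂ)) *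
              (Real.pi : ℂ) ^ ((m : ℂ) / 2) *
              ((2 * T₁ : ℝ) : ℂ) ^ (α - (Confluent.rho (m + 1) : ℂ)) *
              Confluent.eta m y₂ (T₂ - T₁⁻¹ • Matrix.vecMulVec T₁₂ T₁₂)
                (α - 1 / 2) β))) := by
  refine ⟨fun y₁ hy => Confluent.etaDefined_of_posDef (Confluent.blockSym_isSymm hT₂) hT hy,
    fun hT₁ => Confluent.etaDefined_of_posDef (Confluent.isSymm_schur hT₂)
      (Confluent.det_schur_ne_zero hT₁.ne' hT) hy₂,
    fun α β hαβ => ⟨fun hT₁ => Confluent.tendsto_eta_of_nonpos hT₂ hT hy₂ hαβ hT₁,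
      fun hT₁ => Confluent.tendsto_eta_of_pos hT₂ hT hy₂ hαβ hT₁⟩⟩
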